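/- **Setting.** Let $n\ge 2$ and let $\mathbb G$ be a toroidal grid diagram of index $n$, with horizontal circles $\alpha_1,\dots,\alpha_n$, vertical circles $\beta_1,\dots,\beta_n$ and markings $O_1,\dots,O_n$, exactly one in each row and in each column; $H_j$ and $V_j$ are the horizontal and the vertical annulus through $O_j$. Generators are permutations $x\in S_n$, viewed as the $n$ points $\beta_i\cap\alpha_{x(i)}$. A positive domain $D$ from $x$ to $y$ is a combination of the square regions with nonnegative integer coefficients and $\partial(\partial D\cap\alpha)=y-x$; $\mu(D)$ is its Maslov index and $c_x$ is the constant domain at $x$. $\mathit{CDP}_*$ is the complex over $\mathbb Z/2$ freely generated by the triples $(D,\vec N,\vec\lambda)$, where $D$ is a positive domain, $\vec N\in\mathbb N^n$, and $\lambda_j$ is an ordered partition of $N_j$ for each $j$. Its grading is $\mu(D)$ plus the total number of parts of $\vec\lambda$. Its differential is the sum of all terms obtained by 1. removing a rectangle from the beginning or from the end of $D$; 2. removing $H_j$ or $V_j$ from $D$ and inserting a part $1$ into $\lambda_j$ at any one of its positions (counted once for every position); 3. adding two consecutive parts of some $\lambda_j$; 4. deleting the first part or deleting the last part of some nonempty $\lambda_j$.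 $\mathit{CDP}^0_*$ is the subcomplex spanned by the triples whose domain has coefficient $0$ at $O_1$. Cochains have values in $\mathbb Z/2$. Fix a 3-cochain $\mathfrak o_2$ on the complex under consideration (in the case of interest, the obstruction cochain: its value on a triple is the class, in the framed cobordism group $\tilde\Omega^1_{fr}\cong\mathbb Z/2$, of the boundary of the two-dimensional moduli space of the triple when all one-dimensional moduli spaces carry their preferred framings). A *frame assignment* is a 2-cochain $f$ with $\delta f=\mathfrak o_2$. For $j<k$ write $f_{jk}=f(c_{\mathrm{Id}},\vec e_j+\vec e_k,((1)_j,(1)_k))$. Let $U'$ denote a 2-cycle of $\mathit{CDP}_*$ in which each of the $2n$ annuli $H_j$, $V_j$ (without partitions) occurs at an odd number of generators $x$, and whose other terms are positive domains of Maslov index $2$ that are not annuli, without partitions, and rectangles with exactly one part in $\vec\lambda$. **Proposition 8.1.** For every 3-cochain $\mathfrak o_2$ a frame assignment is unique up to the values below and 1-coboundaries. Precisely: (a) Cycles $U'$ as above exist. (b) Let $U'$ be any such cycle, $\mathfrak o_2$ any 3-cochain and $f$ a frame assignment on $\mathit{CDP}_*$. A 2-cochain $f'$ on $\mathit{CDP}_*$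 is a frame assignment with $f'_{jk}=f_{jk}$ for all $1\le j<k\le n$ and $f'(U')=f(U')$ if and only if $f'=f+\delta h$ for some 1-cochain $h$ on $\mathit{CDP}_*$. (c) Let $\mathfrak o_2$ be any 3-cochain and $f$ a frame assignment on $\mathit{CDP}^0_*$. A 2-cochain $f'$ on $\mathit{CDP}^0_*$ is a frame assignment with $f'_{jk}=f_{jk}$ for all $1\le j<k\le n$ if and only if $f'=f+\delta h$ for some 1-cochain $h$ on $\mathit{CDP}^0_*$. -/

import Mathlib

/-! Toroidal grid diagrams, positive domains with partitions, the complex they generate over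
`ZMod 2`, and its cochains.  Indices `1, …, n` are modelled by `Fin n`, with cyclic arithmetic. -/

noncomputable section

namespace GridCDP

/-- A grid diagram of index `n` on the torus: `O_j` lies in column `Ocol j` and row `Orow j`, and
`X_j` in column `Xcol j` and row `Xrow j`; each row and each column contains exactly one `O` and
exactly one `X`.  Column `c` lies between the vertical circles `β_c` and `β_{c+1}`, row `r` between
the horizontal circles `α_r` and `α_{r+1}`. -/
structure GridDiagram (n : ℕ) where
  Ocol : Equiv.Perm (Fin n)
  Orow : Equiv.Perm (Fin n)
  Xcol : Equiv.Perm (Fin n)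
  Xrow : Equiv.Perm (Fin n)

/-- A generator, as a permutation `x`: it consists of the points `β_c ∩ α_{x c}`. -/
abbrev Generator (n : ℕ) := Equiv.Perm (Fin n)

variable {n : ℕ} [NeZero n]

/-- Indicator function of the cyclic half-open interval `[i, j)` of `Fin n`. -/
def cyc (i j c : Fin n) : ℕ := if (c - i).val < (j - i).val then 1 else 0

/-- A positive domain from `x` to `y`: `coeff c r` is the multiplicity of the square in column `c`
and row `r`, whose lower left corner is `β_c ∩ α_r`.  The condition `∂(∂D ∩ α) = y - x` is read off
at the point `β_c ∩ α_r`: (NW + SE) - (NE + SW) equals the multiplicity of the point in `y` minus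
that in `x`. -/
@[ext]
structure PosDomain (n : ℕ) [NeZero n] where
  x : Generator n
  y : Generator n
  coeff : Fin n → Fin n → ℕ
  bdry : ∀ c r : Fin n,
    coeff (c - 1) r + coeff c (r - 1) + (if x c = r then 1 else 0)
      = coeff c r + coeff (c - 1) (r - 1) + (if y c = r then 1 else 0)

/-- The constant domain `c_x`. -/
def constDomain (x : Generator n) : PosDomain n where
  x := x
  y := x
  coeff := fun _ _ => 0
  bdry := fun _ _ => rfl

/-- The sum of the multiplicities of the four squares around the point `β_c ∩ α_r`. -/
def cornerSum (a : Fin n → Fin n → ℕ) (c r : Fin n) : ℕ :=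
  a c r + a (c - 1) r + a c (r - 1) + a (c - 1) (r - 1)

/-- The Maslov index, by Lipshitz's formula `μ(D) = e(D) + n_x(D) + n_y(D)`; the Euler measure
`e(D)` vanishes since every square has Euler measure zero, and `n_x(D)` is the sum over the points
of `x` of the average multiplicity of `D` around the point. -/
def PosDomain.maslov (D : PosDomain n) : ℚ :=
  ((∑ c, (cornerSum D.coeff c (D.x c) + cornerSum D.coeff c (D.y c)) : ℕ) : ℚ) / 4

/-- Multiplicities of the rectangle whose lower left corner is the point of `x` on `β_i` and whose
upper right corner is the point of `x` on `β_j`. -/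
def rectCoeff (x : Generator n) (i j c r : Fin n) : ℕ := cyc i j c * cyc (x i) (x j) r

/-- The data `i ≠ j` determine a rectangle from `x` to `x ∘ (i j)`: no other point of `x` lies in
it. -/
def IsRect (x : Generator n) (i j : Fin n) : Prop :=
  i ≠ j ∧ ∀ k, k ≠ i → k ≠ j → rectCoeff x i j k (x k) = 0

/-- Multiplicities of the horizontal annulus `H_j` through `O_j`. -/
def GridDiagram.hCoeff (G : GridDiagram n) (j _c r : Fin n) : ℕ := if r = G.Orow j then 1 else 0

/-- Multiplicities of the vertical annulus `V_j` through `O_j`. -/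
def GridDiagram.vCoeff (G : GridDiagram n) (j c _r : Fin n) : ℕ := if c = G.Ocol j then 1 else 0

theorem cyc_step {i j : Fin n} (h : i ≠ j) (c : Fin n) :
    cyc i j c + (if c = j then 1 else 0) = cyc i j (c - 1) + (if c = i then 1 else 0) := by
  have hb : (j - i).val ≠ 0 := by
    intro h0
    have : j - i = 0 := Fin.ext (by simpa using h0)
    exact h (sub_eq_zero.mp this).symm
  have e1 : c - 1 - i = (c - i) - 1 := by abel
  have hj : c = j ↔ (c - i).val = (j - i).val := by
    rw [← Fin.ext_iff, sub_left_inj]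
  have hi : c = i ↔ (c - i).val = 0 := by
    rw [← sub_eq_zero (a := c), Fin.ext_iff]; simp
  have hlt := (j - i).isLt
  have hs : ((c - i) - 1).val = if (c - i).val = 0 then n - 1 else (c - i).val - 1 := by
    obtain ⟨m, rfl⟩ : ∃ m, n = m + 1 := ⟨n - 1, by omega⟩
    rw [Fin.coe_sub_one]
    generalize c - i = a
    by_cases h0 : a = 0
    · simp [h0]
    · have : a.val ≠ 0 := fun h1 => h0 (Fin.ext (by simpa using h1))
      simp [h0]
  unfold cyc
  rw [e1, hs]
  simp only [hj, hi]
  split_ifs <;> omega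

theorem rect_bdry {x : Generator n} {i j : Fin n} (h : i ≠ j) (c r : Fin n) :
    rectCoeff x i j (c - 1) r + rectCoeff x i j c (r - 1) + (if x c = r then 1 else 0)
      = rectCoeff x i j c r + rectCoeff x i j (c - 1) (r - 1)
        + (if (x * Equiv.swap i j) c = r then 1 else 0) := by
  have h1 := cyc_step h c
  have h2 := cyc_step (x.injective.ne h) r
  unfold rectCoeff
  by_cases hci : c = i
  · subst hci
    have hcj : ¬ c = j := h
    simp only [hcj, if_true, if_false, Equiv.Perm.mul_apply, Equiv.swap_apply_left,
      eq_comm (b := r)] at h1 h2 ⊢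
    rw [add_zero] at h1
    rw [h1]
    nlinarith
  · by_cases hcj : c = j
    · subst hcj
      simp only [hci, if_true, if_false, Equiv.Perm.mul_apply, Equiv.swap_apply_right,
        eq_comm (b := r)] at h1 h2 ⊢
      rw [add_zero] at h1
      rw [← h1]
      nlinarith
    · simp only [hci, hcj, if_false, Equiv.Perm.mul_apply,
        Equiv.swap_apply_of_ne_of_ne hci hcj] at h1 ⊢
      rw [add_zero, add_zero] at h1
      rw [h1]

/-- The domain `E` with `R * E = D`, where `R` is the rectangle from `D.x` given by `i, j`. -/
def removeFirst (D : PosDomain n) (i j : Fin n) (hij : i ≠ j)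
    (hle : ∀ c r, rectCoeff D.x i j c r ≤ D.coeff c r) : PosDomain n where
  x := D.x * Equiv.swap i j
  y := D.y
  coeff := fun c r => D.coeff c r - rectCoeff D.x i j c r
  bdry := by
    intro c r
    have h1 := D.bdry c r
    have h2 := rect_bdry (x := D.x) hij c r
    have a1 := hle c r
    have a2 := hle (c - 1) r
    have a3 := hle c (r - 1)
    have a4 := hle (c - 1) (r - 1)
    omega

/-- The domain `E` with `E * R = D`, where `R` is the rectangle to `D.y` whose initial generator is
`D.y ∘ (i j)` and which is given by `i, j`. -/
def removeLast (D : PosDomain n) (i j : Fin n) (hij : i ≠ j)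
    (hle : ∀ c r, rectCoeff (D.y * Equiv.swap i j) i j c r ≤ D.coeff c r) : PosDomain n where
  x := D.x
  y := D.y * Equiv.swap i j
  coeff := fun c r => D.coeff c r - rectCoeff (D.y * Equiv.swap i j) i j c r
  bdry := by
    intro c r
    have h1 := D.bdry c r
    have h2 := rect_bdry (x := D.y * Equiv.swap i j) hij c r
    rw [mul_assoc, Equiv.swap_mul_self, mul_one] at h2
    have a1 := hle c r
    have a2 := hle (c - 1) r
    have a3 := hle c (r - 1)
    have a4 := hle (c - 1) (r - 1)
    omega

/-- The multiplicities `p` of a sum of rows and columns, i.e. of a domain from each generator to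
itself. -/
def IsPeriodic (p : Fin n → Fin n → ℕ) : Prop :=
  ∀ c r, p (c - 1) r + p c (r - 1) = p c r + p (c - 1) (r - 1)

theorem GridDiagram.hCoeff_periodic (G : GridDiagram n) (j : Fin n) :
    IsPeriodic (G.hCoeff j) := fun _ _ => rfl

theorem GridDiagram.vCoeff_periodic (G : GridDiagram n) (j : Fin n) :
    IsPeriodic (G.vCoeff j) := fun c _ => by simp only [GridDiagram.vCoeff]; ring

/-- The annulus with multiplicities `p`, as a domain from `x` to itself. -/
def annulus (p : Fin n → Fin n → ℕ) (hp : IsPeriodic p) (x : Generator n) : PosDomain n where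
  x := x
  y := x
  coeff := p
  bdry := fun c r => by rw [hp c r]

/-- The domain `E` with `D = E * A`, where `A` is the annulus with multiplicities `p`. -/
def removeAnnulus (D : PosDomain n) (p : Fin n → Fin n → ℕ) (hp : IsPeriodic p)
    (hle : ∀ c r, p c r ≤ D.coeff c r) : PosDomain n where
  x := D.x
  y := D.y
  coeff := fun c r => D.coeff c r - p c r
  bdry := by
    intro c r
    have h1 := D.bdry c r
    have h2 := hp c r
    have a1 := hle c r
    have a2 := hle (c - 1) r
    have a3 := hle c (r - 1)
    have a4 := hle (c - 1) (r - 1)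
    omega

/-- The unit enlargements of an ordered partition: insert a part `1` at any of its positions.  They
are listed once for every position, so with multiplicity. -/
def unitEnlargements : List ℕ+ → List (List ℕ+)
  | [] => [[1]]
  | a :: l => (1 :: a :: l) :: (unitEnlargements l).map (fun m => a :: m)

/-- The elementary coarsenings of an ordered partition: add two consecutive parts. -/
def elementaryCoarsenings : List ℕ+ → List (List ℕ+)
  | [] => []
  | [_] => []
  | a :: b :: l => ((a + b) :: l) :: (elementaryCoarsenings (b :: l)).map (fun m => a :: m)

/-- The initial reduction (none for the empty partition): drop the first part. -/
def initialReductions : List ℕ+ → List (List ℕ+)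
  | [] => []
  | _ :: l => [l]

/-- The final reduction (none for the empty partition): drop the last part. -/
def finalReductions : List ℕ+ → List (List ℕ+)
  | [] => []
  | a :: l => [(a :: l).dropLast]

/-- A positive domain with partitions `(D, N, λ)`.  The ordered partition `λ_j` is the list
`part j` of its (positive) parts, and `N_j` is the sum of that list, so it is not recorded
separately. -/
@[ext]
structure Triple (n : ℕ) [NeZero n] where
  dom : PosDomain n
  part : Fin n → List ℕ+

/-- The triple has grading `k`: Maslov index plus total length of the partitions. -/
def Triple.HasDegree (t : Triple n) (k : ℕ) : Prop :=
  t.dom.maslov + ((∑ j, (t.part j).length : ℕ) : ℚ) = k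

/-- Chains (of all degrees): the `ZMod 2`-vector space freely generated by the triples. -/
abbrev Chain (n : ℕ) [NeZero n] := Triple n →₀ ZMod 2

/-- The triple `t` as a chain. -/
def gen (t : Triple n) : Chain n := Finsupp.single t 1

/-- Replace the `j`-th partition. -/
def Triple.setPart (t : Triple n) (j : Fin n) (l : List ℕ+) : Triple n :=
  ⟨t.dom, Function.update t.part j l⟩

open Classical in
/-- Type I terms: remove a rectangle from the beginning or from the end of the domain. -/
def bdry1 (t : Triple n) : Chain n :=
  (∑ i, ∑ j, if h : IsRect t.dom.x i j ∧ ∀ c r, rectCoeff t.dom.x i j c r ≤ t.dom.coeff c r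
    then gen ⟨removeFirst t.dom i j h.1.1 h.2, t.part⟩ else 0)
  + ∑ i, ∑ j, if h : IsRect (t.dom.y * Equiv.swap i j) i j ∧
      ∀ c r, rectCoeff (t.dom.y * Equiv.swap i j) i j c r ≤ t.dom.coeff c r
    then gen ⟨removeLast t.dom i j h.1.1 h.2, t.part⟩ else 0

open Classical in
/-- The triples obtained by removing the annulus with multiplicities `p` and replacing `λ_j` by one
of its unit enlargements; zero if the domain does not contain the annulus. -/
def bubbleTerms (t : Triple n) (j : Fin n) (p : Fin n → Fin n → ℕ) (hp : IsPeriodic p) : Chain n :=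
  if h : ∀ c r, p c r ≤ t.dom.coeff c r then
    ((unitEnlargements (t.part j)).map fun l =>
      gen (Triple.setPart ⟨removeAnnulus t.dom p hp h, t.part⟩ j l)).sum
  else 0

/-- Type II terms: remove `H_j` or `V_j` and unit-enlarge `λ_j`. -/
def GridDiagram.bdry2 (G : GridDiagram n) (t : Triple n) : Chain n :=
  ∑ j, (bubbleTerms t j (G.hCoeff j) (G.hCoeff_periodic j)
    + bubbleTerms t j (G.vCoeff j) (G.vCoeff_periodic j))

/-- Type III terms: an elementary coarsening of one of the partitions. -/
def bdry3 (t : Triple n) : Chain n :=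
  ∑ j, ((elementaryCoarsenings (t.part j)).map fun l => gen (t.setPart j l)).sum

/-- Type IV terms: an initial or final reduction of one of the partitions. -/
def bdry4 (t : Triple n) : Chain n :=
  ∑ j, ((initialReductions (t.part j)).map fun l => gen (t.setPart j l)).sum
  + ∑ j, ((finalReductions (t.part j)).map fun l => gen (t.setPart j l)).sum

/-- The differential of `CDP_*`. -/
def GridDiagram.boundary (G : GridDiagram n) : Chain n →ₗ[ZMod 2] Chain n :=
  Finsupp.linearCombination (ZMod 2) fun t => bdry1 t + G.bdry2 t + bdry3 t + bdry4 t

/-- The generators of `CDP_*`: all triples. -/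
def full (n : ℕ) [NeZero n] : Set (Triple n) := Set.univ

/-- The generators of the subcomplex `CDP_*^0`: the triples whose domain does not pass through
`O_1`. -/
def GridDiagram.blocked (G : GridDiagram n) : Set (Triple n) :=
  {t | t.dom.coeff (G.Ocol 0) (G.Orow 0) = 0}

/-- Cochains of degree `k`, with values in `ZMod 2`, on the complex generated by the triples in `S`:
functions on the generators of degree `k`. -/
abbrev Cochain (S : Set (Triple n)) (k : ℕ) := {t : Triple n // t ∈ S ∧ t.HasDegree k} → ZMod 2

open Classical in
/-- The value of a cochain on a chain (the cochain vanishes on generators of other degrees). -/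
def Cochain.eval {S : Set (Triple n)} {k : ℕ} (f : Cochain S k) : Chain n →ₗ[ZMod 2] ZMod 2 :=
  Finsupp.linearCombination (ZMod 2) fun t => if h : t ∈ S ∧ t.HasDegree k then f ⟨t, h⟩ else 0

/-- The coboundary: `(δ f)(t) = f(∂ t)`. It is used for the sets `full n` and `G.blocked`, whose
spans are closed under the differential. -/
def GridDiagram.coboundary (G : GridDiagram n) {S : Set (Triple n)} {k : ℕ} (f : Cochain S k) :
    Cochain S (k + 1) :=
  fun t => Cochain.eval f (G.boundary (gen t.1))

/-- Frame assignments with respect to the obstruction cochain `o`, a 3-cochain: 2-cochains `f` with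
`δ f = o`.  Here `o t` in `ZMod 2` is the class of the boundary of the two-dimensional moduli space
of `t` in the framed cobordism group `Ω̃_fr^1`, all one-dimensional moduli spaces carrying their
preferred framings, and `f u = 1` means that the framing of the one-dimensional moduli space of `u`
differs from the preferred one.  No property of `o` is required. -/
def GridDiagram.IsFrameAssignment (G : GridDiagram n) {S : Set (Triple n)} (o : Cochain S 3)
    (f : Cochain S 2) : Prop :=
  G.coboundary f = o

/-- The triple `(c_Id, e_j + e_k, ((1)_j, (1)_k))`, for `j ≠ k`. -/
def bubblePair (j k : Fin n) : Triple n where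
  dom := constDomain 1
  part := fun i => if i = j ∨ i = k then [1] else []

/-- The annulus with multiplicities `p` at the generator `x`, without partitions. -/
def annulusTriple (p : Fin n → Fin n → ℕ) (hp : IsPeriodic p) (x : Generator n) : Triple n :=
  ⟨annulus p hp x, fun _ => []⟩

/-- `U` is a cycle `U'`: a 2-cycle of `CDP_*` which is a sum of annuli `H_j` and `V_j`, each of them
occurring (at an odd number of generators `x`), together with further triples of degree 2 whose
domain is not constant, i.e. domains of Maslov index 2 other than annuli, and rectangles with one
partition of length one. -/
structure GridDiagram.IsUPrime (G : GridDiagram n) (U : Chain n) : Prop where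
  cycle : G.boundary U = 0
  support : ∀ t ∈ U.support, t.HasDegree 2 ∧ ∀ x, t.dom ≠ constDomain x
  horizontal : ∀ j, ∑ x, U (annulusTriple (G.hCoeff j) (G.hCoeff_periodic j) x) = 1
  vertical : ∀ j, ∑ x, U (annulusTriple (G.vCoeff j) (G.vCoeff_periodic j) x) = 1

end GridCDP

end

/-!
Over the field with two elements, a cochain that vanishes on all cycles is a coboundary.  Two frame
assignments have the same value on every boundary, so the uniqueness statements reduce to the claim
that every 2-cycle is a sum of boundaries, of the triples `(c_Id, e_j + e_k, ((1)_j, (1)_k))` and, on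
the full complex, of a multiple of `U'` (`cycle_mem_bubbleBoundaries`).  The converse directions use
that the differential squares to zero (`boundary_boundary`): it is a sum of commuting operators of
square zero, made of the differentials on domains and on ordered partitions, and of the removal of
annuli combined with the insertion of a part `1`.

The claim is proved by elimination along a rank (`mem_of_triangular`), in the manner of discrete
Morse theory.  Let `(p, q)` be the square of `O_1`, the *corner square*.  Cutting the torus open
along column `p` and row `q` orders rows and columns linearly.  The rank of a domain consists of its
multiplicity at the corner square, the sum of its multiplicities in column `p` and row `q`, the
distance of its final generator from the generator that is increasing for the two linear orders, and
its total multiplicity outside a certain strip.  This strip is a column other than `p` or a row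
other than `q`, chosen from the final generator and the multiplicities in row `q` and column `p`
alone, such that the domain contains each rectangle in the strip that starts at its initial generator
and avoids row `q` and column `p`.  Exactly one of the two rectangles that make up the strip avoids
them.  Hence adding or removing it at the beginning is a matching which preserves the rank, while all
other facets have smaller rank (`IsFacet.domRank_lt_or`, `detected_or_reduced`).  Ordered
partitions are matched by `(1, b, …) ↔ (1 + b, …)`, at the first index where the partition is neither
empty nor `(1)`.

A domain without a suitable strip has constant multiplicity along row `q` and along column `p`, except
possibly at the corner, and ends at the increasing generator.  In Maslov index at most two, it is
constant, an annulus through the corner square, or the corner square itself; the last one is matched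
with the horizontal annulus (`domain_cases`).  The remaining triples of degree two are therefore
those with constant domain and two partitions `(1)`, which are congruent to the ones at `c_Id`, and
the two annuli, which are detected by counting the annuli of a given shape (`annulusCount`).  Each
square lies in an even number of rectangles of a boundary, counted with multiplicity, up to the
contribution of the annuli (`squareCount_domOp`); so in a 2-cycle all `2n` annuli occur with the same
parity.  On the full complex that parity is corrected by `U'`, and on `CDP^0_*` it is even, because
annuli through `O_1` do not occur.

For the existence of `U'`, the boundaries of the two annuli through the corner square at the
increasing generator agree up to terms away from the corner square, where one-dimensional cycles
bound (`degree_one_mem`).  This gives a cycle of domains in which every annulus occurs an odd number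
of times.  Removing `H_j` and `V_j` from it leaves an even number of constant domains, which bound
away from the corner square (`degree_zero_mem`), and this cancels the terms with a part `1`.
-/

noncomputable section

namespace GridCDP

set_option linter.unusedSectionVars false
set_option linter.unusedSimpArgs false

variable {n : ℕ} [NeZero n]

/-! ### Linear algebra over the field with two elements -/

theorem add_self_zmod_two {M : Type*} [AddCommGroup M] [Module (ZMod 2) M] (m : M) :
    m + m = 0 := by
  rw [← two_smul (ZMod 2) m, show (2 : ZMod 2) = 0 from rfl, zero_smul]

theorem zmod_two_eq_one {a : ZMod 2} (h : a ≠ 0) : a = 1 := by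
  revert h; revert a; decide

/-- In characteristic two, a sum of pairwise commuting elements of square zero has square zero. -/
theorem sum_mul_self_eq_zero {R ι : Type*} [Ring R] (hR : ∀ a : R, a + a = 0) (s : Finset ι)
    (f : ι → R) (hc : ∀ i ∈ s, ∀ j ∈ s, Commute (f i) (f j)) (h0 : ∀ i ∈ s, f i * f i = 0) :
    (∑ i ∈ s, f i) * ∑ i ∈ s, f i = 0 := by
  classical
  induction s using Finset.induction_on with
  | empty => simp
  | insert a s ha ih =>
    rw [Finset.sum_insert ha]
    have h1 : Commute (f a) (∑ i ∈ s, f i) :=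
      Commute.sum_right _ _ _ fun i hi => hc a (by simp) i (by simp [hi])
    have h2 := ih (fun i hi j hj => hc i (by simp [hi]) j (by simp [hj]))
      (fun i hi => h0 i (by simp [hi]))
    rw [add_mul, mul_add, mul_add, h0 a (by simp), h2, ← h1.eq, zero_add, add_zero, hR]

theorem add_mul_self_eq_zero {R : Type*} [Ring R] (hR : ∀ a : R, a + a = 0) {a b : R}
    (hc : Commute a b) (ha : a * a = 0) (hb : b * b = 0) : (a + b) * (a + b) = 0 := by
  rw [add_mul, mul_add, mul_add, ha, hb, ← hc.eq, zero_add, add_zero, hR]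

/-- Elimination along a well-founded rank: every basis element `x` in `A` either is congruent
modulo `T` to a combination of elements of smaller rank, or is the only element of rank at most
`ρ x` detected by some functional that vanishes on `T`.  Then the chains on `A` on which all
these functionals vanish lie in `T`. -/
theorem mem_of_triangular {X W : Type*} [LinearOrder W] [WellFoundedLT W] (ρ : X → W) (A : Set X)
    (T : Submodule (ZMod 2) (X →₀ ZMod 2)) (Ψ : Set ((X →₀ ZMod 2) →ₗ[ZMod 2] ZMod 2))
    (hT : ∀ ψ ∈ Ψ, ∀ t ∈ T, ψ t = 0)
    (h : ∀ x ∈ A,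
      (∃ t ∈ T, t - Finsupp.single x 1 ∈ Finsupp.supported (ZMod 2) (ZMod 2) {y ∈ A | ρ y < ρ x}) ∨
      ∃ ψ ∈ Ψ, ψ (Finsupp.single x 1) ≠ 0 ∧
        ∀ y ∈ A, y ≠ x → ρ y ≤ ρ x → ψ (Finsupp.single y 1) = 0)
    (Z : X →₀ ZMod 2) (hZ : Z ∈ Finsupp.supported (ZMod 2) (ZMod 2) A)
    (hψ : ∀ ψ ∈ Ψ, ψ Z = 0) : Z ∈ T := by
  classical
  suffices H : ∀ w : W, ∀ Z : X →₀ ZMod 2,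
      Z ∈ Finsupp.supported (ZMod 2) (ZMod 2) {y ∈ A | ρ y ≤ w} → (∀ ψ ∈ Ψ, ψ Z = 0) → Z ∈ T by
    by_cases h0 : Z.support.Nonempty
    · obtain ⟨x, _, hx⟩ := Z.support.exists_max_image ρ h0
      exact H (ρ x) Z (fun y hy => ⟨hZ hy, hx y hy⟩) hψ
    · rw [Finset.not_nonempty_iff_eq_empty, Finsupp.support_eq_empty] at h0
      rw [h0]; exact T.zero_mem
  intro w
  induction w using WellFoundedLT.induction with
  | ind w ih =>
  intro Z hZ hψ
  -- the correction of an element of top rank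
  have hcorr : ∀ x : X, ∃ t ∈ T, t ∈ Finsupp.supported (ZMod 2) (ZMod 2) {y ∈ A | ρ y ≤ w} ∧
      (x ∈ A → ρ x = w → t x = 0 → ∃ ψ ∈ Ψ, ψ (Finsupp.single x 1) ≠ 0 ∧
        ∀ y ∈ A, y ≠ x → ρ y ≤ ρ x → ψ (Finsupp.single y 1) = 0) ∧
      (t ≠ 0 → ∀ y, ρ y = w → t y = if y = x then 1 else 0) := by
    intro x
    by_cases hx : x ∈ A ∧ ρ x = w
    · rcases h x hx.1 with ⟨t, ht, hl⟩ | hu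
      · have hval : ∀ y, ρ y = w → t y = if y = x then 1 else 0 := by
          intro y hy
          have h1 : (t - Finsupp.single x 1 : X →₀ ZMod 2) y = 0 := by
            by_contra hne
            have := hl (Finsupp.mem_support_iff.2 hne)
            have h2 : ρ y < ρ x := this.2
            rw [hy, hx.2] at h2
            exact lt_irrefl _ h2
          rw [Finsupp.sub_apply, sub_eq_zero, Finsupp.single_apply] at h1
          rw [h1]; simp [eq_comm]
        refine ⟨t, ht, ?_, ?_, fun _ => hval⟩
        · have h3 : t = (t - Finsupp.single x 1) + Finsupp.single x 1 := by abel
          rw [h3]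
          refine Submodule.add_mem _ ?_ (Finsupp.single_mem_supported _ _ ⟨hx.1, hx.2.le⟩)
          refine Finsupp.supported_mono ?_ hl
          rintro y ⟨hy, hy2⟩
          exact ⟨hy, by rw [← hx.2]; exact hy2.le⟩
        · intro _ hw h0
          rw [hval x hw] at h0
          simp at h0
      · exact ⟨0, T.zero_mem, Submodule.zero_mem _, fun _ _ _ => hu, fun h => absurd rfl h⟩
    · exact ⟨0, T.zero_mem, Submodule.zero_mem _, fun h1 h2 => absurd ⟨h1, h2⟩ hx,
        fun h => absurd rfl h⟩
  choose t htT htA htU htV using hcorr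
  set Z' : X →₀ ZMod 2 := Z - ∑ x ∈ Z.support with ρ x = w, Z x • t x with hZ'
  have hsumT : ∑ x ∈ Z.support with ρ x = w, Z x • t x ∈ T :=
    Submodule.sum_mem _ fun x _ => T.smul_mem _ (htT x)
  have hZ'A : Z' ∈ Finsupp.supported (ZMod 2) (ZMod 2) {y ∈ A | ρ y ≤ w} :=
    Submodule.sub_mem _ hZ (Submodule.sum_mem _ fun x _ => Submodule.smul_mem _ _ (htA x))
  have hψ' : ∀ ψ ∈ Ψ, ψ Z' = 0 := fun ψ h1 => by
    rw [hZ', map_sub, hψ ψ h1, hT ψ h1 _ hsumT, sub_zero]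
  suffices hmem : Z' ∈ T by
    have := T.add_mem hmem hsumT
    rwa [hZ', sub_add_cancel] at this
  have htop : ∀ x, ρ x = w → Z' x = 0 := by
    intro x hx
    by_contra hne
    have hxA : x ∈ A := (hZ'A (Finsupp.mem_support_iff.2 hne)).1
    have key : t x = 0 := by
      by_contra htx
      apply hne
      have hs : (∑ y ∈ Z.support with ρ y = w, Z y • t y) x = Z x := by
        rw [Finsupp.finsetSum_apply]
        have : ∀ y ∈ {y ∈ Z.support | ρ y = w}, (Z y • t y) x = if y = x then Z y else 0 := by
          intro y hy
          rw [Finsupp.smul_apply, smul_eq_mul]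
          by_cases hty : t y = 0
          · have : y ≠ x := fun h => htx (h ▸ hty)
            simp [hty, this]
          · rw [htV y hty x hx]
            by_cases hyx : y = x
            · simp [hyx]
            · simp [hyx, Ne.symm hyx]
        rw [Finset.sum_congr rfl this, Finset.sum_ite_eq' ]
        simp only [Finset.mem_filter, Finsupp.mem_support_iff, hx, and_true]
        by_cases h0 : Z x = 0 <;> simp [h0]
      rw [hZ', Finsupp.sub_apply, hs, sub_self]
    obtain ⟨ψ, hψΨ, hψx, hψy⟩ := htU x hxA hx (by rw [key]; rfl)
    have h1 := hψ' ψ hψΨ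
    rw [← Finsupp.sum_single Z', Finsupp.sum, map_sum, Finset.sum_eq_single x] at h1
    · rw [zmod_two_eq_one hne] at h1
      exact hψx h1
    · intro y hy hyx
      have hyA := hZ'A hy
      rw [zmod_two_eq_one (Finsupp.mem_support_iff.1 hy)]
      exact hψy y hyA.1 hyx (by rw [hx]; exact hyA.2)
    · intro hx0
      exact absurd (Finsupp.mem_support_iff.2 hne) hx0
  by_cases h0 : Z'.support.Nonempty
  · obtain ⟨x, hx0, hx⟩ := Z'.support.exists_max_image ρ h0
    have hxw : ρ x < w :=
      lt_of_le_of_ne (hZ'A hx0).2 fun h1 => Finsupp.mem_support_iff.1 hx0 (htop x h1)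
    exact ih (ρ x) hxw Z' (fun y hy => ⟨(hZ'A hy).1, hx y hy⟩) hψ'
  · rw [Finset.not_nonempty_iff_eq_empty, Finsupp.support_eq_empty] at h0
    rw [h0]; exact T.zero_mem

/-- A functional that vanishes on the kernel of a linear map factors through it. -/
theorem exists_factor_of_ker_le {V W : Type*} [AddCommGroup V] [Module (ZMod 2) V]
    [AddCommGroup W] [Module (ZMod 2) W] (d : V →ₗ[ZMod 2] W) (g : V →ₗ[ZMod 2] ZMod 2)
    (h : LinearMap.ker d ≤ LinearMap.ker g) : ∃ H : W →ₗ[ZMod 2] ZMod 2, g = H ∘ₗ d := by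
  have : g ∈ LinearMap.range (Module.Dual.transpose (R := ZMod 2) d) := by
    have h1 := LinearMap.range_dualMap_eq_dualAnnihilator_ker d
    change g ∈ LinearMap.range d.dualMap
    rw [h1, Submodule.mem_dualAnnihilator]
    intro w hw
    exact h hw
  obtain ⟨H, hH⟩ := this
  exact ⟨H, hH.symm⟩

/-! ### Operations on ordered partitions -/

/-- Formal sums of ordered partitions. -/
abbrev ListChain := List ℕ+ →₀ ZMod 2

/-- Linear extension of a map from a basis to chains. -/
abbrev lin {X M : Type*} [AddCommGroup M] [Module (ZMod 2) M] (f : X → M) :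
    (X →₀ ZMod 2) →ₗ[ZMod 2] M := Finsupp.linearCombination (ZMod 2) f

theorem lin_single {X M : Type*} [AddCommGroup M] [Module (ZMod 2) M] (f : X → M) (x : X) :
    lin f (Finsupp.single x 1) = f x := by simp [lin]

/-- Formal sum of a list. -/
def sumSingle {X : Type*} (l : List X) : X →₀ ZMod 2 := (l.map fun m => Finsupp.single m 1).sum

theorem sumSingle_cons {X : Type*} (a : X) (l : List X) :
    sumSingle (a :: l) = Finsupp.single a 1 + sumSingle l := by simp [sumSingle]

theorem lin_sumSingle {X M : Type*} [AddCommGroup M] [Module (ZMod 2) M] (f : X → M) (l : List X) :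
    lin f (sumSingle l) = (l.map f).sum := by
  induction l with
  | nil => simp [sumSingle]
  | cons a l ih => rw [sumSingle_cons, map_add, lin_single, ih]; simp

/-- Prepend the part `a`. -/
def consOp (a : ℕ+) : ListChain →ₗ[ZMod 2] ListChain := lin fun l => Finsupp.single (a :: l) 1

/-- Add `a` to the first part; the empty partition is fixed. -/
def mergeOp (a : ℕ+) : ListChain →ₗ[ZMod 2] ListChain :=
  lin fun l => match l with
    | [] => Finsupp.single [] 1
    | b :: m => Finsupp.single ((a + b) :: m) 1

/-- Drop the first part. -/
def initOp : ListChain →ₗ[ZMod 2] ListChain := lin fun l => sumSingle (initialReductions l)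

/-- Elementary coarsenings together with the final reduction. -/
def tailOp : ListChain →ₗ[ZMod 2] ListChain :=
  lin fun l => sumSingle (elementaryCoarsenings l) + sumSingle (finalReductions l)

/-- The differential on ordered partitions: coarsenings, initial and final reductions. -/
def partOp : ListChain →ₗ[ZMod 2] ListChain := initOp + tailOp

/-- Unit enlargements. -/
def enlargeOp : ListChain →ₗ[ZMod 2] ListChain := lin fun l => sumSingle (unitEnlargements l)

theorem sumSingle_map_cons (a : ℕ+) (s : List (List ℕ+)) :
    sumSingle (s.map fun m => a :: m) = consOp a (sumSingle s) := by
  rw [consOp, lin_sumSingle, sumSingle, List.map_map]; rfl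

@[simp] theorem consOp_single (a : ℕ+) (l : List ℕ+) :
    consOp a (Finsupp.single l 1) = Finsupp.single (a :: l) 1 := lin_single _ _

@[simp] theorem mergeOp_nil (a : ℕ+) :
    mergeOp a (Finsupp.single [] 1) = Finsupp.single [] 1 := lin_single _ _

@[simp] theorem mergeOp_cons (a b : ℕ+) (l : List ℕ+) :
    mergeOp a (Finsupp.single (b :: l) 1) = Finsupp.single ((a + b) :: l) 1 := lin_single _ _

@[simp] theorem initOp_nil : initOp (Finsupp.single [] 1) = 0 := lin_single _ _

@[simp] theorem initOp_cons (a : ℕ+) (l : List ℕ+) :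
    initOp (Finsupp.single (a :: l) 1) = Finsupp.single l 1 := by
  rw [initOp, lin_single]; simp [initialReductions, sumSingle]

@[simp] theorem tailOp_nil : tailOp (Finsupp.single [] 1) = 0 := by
  rw [tailOp, lin_single]; simp [elementaryCoarsenings, finalReductions, sumSingle]

@[simp] theorem tailOp_cons (a : ℕ+) (l : List ℕ+) : tailOp (Finsupp.single (a :: l) 1)
    = mergeOp a (Finsupp.single l 1) + consOp a (tailOp (Finsupp.single l 1)) := by
  rw [tailOp, lin_single, lin_single]
  cases l with
  | nil => simp [elementaryCoarsenings, finalReductions, sumSingle]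
  | cons b l =>
    rw [elementaryCoarsenings, sumSingle_cons, sumSingle_map_cons, mergeOp_cons, map_add]
    have : finalReductions (a :: b :: l) = (finalReductions (b :: l)).map fun m => a :: m := by
      simp [finalReductions]
    rw [this, sumSingle_map_cons, add_assoc]

@[simp] theorem enlargeOp_nil :
    enlargeOp (Finsupp.single [] 1) = Finsupp.single [1] 1 := by
  rw [enlargeOp, lin_single]; simp [unitEnlargements, sumSingle]

@[simp] theorem enlargeOp_cons (a : ℕ+) (l : List ℕ+) : enlargeOp (Finsupp.single (a :: l) 1)
    = Finsupp.single (1 :: a :: l) 1 + consOp a (enlargeOp (Finsupp.single l 1)) := by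
  rw [enlargeOp, lin_single, lin_single, unitEnlargements, sumSingle_cons, sumSingle_map_cons]

theorem linearMap_ext_single {X M : Type*} [AddCommGroup M] [Module (ZMod 2) M]
    {f g : (X →₀ ZMod 2) →ₗ[ZMod 2] M}
    (h : ∀ x, f (Finsupp.single x 1) = g (Finsupp.single x 1)) : f = g := by
  ext x; simpa using h x

theorem tailOp_consOp (a : ℕ+) (m : ListChain) :
    tailOp (consOp a m) = mergeOp a m + consOp a (tailOp m) := by
  have : tailOp ∘ₗ consOp a = mergeOp a + consOp a ∘ₗ tailOp :=
    linearMap_ext_single fun l => by simp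
  exact LinearMap.congr_fun this m

theorem initOp_consOp (a : ℕ+) (m : ListChain) : initOp (consOp a m) = m := by
  have : initOp ∘ₗ consOp a = LinearMap.id := linearMap_ext_single fun l => by simp
  exact LinearMap.congr_fun this m

theorem enlargeOp_consOp (a : ℕ+) (m : ListChain) :
    enlargeOp (consOp a m) = consOp 1 (consOp a m) + consOp a (enlargeOp m) := by
  have : enlargeOp ∘ₗ consOp a = consOp 1 ∘ₗ consOp a + consOp a ∘ₗ enlargeOp :=
    linearMap_ext_single fun l => by simp
  exact LinearMap.congr_fun this m

theorem mergeOp_consOp (a b : ℕ+) (m : ListChain) :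
    mergeOp a (consOp b m) = consOp (a + b) m := by
  have : mergeOp a ∘ₗ consOp b = consOp (a + b) := linearMap_ext_single fun l => by simp
  exact LinearMap.congr_fun this m

theorem tailOp_mergeOp (a : ℕ+) (m : ListChain) :
    tailOp (mergeOp a m) = mergeOp a (tailOp m) := by
  have : tailOp ∘ₗ mergeOp a = mergeOp a ∘ₗ tailOp := linearMap_ext_single fun l => by
    cases l with
    | nil => simp
    | cons b l =>
      simp only [LinearMap.comp_apply, mergeOp_cons, tailOp_cons, map_add, mergeOp_consOp]
      cases l with
      | nil => simp
      | cons c l => simp [add_assoc]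
  exact LinearMap.congr_fun this m

theorem tailOp_tailOp (m : ListChain) : tailOp (tailOp m) = 0 := by
  have : tailOp ∘ₗ tailOp = 0 := linearMap_ext_single fun l => by
    induction l with
    | nil => simp
    | cons a l ih =>
      simp only [LinearMap.comp_apply, LinearMap.zero_apply] at ih ⊢
      rw [tailOp_cons, map_add, tailOp_mergeOp, tailOp_consOp, ih, map_zero, add_zero,
        add_self_zmod_two]
  exact LinearMap.congr_fun this m

theorem partOp_partOp (m : ListChain) : partOp (partOp m) = 0 := by
  have : partOp ∘ₗ partOp = 0 := linearMap_ext_single fun l => by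
    simp only [LinearMap.comp_apply, partOp, LinearMap.add_apply, LinearMap.zero_apply, map_add,
      tailOp_tailOp, add_zero]
    cases l with
    | nil => simp
    | cons a l =>
      rw [initOp_cons, tailOp_cons, map_add, initOp_consOp]
      cases l with
      | nil => simp
      | cons b l =>
        simp only [initOp_cons, mergeOp_cons]
        have h1 := add_self_zmod_two (Finsupp.single l 1 : ListChain)
        have h2 := add_self_zmod_two (tailOp (Finsupp.single (b :: l) 1))
        calc _ = (Finsupp.single l 1 + Finsupp.single l 1 : ListChain) +
            (tailOp (Finsupp.single (b :: l) 1) + tailOp (Finsupp.single (b :: l) 1)) := by abel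
          _ = 0 := by rw [h1, h2, add_zero]
  exact LinearMap.congr_fun this m

theorem enlargeOp_enlargeOp (m : ListChain) : enlargeOp (enlargeOp m) = 0 := by
  have : enlargeOp ∘ₗ enlargeOp = 0 := linearMap_ext_single fun l => by
    simp only [LinearMap.comp_apply, LinearMap.zero_apply]
    induction l with
    | nil => simp [add_self_zmod_two]
    | cons a l ih =>
      simp only [enlargeOp_cons, map_add, enlargeOp_consOp, ih, map_zero, add_zero, consOp_single]
      set X := (Finsupp.single (1 :: 1 :: a :: l) 1 : ListChain)
      set Y := consOp 1 (consOp a (enlargeOp (Finsupp.single l 1)))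
      calc _ = (X + X) + (Y + Y) := by abel
        _ = 0 := by rw [add_self_zmod_two, add_self_zmod_two, add_zero]
  exact LinearMap.congr_fun this m

theorem initOp_enlargeOp (m : ListChain) : initOp (enlargeOp m) = m + enlargeOp (initOp m) := by
  have : initOp ∘ₗ enlargeOp = LinearMap.id + enlargeOp ∘ₗ initOp :=
    linearMap_ext_single fun l => by cases l <;> simp [initOp_consOp]
  exact LinearMap.congr_fun this m

theorem mergeOp_enlargeOp (a : ℕ+) (m : ListChain) :
    mergeOp a (enlargeOp m) + enlargeOp (mergeOp a m) = consOp (1 + a) m + consOp 1 (mergeOp a m) := by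
  have : mergeOp a ∘ₗ enlargeOp + enlargeOp ∘ₗ mergeOp a = consOp (1 + a) + consOp 1 ∘ₗ mergeOp a :=
    linearMap_ext_single fun l => by
      cases l with
      | nil => simp [add_comm]
      | cons b l =>
        simp only [LinearMap.comp_apply, LinearMap.add_apply, enlargeOp_cons, mergeOp_cons,
          map_add, mergeOp_consOp, consOp_single, add_comm a 1]
        set Y := consOp (a + b) (enlargeOp (Finsupp.single l 1))
        calc _ = Finsupp.single ((1 + a) :: b :: l) 1 + Finsupp.single (1 :: (a + b) :: l) 1
              + (Y + Y) := by abel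
          _ = _ := by rw [add_self_zmod_two, add_zero]
  exact LinearMap.congr_fun this m

theorem tailOp_enlargeOp (m : ListChain) : tailOp (enlargeOp m) = m + enlargeOp (tailOp m) := by
  have : tailOp ∘ₗ enlargeOp = LinearMap.id + enlargeOp ∘ₗ tailOp :=
    linearMap_ext_single fun l => by
      simp only [LinearMap.comp_apply, LinearMap.add_apply, LinearMap.id_apply]
      induction l with
      | nil => simp
      | cons a l ih =>
        have h := mergeOp_enlargeOp a (Finsupp.single l 1)
        simp only [enlargeOp_cons, map_add, tailOp_consOp, ih, tailOp_cons, mergeOp_cons,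
          enlargeOp_consOp, consOp_single] at h ⊢
        set X := consOp 1 (consOp a (tailOp (Finsupp.single l 1)))
        set Y := consOp a (enlargeOp (tailOp (Finsupp.single l 1)))
        set P := mergeOp a (enlargeOp (Finsupp.single l 1))
        set Q := enlargeOp (mergeOp a (Finsupp.single l 1))
        set R := consOp 1 (mergeOp a (Finsupp.single l 1))
        have h2 : P = Finsupp.single ((1 + a) :: l) 1 + R + Q := by
          rw [← h, add_assoc, add_self_zmod_two, add_zero]
        rw [h2]
        have h3 := add_self_zmod_two (Finsupp.single ((1 + a) :: l) 1 : ListChain)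
        calc _ = (Finsupp.single ((1 + a) :: l) 1 + Finsupp.single ((1 + a) :: l) 1 : ListChain)
              + (R + R) + (Finsupp.single (a :: l) 1 + (Q + (X + Y))) := by abel
          _ = _ := by rw [h3, add_self_zmod_two R, zero_add, zero_add]
  exact LinearMap.congr_fun this m

theorem partOp_enlargeOp (m : ListChain) : partOp (enlargeOp m) = enlargeOp (partOp m) := by
  simp only [partOp, LinearMap.add_apply, map_add, initOp_enlargeOp, tailOp_enlargeOp]
  calc _ = (m + m) + (enlargeOp (initOp m) + enlargeOp (tailOp m)) := by abel
    _ = _ := by rw [add_self_zmod_two, zero_add]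

/-! ### Cyclic intervals -/

theorem val_sub_eq (a b : Fin n) :
    (a - b).val = if b.val ≤ a.val then a.val - b.val else n + a.val - b.val := by
  have ha := a.isLt
  have hb := b.isLt
  rw [Fin.val_sub]
  split_ifs with h
  · rw [show n - b.val + a.val = (a.val - b.val) + n by omega, Nat.add_mod_right,
      Nat.mod_eq_of_lt (by omega)]
  · rw [Nat.mod_eq_of_lt (by omega)]; omega

theorem cyc_le_one (a b c : Fin n) : cyc a b c ≤ 1 := by unfold cyc; split_ifs <;> omega

theorem cyc_self (a c : Fin n) : cyc a a c = 0 := by simp [cyc]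

theorem cyc_left {a b : Fin n} (h : a ≠ b) : cyc a b a = 1 := by
  have : (b - a).val ≠ 0 := fun h0 => h (sub_eq_zero.1 (Fin.ext (by simpa using h0))).symm
  simp only [cyc, sub_self, Fin.val_zero]
  rw [if_pos (by omega)]

theorem cyc_right (a b : Fin n) : cyc a b b = 0 := by simp [cyc]

/-- Differences in terms of the coordinate centred at `a`. -/
theorem val_sub_rel (a b c : Fin n) :
    (c - b).val = if (b - a).val ≤ (c - a).val then (c - a).val - (b - a).val
      else n + (c - a).val - (b - a).val := by
  rw [← val_sub_eq, sub_sub_sub_cancel_right]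

theorem val_sub_ne_zero {a b : Fin n} (h : a ≠ b) : (b - a).val ≠ 0 := fun h0 =>
  h (sub_eq_zero.1 (Fin.ext (by simpa using h0))).symm

theorem val_sub_ne {b c : Fin n} (a : Fin n) (h : b ≠ c) : (b - a).val ≠ (c - a).val := fun h0 =>
  h (sub_left_injective (Fin.ext h0))

theorem cyc_add_cyc {a b : Fin n} (h : a ≠ b) (c : Fin n) : cyc a b c + cyc b a c = 1 := by
  have h' := val_sub_ne_zero h
  have := (b - a).isLt; have := (c - a).isLt
  simp only [cyc, val_sub_rel a b, sub_self, Fin.val_zero]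
  split_ifs <;> omega

/-- Concatenation of the cyclic intervals `[a, b)` and `[b, c)`, for `b` in `[a, c)`. -/
theorem cyc_concat {a b c : Fin n} (h : cyc a c b = 1) (d : Fin n) :
    cyc a c d = cyc a b d + cyc b c d := by
  have := (b - a).isLt; have := (c - a).isLt; have := (d - a).isLt
  simp only [cyc, val_sub_rel a b] at h ⊢
  split_ifs at h ⊢ <;> omega

theorem cyc_rotate {a b c : Fin n} (h1 : a ≠ b) (h2 : b ≠ c) (h3 : a ≠ c) :
    cyc a c b = cyc b a c := by
  have h1' := val_sub_ne_zero h1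
  have h2' := val_sub_ne a h2
  have h3' := val_sub_ne_zero h3
  have := (b - a).isLt; have := (c - a).isLt
  simp only [cyc, val_sub_rel a b, sub_self, Fin.val_zero]
  split_ifs <;> omega

/-- The cyclic order of three distinct points. -/
theorem cyc_three {a b c : Fin n} (h1 : a ≠ b) (h2 : b ≠ c) (h3 : a ≠ c) :
    (cyc a c b = 1 ∧ cyc b a c = 1 ∧ cyc c b a = 1 ∧
      cyc c a b = 0 ∧ cyc a b c = 0 ∧ cyc b c a = 0) ∨
    (cyc a c b = 0 ∧ cyc b a c = 0 ∧ cyc c b a = 0 ∧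
      cyc c a b = 1 ∧ cyc a b c = 1 ∧ cyc b c a = 1) := by
  have e1 := cyc_rotate h1 h2 h3
  have e2 := cyc_rotate h2 h3.symm h1.symm
  have e3 := cyc_add_cyc h1 c
  have e4 := cyc_add_cyc h2 a
  have e5 := cyc_add_cyc h3 b
  omega

/-- Two pairs of points of a circle: each pair separates the other or neither does. -/
theorem cyc_cross {i j k l : Fin n} (hij : i ≠ j) (h1 : i ≠ k) (h2 : i ≠ l) (h3 : j ≠ k)
    (h4 : j ≠ l) : cyc k l i + cyc i j k = cyc k l j + cyc i j l := by
  have a1 := val_sub_ne_zero h1.symm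
  have a2 := val_sub_ne_zero h3.symm
  have a3 := val_sub_ne k hij
  have a4 := val_sub_ne k h2
  have a5 := val_sub_ne k h4
  have := (i - k).isLt; have := (j - k).isLt; have := (l - k).isLt
  simp only [cyc, val_sub_rel k i, sub_self, Fin.val_zero]
  split_ifs <;> omega

theorem cyc_succ (hn : 2 ≤ n) (i c : Fin n) : cyc i (i + 1) c = if c = i then 1 else 0 := by
  have h1 : (i + 1 - i).val = 1 := by
    rw [add_sub_cancel_left]
    obtain ⟨m, rfl⟩ : ∃ m, n = m + 2 := ⟨n - 2, by omega⟩
    rfl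
  have h2 : c = i ↔ (c - i).val = 0 := by
    rw [← sub_eq_zero (a := c), Fin.ext_iff]; simp
  simp only [cyc, h1, h2]
  split_ifs <;> omega

theorem succ_ne (hn : 2 ≤ n) (i : Fin n) : i ≠ i + 1 := by
  intro h
  have h1 := cyc_succ hn i i
  rw [← h, cyc_self] at h1
  simp at h1

/-- An interval all of whose points are equal to `i` is `[i, i + 1)`. -/
theorem eq_succ_of_cyc {i j : Fin n} (hij : i ≠ j) (h : ∀ c, cyc i j c = 1 → c = i) :
    j = i + 1 := by
  have h1 := cyc_step hij j
  rw [cyc_right, if_pos rfl, if_neg hij.symm] at h1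
  have := h (j - 1) (by omega)
  rw [← this]; abel

/-! ### Pairs of consecutive rectangles -/

/-- The data `(i, j)` and `(k, l)` determine two consecutive rectangles starting at `x`. -/
def IsRectPair (x : Generator n) (i j k l : Fin n) : Prop :=
  IsRect x i j ∧ IsRect (x * Equiv.swap i j) k l

/-- The multiplicities of the juxtaposition of two consecutive rectangles. -/
def pairCoeff (x : Generator n) (i j k l : Fin n) : Fin n → Fin n → ℕ := fun c r =>
  rectCoeff x i j c r + rectCoeff (x * Equiv.swap i j) k l c r

/-- Two pairs of consecutive rectangles from `x` with the same end point and the same sum. -/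
structure PairEquiv (x : Generator n) (i j k l i' j' k' l' : Fin n) : Prop where
  isPair : IsRectPair x i' j' k' l'
  endpoint : x * Equiv.swap i' j' * Equiv.swap k' l' = x * Equiv.swap i j * Equiv.swap k l
  coeff : pairCoeff x i' j' k' l' = pairCoeff x i j k l

theorem swap_val {a b c : Fin n} (x : Generator n) :
    (x * Equiv.swap a b) c = if c = a then x b else if c = b then x a else x c := by
  rw [Equiv.Perm.mul_apply, Equiv.swap_apply_def]; split_ifs <;> rfl

/-- To replace a pair of rectangles by another one with the same sum, involving the same three
circles, only the third point has to be checked for each of the new rectangles. -/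
theorem PairEquiv.mk_of_coeff {x : Generator n} {i j k l i' j' k' l' : Fin n}
    (h : IsRectPair x i j k l) (hij : i' ≠ j') (hkl : k' ≠ l')
    (hend : x * Equiv.swap i' j' * Equiv.swap k' l' = x * Equiv.swap i j * Equiv.swap k l)
    (hc : pairCoeff x i' j' k' l' = pairCoeff x i j k l)
    (h1 : ∀ m, m ≠ i' → m ≠ j' → (m = i ∨ m = j ∨ m = k ∨ m = l) → rectCoeff x i' j' m (x m) = 0)
    (h2 : ∀ m, m ≠ k' → m ≠ l' → (m = i ∨ m = j ∨ m = k ∨ m = l ∨ m = i' ∨ m = j') →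
      rectCoeff (x * Equiv.swap i' j') k' l' m ((x * Equiv.swap i' j') m) = 0) :
    PairEquiv x i j k l i' j' k' l' := by
  have key : ∀ m, ¬ (m = i ∨ m = j ∨ m = k ∨ m = l) → rectCoeff x i' j' m (x m) = 0 ∧
      rectCoeff (x * Equiv.swap i' j') k' l' m (x m) = 0 := by
    intro m hm
    push Not at hm
    have e1 := h.1.2 m hm.1 hm.2.1
    have e2 := h.2.2 m hm.2.2.1 hm.2.2.2
    rw [swap_val, if_neg hm.1, if_neg hm.2.1] at e2
    have e3 := congrFun (congrFun hc m) (x m)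
    simp only [pairCoeff] at e3
    omega
  refine ⟨⟨⟨hij, fun m hi hj => ?_⟩, hkl, fun m hk hl => ?_⟩, hend, hc⟩
  · by_cases hm : m = i ∨ m = j ∨ m = k ∨ m = l
    · exact h1 m hi hj hm
    · exact (key m hm).1
  · by_cases hm : m = i ∨ m = j ∨ m = k ∨ m = l ∨ m = i' ∨ m = j'
    · exact h2 m hk hl hm
    · push Not at hm
      rw [swap_val, if_neg hm.2.2.2.2.1, if_neg hm.2.2.2.2.2]
      refine (key m ?_).2
      rintro (h | h | h | h)
      exacts [hm.1 h, hm.2.1 h, hm.2.2.1 h, hm.2.2.2.1 h]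

theorem swap_three {x : Generator n} {a b c d a' b' c' d' : Fin n}
    (h : ∀ m, (if m = c' then (if d' = a' then x b' else if d' = b' then x a' else x d')
      else if m = d' then (if c' = a' then x b' else if c' = b' then x a' else x c')
      else (if m = a' then x b' else if m = b' then x a' else x m))
      = (if m = c then (if d = a then x b else if d = b then x a else x d)
      else if m = d then (if c = a then x b else if c = b then x a else x c)
      else (if m = a then x b else if m = b then x a else x m))) :
    x * Equiv.swap a' b' * Equiv.swap c' d' = x * Equiv.swap a b * Equiv.swap c d := by
  ext m
  simp only [swap_val]
  rw [h m]

theorem cyc_zero_or_one (a b c : Fin n) : cyc a b c = 0 ∨ cyc a b c = 1 := by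
  have := cyc_le_one a b c; omega

section moves

variable {x : Generator n} {i j k l : Fin n}

/-- The second rectangle lies to the left of the first one and is lower. -/
theorem IsRectPair.beside_left_lower (h : IsRectPair x i j k i) (hne : k ≠ j)
    (hr : cyc (x i) (x j) (x k) = 1) :
    PairEquiv x i j k i k j i j ∧ cyc k j i = 1 := by
  have hij := h.1.1
  have hni : k ≠ i := h.2.1
  have hnj : k ≠ j := hne
  have xij := x.injective.ne hij
  have xni := x.injective.ne hni
  have xnj := x.injective.ne hnj
  have e0 := h.1.2 k hni hnj
  rw [rectCoeff] at e0
  have cc := cyc_three hni hij hnj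
  have rr := cyc_three xni xij xnj
  have c1 : cyc k j i = 1 := by
    rcases cc with cc | cc <;> rcases rr with rr | rr <;> simp [cc, rr] at hr e0 ⊢
  have r1 : cyc (x i) (x j) (x k) = 1 := by
    rcases cc with cc | cc <;> rcases rr with rr | rr <;> simp [cc, rr] at hr e0 ⊢
  refine ⟨PairEquiv.mk_of_coeff h hnj hij (swap_three fun m => by grind) ?_ ?_ ?_, ?_⟩
  · ext c r
    simp only [pairCoeff, rectCoeff, swap_val, hij, hij.symm, hni, hni.symm, hnj, hnj.symm, if_true,
      if_false]
    rw [cyc_concat c1 c, cyc_concat r1 r]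
    ring
  · intro m h1 h2 h3
    obtain rfl : m = i := by
      rcases h3 with h3 | h3 | h3 | h3 <;> first | exact h3 | exact absurd h3 h1 | exact absurd h3 h2
    rcases cc with cc | cc <;> rcases rr with rr | rr <;> simp [cc, rr, rectCoeff] at c1 r1 ⊢
  · intro m h1 h2 h3
    obtain rfl : m = k := by
      rcases h3 with h3 | h3 | h3 | h3 | h3 | h3 <;> first | exact h3 | exact absurd h3 h1 | exact absurd h3 h2
    simp only [rectCoeff, swap_val, hij, hij.symm, hni, hni.symm, hnj, hnj.symm, if_true, if_false]
    rcases cc with cc | cc <;> rcases rr with rr | rr <;> simp [cc, rr] at c1 r1 ⊢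
  · rcases cc with cc | cc <;> rcases rr with rr | rr <;> simp [cc, rr] at c1 r1 ⊢

/-- The second rectangle lies to the left of the first one and is higher. -/
theorem IsRectPair.beside_left_higher (h : IsRectPair x i j k i) (hne : k ≠ j)
    (hr : cyc (x i) (x j) (x k) = 0) :
    PairEquiv x i j k i k i k j ∧ cyc k i j = 0 := by
  have hij := h.1.1
  have hni : k ≠ i := h.2.1
  have hnj : k ≠ j := hne
  have xij := x.injective.ne hij
  have xni := x.injective.ne hni
  have xnj := x.injective.ne hnj
  have e0 := h.2.2 j hnj.symm hij.symm
  simp only [rectCoeff, swap_val, hij, hij.symm, hni, hni.symm, hnj, hnj.symm, if_true,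
    if_false] at e0
  have cc := cyc_three hni hij hnj
  have rr := cyc_three xni xij xnj
  have c1 : cyc k j i = 1 := by
    rcases cc with cc | cc <;> rcases rr with rr | rr <;> simp [cc, rr] at hr e0 ⊢
  have r1 : cyc (x k) (x j) (x i) = 1 := by
    rcases cc with cc | cc <;> rcases rr with rr | rr <;> simp [cc, rr] at hr e0 ⊢
  refine ⟨PairEquiv.mk_of_coeff h hni hnj (swap_three fun m => by grind) ?_ ?_ ?_, ?_⟩
  · ext c r
    simp only [pairCoeff, rectCoeff, swap_val, hij, hij.symm, hni, hni.symm, hnj, hnj.symm, if_true,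
      if_false]
    rw [cyc_concat c1 c, cyc_concat r1 r]
    ring
  · intro m h1 h2 h3
    obtain rfl : m = j := by
      rcases h3 with h3 | h3 | h3 | h3 <;> first | exact h3 | exact absurd h3 h1 | exact absurd h3 h2
    rcases cc with cc | cc <;> rcases rr with rr | rr <;> simp [cc, rr, rectCoeff] at c1 r1 ⊢
  · intro m h1 h2 h3
    obtain rfl : m = i := by
      rcases h3 with h3 | h3 | h3 | h3 | h3 | h3 <;> first | exact h3 | exact absurd h3 h1 | exact absurd h3 h2
    simp only [rectCoeff, swap_val, hij, hij.symm, hni, hni.symm, hnj, hnj.symm, if_true, if_false]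
    rcases cc with cc | cc <;> rcases rr with rr | rr <;> simp [cc, rr] at c1 r1 ⊢
  · rcases cc with cc | cc <;> rcases rr with rr | rr <;> simp [cc, rr] at c1 r1 ⊢

/-- The second rectangle lies to the right of the first one and is lower. -/
theorem IsRectPair.beside_right_lower (h : IsRectPair x i j j l) (hne : l ≠ i)
    (hr : cyc (x i) (x j) (x l) = 1) :
    PairEquiv x i j j l i l i j ∧ cyc i l j = 1 := by
  have hij := h.1.1
  have hnj : l ≠ j := h.2.1.symm
  have hni : l ≠ i := hne
  have xij := x.injective.ne hij
  have xni := x.injective.ne hni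
  have xnj := x.injective.ne hnj
  have e0 := h.1.2 l hni hnj
  rw [rectCoeff] at e0
  have cc := cyc_three hni hij hnj
  have rr := cyc_three xni xij xnj
  have c1 : cyc i l j = 1 := by
    rcases cc with cc | cc <;> rcases rr with rr | rr <;> simp [cc, rr] at hr e0 ⊢
  have r1 : cyc (x i) (x j) (x l) = 1 := by
    rcases cc with cc | cc <;> rcases rr with rr | rr <;> simp [cc, rr] at hr e0 ⊢
  refine ⟨PairEquiv.mk_of_coeff h hni.symm hij (swap_three fun m => by grind) ?_ ?_ ?_, ?_⟩
  · ext c r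
    simp only [pairCoeff, rectCoeff, swap_val, hij, hij.symm, hni, hni.symm, hnj, hnj.symm, if_true,
      if_false]
    rw [cyc_concat c1 c, cyc_concat r1 r]
    ring
  · intro m h1 h2 h3
    obtain rfl : m = j := by
      rcases h3 with h3 | h3 | h3 | h3 <;> first | exact h3 | exact absurd h3 h1 | exact absurd h3 h2
    rcases cc with cc | cc <;> rcases rr with rr | rr <;> simp [cc, rr, rectCoeff] at c1 r1 ⊢
  · intro m h1 h2 h3
    obtain rfl : m = l := by
      rcases h3 with h3 | h3 | h3 | h3 | h3 | h3 <;> first | exact h3 | exact absurd h3 h1 | exact absurd h3 h2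
    simp only [rectCoeff, swap_val, hij, hij.symm, hni, hni.symm, hnj, hnj.symm, if_true, if_false]
    rcases cc with cc | cc <;> rcases rr with rr | rr <;> simp [cc, rr] at c1 r1 ⊢
  · rcases cc with cc | cc <;> rcases rr with rr | rr <;> simp [cc, rr] at c1 r1 ⊢

/-- The second rectangle lies to the right of the first one and is higher. -/
theorem IsRectPair.beside_right_higher (h : IsRectPair x i j j l) (hne : l ≠ i)
    (hr : cyc (x i) (x j) (x l) = 0) :
    PairEquiv x i j j l j l i l ∧ cyc j l i = 0 := by
  have hij := h.1.1
  have hnj : l ≠ j := h.2.1.symm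
  have hni : l ≠ i := hne
  have xij := x.injective.ne hij
  have xni := x.injective.ne hni
  have xnj := x.injective.ne hnj
  have e0 := h.2.2 i hij hni.symm
  simp only [rectCoeff, swap_val, hij, hij.symm, hni, hni.symm, hnj, hnj.symm, if_true,
    if_false] at e0
  have cc := cyc_three hni hij hnj
  have rr := cyc_three xni xij xnj
  have c1 : cyc i l j = 1 := by
    rcases cc with cc | cc <;> rcases rr with rr | rr <;> simp [cc, rr] at hr e0 ⊢
  have r1 : cyc (x i) (x l) (x j) = 1 := by
    rcases cc with cc | cc <;> rcases rr with rr | rr <;> simp [cc, rr] at hr e0 ⊢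
  refine ⟨PairEquiv.mk_of_coeff h hnj.symm hni.symm (swap_three fun m => by grind) ?_ ?_ ?_, ?_⟩
  · ext c r
    simp only [pairCoeff, rectCoeff, swap_val, hij, hij.symm, hni, hni.symm, hnj, hnj.symm, if_true,
      if_false]
    rw [cyc_concat c1 c, cyc_concat r1 r]
    ring
  · intro m h1 h2 h3
    obtain rfl : m = i := by
      rcases h3 with h3 | h3 | h3 | h3 <;> first | exact h3 | exact absurd h3 h1 | exact absurd h3 h2
    rcases cc with cc | cc <;> rcases rr with rr | rr <;> simp [cc, rr, rectCoeff] at c1 r1 ⊢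
  · intro m h1 h2 h3
    obtain rfl : m = j := by
      rcases h3 with h3 | h3 | h3 | h3 | h3 | h3 <;> first | exact h3 | exact absurd h3 h1 | exact absurd h3 h2
    simp only [rectCoeff, swap_val, hij, hij.symm, hni, hni.symm, hnj, hnj.symm, if_true, if_false]
    rcases cc with cc | cc <;> rcases rr with rr | rr <;> simp [cc, rr] at c1 r1 ⊢
  · rcases cc with cc | cc <;> rcases rr with rr | rr <;> simp [cc, rr] at c1 r1 ⊢

/-- The second rectangle lies on top of the first one and is narrower. -/
theorem IsRectPair.above_narrower (h : IsRectPair x i j i l) (hne : l ≠ j)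
    (hr : cyc i j l = 1) :
    PairEquiv x i j i l i l l j ∧ cyc (x i) (x l) (x j) = 1 := by
  have hij := h.1.1
  have hni : l ≠ i := h.2.1.symm
  have hnj : l ≠ j := hne
  have xij := x.injective.ne hij
  have xni := x.injective.ne hni
  have xnj := x.injective.ne hnj
  have e0 := h.1.2 l hni hnj
  rw [rectCoeff] at e0
  have cc := cyc_three hni hij hnj
  have rr := cyc_three xni xij xnj
  have c1 : cyc i j l = 1 := by
    rcases cc with cc | cc <;> rcases rr with rr | rr <;> simp [cc, rr] at hr e0 ⊢
  have r1 : cyc (x i) (x l) (x j) = 1 := by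
    rcases cc with cc | cc <;> rcases rr with rr | rr <;> simp [cc, rr] at hr e0 ⊢
  refine ⟨PairEquiv.mk_of_coeff h hni.symm hnj (swap_three fun m => by grind) ?_ ?_ ?_, ?_⟩
  · ext c r
    simp only [pairCoeff, rectCoeff, swap_val, hij, hij.symm, hni, hni.symm, hnj, hnj.symm, if_true,
      if_false]
    rw [cyc_concat c1 c, cyc_concat r1 r]
    ring
  · intro m h1 h2 h3
    obtain rfl : m = j := by
      rcases h3 with h3 | h3 | h3 | h3 <;> first | exact h3 | exact absurd h3 h1 | exact absurd h3 h2
    rcases cc with cc | cc <;> rcases rr with rr | rr <;> simp [cc, rr, rectCoeff] at c1 r1 ⊢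
  · intro m h1 h2 h3
    obtain rfl : m = i := by
      rcases h3 with h3 | h3 | h3 | h3 | h3 | h3 <;> first | exact h3 | exact absurd h3 h1 | exact absurd h3 h2
    simp only [rectCoeff, swap_val, hij, hij.symm, hni, hni.symm, hnj, hnj.symm, if_true, if_false]
    rcases cc with cc | cc <;> rcases rr with rr | rr <;> simp [cc, rr] at c1 r1 ⊢
  · rcases cc with cc | cc <;> rcases rr with rr | rr <;> simp [cc, rr] at c1 r1 ⊢

/-- The second rectangle lies on top of the first one and is wider. -/
theorem IsRectPair.above_wider (h : IsRectPair x i j i l) (hne : l ≠ j)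
    (hr : cyc i j l = 0) :
    PairEquiv x i j i l j l i j ∧ cyc (x j) (x l) (x i) = 0 := by
  have hij := h.1.1
  have hni : l ≠ i := h.2.1.symm
  have hnj : l ≠ j := hne
  have xij := x.injective.ne hij
  have xni := x.injective.ne hni
  have xnj := x.injective.ne hnj
  have e0 := h.2.2 j hij.symm hnj.symm
  simp only [rectCoeff, swap_val, hij, hij.symm, hni, hni.symm, hnj, hnj.symm, if_true,
    if_false] at e0
  have cc := cyc_three hni hij hnj
  have rr := cyc_three xni xij xnj
  have c1 : cyc i l j = 1 := by
    rcases cc with cc | cc <;> rcases rr with rr | rr <;> simp [cc, rr] at hr e0 ⊢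
  have r1 : cyc (x i) (x l) (x j) = 1 := by
    rcases cc with cc | cc <;> rcases rr with rr | rr <;> simp [cc, rr] at hr e0 ⊢
  refine ⟨PairEquiv.mk_of_coeff h hnj.symm hij (swap_three fun m => by grind) ?_ ?_ ?_, ?_⟩
  · ext c r
    simp only [pairCoeff, rectCoeff, swap_val, hij, hij.symm, hni, hni.symm, hnj, hnj.symm, if_true,
      if_false]
    rw [cyc_concat c1 c, cyc_concat r1 r]
    ring
  · intro m h1 h2 h3
    obtain rfl : m = i := by
      rcases h3 with h3 | h3 | h3 | h3 <;> first | exact h3 | exact absurd h3 h1 | exact absurd h3 h2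
    rcases cc with cc | cc <;> rcases rr with rr | rr <;> simp [cc, rr, rectCoeff] at c1 r1 ⊢
  · intro m h1 h2 h3
    obtain rfl : m = l := by
      rcases h3 with h3 | h3 | h3 | h3 | h3 | h3 <;> first | exact h3 | exact absurd h3 h1 | exact absurd h3 h2
    simp only [rectCoeff, swap_val, hij, hij.symm, hni, hni.symm, hnj, hnj.symm, if_true, if_false]
    rcases cc with cc | cc <;> rcases rr with rr | rr <;> simp [cc, rr] at c1 r1 ⊢
  · rcases cc with cc | cc <;> rcases rr with rr | rr <;> simp [cc, rr] at c1 r1 ⊢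

/-- The second rectangle lies below the first one and is narrower. -/
theorem IsRectPair.below_narrower (h : IsRectPair x i j k j) (hne : k ≠ i)
    (hr : cyc i j k = 1) :
    PairEquiv x i j k j k j i k ∧ cyc (x k) (x j) (x i) = 1 := by
  have hij := h.1.1
  have hnj : k ≠ j := h.2.1
  have hni : k ≠ i := hne
  have xij := x.injective.ne hij
  have xni := x.injective.ne hni
  have xnj := x.injective.ne hnj
  have e0 := h.1.2 k hni hnj
  rw [rectCoeff] at e0
  have cc := cyc_three hni hij hnj
  have rr := cyc_three xni xij xnj
  have c1 : cyc i j k = 1 := by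
    rcases cc with cc | cc <;> rcases rr with rr | rr <;> simp [cc, rr] at hr e0 ⊢
  have r1 : cyc (x k) (x j) (x i) = 1 := by
    rcases cc with cc | cc <;> rcases rr with rr | rr <;> simp [cc, rr] at hr e0 ⊢
  refine ⟨PairEquiv.mk_of_coeff h hnj hni.symm (swap_three fun m => by grind) ?_ ?_ ?_, ?_⟩
  · ext c r
    simp only [pairCoeff, rectCoeff, swap_val, hij, hij.symm, hni, hni.symm, hnj, hnj.symm, if_true,
      if_false]
    rw [cyc_concat c1 c, cyc_concat r1 r]
    ring
  · intro m h1 h2 h3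
    obtain rfl : m = i := by
      rcases h3 with h3 | h3 | h3 | h3 <;> first | exact h3 | exact absurd h3 h1 | exact absurd h3 h2
    rcases cc with cc | cc <;> rcases rr with rr | rr <;> simp [cc, rr, rectCoeff] at c1 r1 ⊢
  · intro m h1 h2 h3
    obtain rfl : m = j := by
      rcases h3 with h3 | h3 | h3 | h3 | h3 | h3 <;> first | exact h3 | exact absurd h3 h1 | exact absurd h3 h2
    simp only [rectCoeff, swap_val, hij, hij.symm, hni, hni.symm, hnj, hnj.symm, if_true, if_false]
    rcases cc with cc | cc <;> rcases rr with rr | rr <;> simp [cc, rr] at c1 r1 ⊢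
  · rcases cc with cc | cc <;> rcases rr with rr | rr <;> simp [cc, rr] at c1 r1 ⊢

/-- The second rectangle lies below the first one and is wider. -/
theorem IsRectPair.below_wider (h : IsRectPair x i j k j) (hne : k ≠ i)
    (hr : cyc i j k = 0) :
    PairEquiv x i j k j k i i j ∧ cyc (x k) (x i) (x j) = 0 := by
  have hij := h.1.1
  have hnj : k ≠ j := h.2.1
  have hni : k ≠ i := hne
  have xij := x.injective.ne hij
  have xni := x.injective.ne hni
  have xnj := x.injective.ne hnj
  have e0 := h.2.2 i hni.symm hij
  simp only [rectCoeff, swap_val, hij, hij.symm, hni, hni.symm, hnj, hnj.symm, if_true,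
    if_false] at e0
  have cc := cyc_three hni hij hnj
  have rr := cyc_three xni xij xnj
  have c1 : cyc k j i = 1 := by
    rcases cc with cc | cc <;> rcases rr with rr | rr <;> simp [cc, rr] at hr e0 ⊢
  have r1 : cyc (x k) (x j) (x i) = 1 := by
    rcases cc with cc | cc <;> rcases rr with rr | rr <;> simp [cc, rr] at hr e0 ⊢
  refine ⟨PairEquiv.mk_of_coeff h hni hij (swap_three fun m => by grind) ?_ ?_ ?_, ?_⟩
  · ext c r
    simp only [pairCoeff, rectCoeff, swap_val, hij, hij.symm, hni, hni.symm, hnj, hnj.symm, if_true,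
      if_false]
    rw [cyc_concat c1 c, cyc_concat r1 r]
    ring
  · intro m h1 h2 h3
    obtain rfl : m = j := by
      rcases h3 with h3 | h3 | h3 | h3 <;> first | exact h3 | exact absurd h3 h1 | exact absurd h3 h2
    rcases cc with cc | cc <;> rcases rr with rr | rr <;> simp [cc, rr, rectCoeff] at c1 r1 ⊢
  · intro m h1 h2 h3
    obtain rfl : m = k := by
      rcases h3 with h3 | h3 | h3 | h3 | h3 | h3 <;> first | exact h3 | exact absurd h3 h1 | exact absurd h3 h2
    simp only [rectCoeff, swap_val, hij, hij.symm, hni, hni.symm, hnj, hnj.symm, if_true, if_false]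
    rcases cc with cc | cc <;> rcases rr with rr | rr <;> simp [cc, rr] at c1 r1 ⊢
  · rcases cc with cc | cc <;> rcases rr with rr | rr <;> simp [cc, rr] at c1 r1 ⊢

/-- Two rectangles without common circles can be exchanged. -/
theorem IsRectPair.exchange (h : IsRectPair x i j k l) (h1 : k ≠ i) (h2 : k ≠ j) (h3 : l ≠ i)
    (h4 : l ≠ j) : PairEquiv x i j k l k l i j := by
  have hij := h.1.1
  have hkl := h.2.1
  have xij := x.injective.ne hij
  have xkl := x.injective.ne hkl
  have x1 := x.injective.ne h1
  have x2 := x.injective.ne h2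
  have x3 := x.injective.ne h3
  have x4 := x.injective.ne h4
  have e1 := h.1.2 k h1 h2
  have e2 := h.1.2 l h3 h4
  have e3 := h.2.2 i h1.symm h3.symm
  have e4 := h.2.2 j h2.symm h4.symm
  simp only [rectCoeff, swap_val, hij, hij.symm, h1, h1.symm, h2, h2.symm, h3, h3.symm, h4, h4.symm,
    if_true, if_false] at e1 e2 e3 e4
  have a := cyc_cross hij h1.symm h3.symm h2.symm h4.symm
  have b := cyc_cross xij x1.symm x3.symm x2.symm x4.symm
  have key : cyc k l i * cyc (x k) (x l) (x i) = 0 ∧ cyc k l j * cyc (x k) (x l) (x j) = 0 ∧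
      cyc i j k * cyc (x i) (x j) (x l) = 0 ∧ cyc i j l * cyc (x i) (x j) (x k) = 0 := by
    rcases cyc_zero_or_one k l i with p1 | p1 <;> rcases cyc_zero_or_one k l j with p2 | p2 <;>
    rcases cyc_zero_or_one i j k with p3 | p3 <;> rcases cyc_zero_or_one i j l with p4 | p4 <;>
    simp only [p1, p2, p3, p4, zero_mul, one_mul] at a e1 e2 e3 e4 <;>
    refine ⟨?_, ?_, ?_, ?_⟩ <;> simp only [p1, p2, p3, p4, zero_mul, one_mul] <;> omega
  refine PairEquiv.mk_of_coeff h hkl hij (swap_three fun m => by grind) ?_ ?_ ?_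
  · ext c r
    simp only [pairCoeff, rectCoeff, swap_val, hij, hij.symm, h1, h1.symm, h2, h2.symm, h3, h3.symm,
      h4, h4.symm, if_true, if_false]
    ring
  · intro m m1 m2 m3
    have : m = i ∨ m = j := by
      rcases m3 with m3 | m3 | m3 | m3
      exacts [Or.inl m3, Or.inr m3, absurd m3 m1, absurd m3 m2]
    rcases this with rfl | rfl
    · exact key.1
    · exact key.2.1
  · intro m m1 m2 m3
    have : m = k ∨ m = l := by
      rcases m3 with m3 | m3 | m3 | m3 | m3 | m3
      exacts [absurd m3 m1, absurd m3 m2, Or.inl m3, Or.inr m3, Or.inl m3, Or.inr m3]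
    rcases this with rfl | rfl <;>
    simp only [rectCoeff, swap_val, hij, hij.symm, h1, h1.symm, h2, h2.symm, h3, h3.symm,
      h4, h4.symm, hkl.symm, if_true, if_false]
    · exact key.2.2.1
    · exact key.2.2.2

end moves

/-! ### The cancellation of pairs of rectangles -/

/-- Multiplicities of the vertical annulus in column `c₀`. -/
def colCoeff (c₀ c _r : Fin n) : ℕ := if c = c₀ then 1 else 0

/-- Multiplicities of the horizontal annulus in row `r₀`. -/
def rowCoeff (r₀ _c r : Fin n) : ℕ := if r = r₀ then 1 else 0

theorem rectCoeff_col (hn : 2 ≤ n) (x : Generator n) (i : Fin n) :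
    pairCoeff x i (i + 1) i (i + 1) = colCoeff i := by
  have h := succ_ne hn i
  ext c r
  simp only [pairCoeff, rectCoeff, swap_val, h, h.symm, if_true, if_false]
  rw [← mul_add, cyc_add_cyc (x.injective.ne h), mul_one, cyc_succ hn, colCoeff]

theorem isRect_col (hn : 2 ≤ n) (x : Generator n) (i : Fin n) : IsRect x i (i + 1) := by
  refine ⟨succ_ne hn i, fun k h1 _ => ?_⟩
  rw [rectCoeff, cyc_succ hn, if_neg h1, zero_mul]

theorem isRect_row (hn : 2 ≤ n) (x : Generator n) {i j : Fin n} (h : x j = x i + 1) :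
    IsRect x i j := by
  refine ⟨fun hij => succ_ne hn (x i) (by rw [← h, hij]), fun k h1 _ => ?_⟩
  rw [rectCoeff, h, cyc_succ hn, if_neg (x.injective.ne h1), mul_zero]

theorem isRectPair_col_iff (hn : 2 ≤ n) (x : Generator n) (i j : Fin n) :
    IsRectPair x i j i j ↔ j = i + 1 := by
  constructor
  · intro h
    refine eq_succ_of_cyc h.1.1 fun c hc => ?_
    by_contra hci
    have hcj : c ≠ j := fun hcj => by rw [hcj, cyc_right] at hc; omega
    have e1 := h.1.2 c hci hcj
    have e2 := h.2.2 c hci hcj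
    simp only [rectCoeff, swap_val, h.1.1.symm, hci, hcj, if_true, if_false, hc, one_mul] at e1 e2
    have := cyc_add_cyc (x.injective.ne h.1.1) (x c)
    omega
  · rintro rfl
    exact ⟨isRect_col hn _ _, isRect_col hn _ _⟩

theorem isRectPair_row_iff (hn : 2 ≤ n) (x : Generator n) (i j : Fin n) :
    IsRectPair x i j j i ↔ x j = x i + 1 := by
  constructor
  · intro h
    refine eq_succ_of_cyc (x.injective.ne h.1.1) fun r hr => ?_
    obtain ⟨c, rfl⟩ := x.surjective r
    by_contra hci
    have hci : c ≠ i := fun h => hci (by rw [h])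
    have hcj : c ≠ j := fun hcj => by rw [hcj, cyc_right] at hr; omega
    have e1 := h.1.2 c hci hcj
    have e2 := h.2.2 c hcj hci
    simp only [rectCoeff, swap_val, h.1.1.symm, hci, hcj, if_true, if_false, hr, mul_one] at e1 e2
    have := cyc_add_cyc h.1.1 c
    omega
  · intro h
    have h1 := isRect_row hn x h
    refine ⟨h1, isRect_row hn _ ?_⟩
    simp only [swap_val, h1.1.symm, if_true, if_false, h]

theorem rectCoeff_row (hn : 2 ≤ n) (x : Generator n) {i j : Fin n} (h : x j = x i + 1) :
    pairCoeff x i j j i = rowCoeff (x i) := by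
  have h1 := (isRect_row hn x h).1
  ext c r
  simp only [pairCoeff, rectCoeff, swap_val, h1, h1.symm, if_true, if_false]
  rw [← add_mul, cyc_add_cyc h1, one_mul, h, cyc_succ hn, rowCoeff]

open Classical in
/-- The other way of cutting the sum of two consecutive rectangles into two rectangles. -/
def otherPair (x : Generator n) : Fin n × Fin n × Fin n × Fin n → Fin n × Fin n × Fin n × Fin n
  | (i, j, k, l) =>
    if l = i then (if cyc (x i) (x j) (x k) = 1 then (k, j, i, j) else (k, i, k, j))
    else if k = j then (if cyc (x i) (x j) (x l) = 1 then (i, l, i, j) else (j, l, i, l))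
    else if k = i then (if cyc i j l = 1 then (i, l, l, j) else (j, l, i, j))
    else if l = j then (if cyc i j k = 1 then (k, j, i, k) else (k, i, i, j))
    else (k, l, i, j)

/-- The two rectangles of a pair have the same two pairs of circles. -/
def IsAnnular (q : Fin n × Fin n × Fin n × Fin n) : Prop :=
  (q.2.2.1 = q.1 ∧ q.2.2.2 = q.2.1) ∨ (q.2.2.1 = q.2.1 ∧ q.2.2.2 = q.1)

theorem otherPair_spec {x : Generator n} {i j k l : Fin n} (h : IsRectPair x i j k l)
    (ha : ¬ IsAnnular (i, j, k, l)) : ∃ i' j' k' l', otherPair x (i, j, k, l) = (i', j', k', l') ∧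
      PairEquiv x i j k l i' j' k' l' ∧ ¬ IsAnnular (i', j', k', l') ∧
      (i', j', k', l') ≠ (i, j, k, l) ∧ otherPair x (i', j', k', l') = (i, j, k, l) := by
  have hij := h.1.1
  have hkl := h.2.1
  simp only [IsAnnular, not_or, not_and] at ha ⊢
  by_cases h1 : l = i
  · subst h1
    have hkj : k ≠ j := fun h => ha.2 h rfl
    rcases cyc_zero_or_one (x l) (x j) (x k) with hr | hr
    · obtain ⟨e, f⟩ := h.beside_left_higher hkj hr
      refine ⟨k, l, k, j, by simp [otherPair, hr], e, ?_⟩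
      simp [otherPair, hij, hij.symm, hkl, hkl.symm, hkj, hkj.symm, f]
    · obtain ⟨e, f⟩ := h.beside_left_lower hkj hr
      refine ⟨k, j, l, j, by simp [otherPair, hr], e, ?_⟩
      simp [otherPair, hij, hij.symm, hkl, hkl.symm, hkj, hkj.symm, f]
  by_cases h2 : k = j
  · subst h2
    rcases cyc_zero_or_one (x i) (x k) (x l) with hr | hr
    · obtain ⟨e, f⟩ := h.beside_right_higher h1 hr
      refine ⟨k, l, i, l, by simp [otherPair, hr, h1], e, ?_⟩
      simp [otherPair, hij, hij.symm, hkl, hkl.symm, h1, Ne.symm h1, f]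
    · obtain ⟨e, f⟩ := h.beside_right_lower h1 hr
      refine ⟨i, l, i, k, by simp [otherPair, hr, h1], e, ?_⟩
      simp [otherPair, hij, hij.symm, hkl, hkl.symm, h1, Ne.symm h1, f]
  by_cases h3 : k = i
  · subst h3
    have hlj : l ≠ j := ha.1 rfl
    rcases cyc_zero_or_one k j l with hr | hr
    · obtain ⟨e, f⟩ := h.above_wider hlj hr
      refine ⟨j, l, k, j, by simp [otherPair, hr, h1, h2], e, ?_⟩
      simp [otherPair, hij, hij.symm, hkl, hkl.symm, hlj, hlj.symm, f]
    · obtain ⟨e, f⟩ := h.above_narrower hlj hr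
      refine ⟨k, l, l, j, by simp [otherPair, hr, h1, h2], e, ?_⟩
      simp [otherPair, hij, hij.symm, hkl, hkl.symm, hlj, hlj.symm, f]
  by_cases h4 : l = j
  · subst h4
    rcases cyc_zero_or_one i l k with hr | hr
    · obtain ⟨e, f⟩ := h.below_wider h3 hr
      refine ⟨k, i, i, l, by simp [otherPair, hr, h1, h2, h3], e, ?_⟩
      simp [otherPair, hij, hij.symm, hkl, hkl.symm, h3, Ne.symm h3, f]
    · obtain ⟨e, f⟩ := h.below_narrower h3 hr
      refine ⟨k, l, i, k, by simp [otherPair, hr, h1, h2, h3], e, ?_⟩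
      simp [otherPair, hij, hij.symm, hkl, hkl.symm, h3, Ne.symm h3, f]
  · refine ⟨k, l, i, j, by simp [otherPair, h1, h2, h3, h4], h.exchange h3 h2 h1 h4, ?_⟩
    simp [otherPair, Ne.symm h1, Ne.symm h2, Ne.symm h3, Ne.symm h4, h1, h2, h3, h4]

open Classical in
/-- The pairs of consecutive rectangles with a given sum cancel in pairs, except that each annulus
is such a sum in exactly one way. -/
theorem sum_rectPair (hn : 2 ≤ n) {M : Type*} [AddCommGroup M] (hM : ∀ m : M, m + m = 0)
    (x : Generator n) (F : Generator n → (Fin n → Fin n → ℕ) → M) :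
    (∑ i, ∑ j, ∑ k, ∑ l, if IsRectPair x i j k l then
      F (x * Equiv.swap i j * Equiv.swap k l) (pairCoeff x i j k l) else 0)
    = ∑ c, F x (colCoeff c) + ∑ r, F x (rowCoeff r) := by
  let f : Fin n × Fin n × Fin n × Fin n → M := fun q =>
    if IsRectPair x q.1 q.2.1 q.2.2.1 q.2.2.2 then
      F (x * Equiv.swap q.1 q.2.1 * Equiv.swap q.2.2.1 q.2.2.2)
        (pairCoeff x q.1 q.2.1 q.2.2.1 q.2.2.2) else 0
  have e1 : (∑ i, ∑ j, ∑ k, ∑ l, if IsRectPair x i j k l then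
      F (x * Equiv.swap i j * Equiv.swap k l) (pairCoeff x i j k l) else 0) = ∑ q, f q := by
    simp only [Fintype.sum_prod_type, f]
  have e2 : ∑ q with ¬ IsAnnular q, f q = 0 := by
    rw [← Finset.sum_filter_ne_zero]
    refine Finset.sum_involution (fun q _ => otherPair x q) ?_ ?_ ?_ ?_
    all_goals
      rintro ⟨i, j, k, l⟩ hq
      simp only [Finset.mem_filter, Finset.mem_univ, true_and] at hq
      have hp : IsRectPair x i j k l := by
        by_contra h
        exact hq.2 (if_neg h)
      obtain ⟨i', j', k', l', o1, o2, o3, o4, o5⟩ := otherPair_spec hp hq.1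
      have hf : f (i', j', k', l') = f (i, j, k, l) := by
        simp only [f]
        rw [if_pos hp, if_pos o2.isPair, o2.endpoint, o2.coeff]
      simp only [o1]
    · rw [hf, hM]
    · intro _; exact o4
    · simp only [Finset.mem_filter, Finset.mem_univ, true_and]
      exact ⟨o3, by rw [hf]; exact hq.2⟩
    · exact o5
  have e3 : ∑ q with IsAnnular q, f q =
      (∑ i, ∑ j, f (i, j, i, j)) + ∑ i, ∑ j, f (i, j, j, i) := by
    have d1 : ∀ i j : Fin n, (∑ k, ∑ l, if IsAnnular (i, j, k, l) then f (i, j, k, l) else 0)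
        = f (i, j, i, j) + f (i, j, j, i) := by
      intro i j
      by_cases hij : i = j
      · have : ∀ k l, f (i, j, k, l) = 0 := fun k l => if_neg fun h => h.1.1 hij
        simp [this]
      · rw [← Fintype.sum_prod_type' (f := fun k l => if IsAnnular (i, j, k, l) then
          f (i, j, k, l) else 0), ← Finset.sum_filter]
        have : (Finset.univ.filter fun q : Fin n × Fin n => IsAnnular (i, j, q.1, q.2))
            = {(i, j), (j, i)} := by
          ext ⟨k, l⟩
          rw [Finset.mem_filter]
          simp only [Finset.mem_univ, true_and, IsAnnular, Finset.mem_insert,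
            Finset.mem_singleton, Prod.mk.injEq]
        rw [this, Finset.sum_pair]
        simp [hij]
    rw [Finset.sum_filter]
    simp only [Fintype.sum_prod_type]
    rw [← Finset.sum_add_distrib]
    refine Finset.sum_congr rfl fun i _ => ?_
    rw [← Finset.sum_add_distrib]
    exact Finset.sum_congr rfl fun j _ => d1 i j
  rw [e1, ← Finset.sum_filter_add_sum_filter_not _ (fun q => IsAnnular q), e2, add_zero, e3]
  congr 1
  · refine Finset.sum_congr rfl fun i _ => ?_
    simp only [f, isRectPair_col_iff hn, Finset.sum_ite_eq', Finset.mem_univ, if_true]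
    rw [rectCoeff_col hn, mul_assoc,
      Equiv.swap_mul_self, mul_one]
  · rw [← Equiv.sum_comp x fun r => F x (rowCoeff r)]
    refine Finset.sum_congr rfl fun i _ => ?_
    rw [Finset.sum_eq_single (x.symm (x i + 1))]
    · have h : x (x.symm (x i + 1)) = x i + 1 := by simp
      simp only [f]
      rw [if_pos ((isRectPair_row_iff hn x _ _).2 h), rectCoeff_row hn x h, Equiv.swap_comm i,
        mul_assoc, Equiv.swap_mul_self, mul_one]
    · intro j _ hj
      refine if_neg fun h => hj ?_
      have h' : x j = x i + 1 := (isRectPair_row_iff hn x i j).1 h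
      rw [← h']; simp
    · simp

/-! ### The complex of domains -/

/-- Chains of positive domains, without partitions. -/
abbrev DChain (n : ℕ) [NeZero n] := PosDomain n →₀ ZMod 2

/-- The multiplicities `a` are those of a domain from `x` to `y`. -/
def BdryCond (x y : Generator n) (a : Fin n → Fin n → ℕ) : Prop := ∀ c r : Fin n,
  a (c - 1) r + a c (r - 1) + (if x c = r then 1 else 0)
    = a c r + a (c - 1) (r - 1) + (if y c = r then 1 else 0)

open Classical in
/-- The domain from `x` to `y` with multiplicities `a` as a chain, zero if there is none. -/
def mkDom (x y : Generator n) (a : Fin n → Fin n → ℕ) : DChain n :=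
  if h : BdryCond x y a then Finsupp.single ⟨x, y, a, h⟩ 1 else 0

theorem mkDom_self (D : PosDomain n) : mkDom D.x D.y D.coeff = Finsupp.single D 1 :=
  dif_pos D.bdry

open Classical in
/-- Remove the rectangle `(i, j)` from the beginning of the domain. -/
def firstTerm (D : PosDomain n) (i j : Fin n) : DChain n :=
  if h : IsRect D.x i j ∧ ∀ c r, rectCoeff D.x i j c r ≤ D.coeff c r
  then Finsupp.single (removeFirst D i j h.1.1 h.2) 1 else 0

open Classical in
/-- Remove the rectangle `(i, j)` from the end of the domain. -/
def lastTerm (D : PosDomain n) (i j : Fin n) : DChain n :=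
  if h : IsRect (D.y * Equiv.swap i j) i j ∧
      ∀ c r, rectCoeff (D.y * Equiv.swap i j) i j c r ≤ D.coeff c r
  then Finsupp.single (removeLast D i j h.1.1 h.2) 1 else 0

theorem firstTerm_pos (D : PosDomain n) {i j : Fin n}
    (h : IsRect D.x i j ∧ rectCoeff D.x i j ≤ D.coeff) :
    firstTerm D i j = Finsupp.single (removeFirst D i j h.1.1 h.2) 1 := dif_pos h

theorem firstTerm_neg (D : PosDomain n) {i j : Fin n}
    (h : ¬ (IsRect D.x i j ∧ rectCoeff D.x i j ≤ D.coeff)) : firstTerm D i j = 0 := dif_neg h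

theorem lastTerm_pos (D : PosDomain n) {i j : Fin n}
    (h : IsRect (D.y * Equiv.swap i j) i j ∧
      rectCoeff (D.y * Equiv.swap i j) i j ≤ D.coeff) :
    lastTerm D i j = Finsupp.single (removeLast D i j h.1.1 h.2) 1 := dif_pos h

theorem lastTerm_neg (D : PosDomain n) {i j : Fin n}
    (h : ¬ (IsRect (D.y * Equiv.swap i j) i j ∧
      rectCoeff (D.y * Equiv.swap i j) i j ≤ D.coeff)) : lastTerm D i j = 0 := dif_neg h

open Classical in
theorem firstTerm_eq (D : PosDomain n) (i j : Fin n) : firstTerm D i j =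
    if IsRect D.x i j ∧ rectCoeff D.x i j ≤ D.coeff then
      mkDom (D.x * Equiv.swap i j) D.y (D.coeff - rectCoeff D.x i j) else 0 := by
  by_cases h : IsRect D.x i j ∧ rectCoeff D.x i j ≤ D.coeff
  · rw [firstTerm_pos D h, if_pos h, ← mkDom_self]; rfl
  · rw [firstTerm_neg D h, if_neg h]

open Classical in
theorem lastTerm_eq (D : PosDomain n) (i j : Fin n) : lastTerm D i j =
    if IsRect (D.y * Equiv.swap i j) i j ∧ rectCoeff (D.y * Equiv.swap i j) i j ≤ D.coeff then
      mkDom D.x (D.y * Equiv.swap i j) (D.coeff - rectCoeff (D.y * Equiv.swap i j) i j)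
    else 0 := by
  by_cases h : IsRect (D.y * Equiv.swap i j) i j ∧
      rectCoeff (D.y * Equiv.swap i j) i j ≤ D.coeff
  · rw [lastTerm_pos D h, if_pos h, ← mkDom_self]; rfl
  · rw [lastTerm_neg D h, if_neg h]

/-- Removal of a rectangle from the beginning. -/
def firstOp : DChain n →ₗ[ZMod 2] DChain n := lin fun D => ∑ i, ∑ j, firstTerm D i j

/-- Removal of a rectangle from the end. -/
def lastOp : DChain n →ₗ[ZMod 2] DChain n := lin fun D => ∑ i, ∑ j, lastTerm D i j

/-- The differential on domains: remove a rectangle from the beginning or from the end. -/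
def domOp : DChain n →ₗ[ZMod 2] DChain n := firstOp + lastOp

theorem firstOp_single (D : PosDomain n) :
    firstOp (Finsupp.single D 1) = ∑ i, ∑ j, firstTerm D i j := lin_single _ _

theorem lastOp_single (D : PosDomain n) :
    lastOp (Finsupp.single D 1) = ∑ i, ∑ j, lastTerm D i j := lin_single _ _

open Classical in
theorem lin_firstTerm_firstTerm (D : PosDomain n) (i j k l : Fin n) :
    lin (fun E => firstTerm E k l) (firstTerm D i j) =
      if IsRectPair D.x i j k l then
        if pairCoeff D.x i j k l ≤ D.coeff then
          mkDom (D.x * Equiv.swap i j * Equiv.swap k l) D.y (D.coeff - pairCoeff D.x i j k l)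
        else 0
      else 0 := by
  by_cases h : IsRect D.x i j ∧ rectCoeff D.x i j ≤ D.coeff
  · rw [firstTerm_pos D h, lin_single, firstTerm_eq]
    by_cases h2 : IsRect (D.x * Equiv.swap i j) k l
    · rw [if_pos (show IsRectPair D.x i j k l from ⟨h.1, h2⟩)]
      by_cases h3 : pairCoeff D.x i j k l ≤ D.coeff
      · rw [if_pos h3, if_pos]
        · congr 1
          funext c r
          simp only [removeFirst, Pi.sub_apply, pairCoeff]
          omega
        · refine ⟨h2, fun c r => ?_⟩
          have := h3 c r
          simp only [pairCoeff] at this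
          simp only [removeFirst]
          omega
      · rw [if_neg h3, if_neg]
        rintro ⟨-, h4⟩
        refine h3 fun c r => ?_
        have h5 := h4 c r
        have h6 : rectCoeff D.x i j c r ≤ D.coeff c r := h.2 c r
        simp only [removeFirst] at h5
        simp only [pairCoeff]
        omega
    · rw [if_neg (fun h' : IsRectPair D.x i j k l => h2 h'.2), if_neg fun h' => h2 h'.1]
  · rw [firstTerm_neg D h, map_zero]
    split_ifs with h1 h2
    · exact absurd ⟨h1.1, fun c r => le_trans (Nat.le_add_right _ _) (h2 c r)⟩ h
    · rfl
    · rfl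

open Classical in
theorem lin_lastTerm_lastTerm (D : PosDomain n) (i j k l : Fin n) :
    lin (fun E => lastTerm E k l) (lastTerm D i j) =
      if IsRectPair (D.y * Equiv.swap i j * Equiv.swap k l) k l i j then
        if pairCoeff (D.y * Equiv.swap i j * Equiv.swap k l) k l i j ≤ D.coeff then
          mkDom D.x (D.y * Equiv.swap i j * Equiv.swap k l)
            (D.coeff - pairCoeff (D.y * Equiv.swap i j * Equiv.swap k l) k l i j)
        else 0
      else 0 := by
  have e : D.y * Equiv.swap i j * Equiv.swap k l * Equiv.swap k l = D.y * Equiv.swap i j := by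
    rw [mul_assoc, Equiv.swap_mul_self, mul_one]
  by_cases h : IsRect (D.y * Equiv.swap i j) i j ∧ rectCoeff (D.y * Equiv.swap i j) i j ≤ D.coeff
  · rw [lastTerm_pos D h, lin_single, lastTerm_eq]
    by_cases h2 : IsRect (D.y * Equiv.swap i j * Equiv.swap k l) k l
    · rw [if_pos (show IsRectPair (D.y * Equiv.swap i j * Equiv.swap k l) k l i j from
        ⟨h2, by rw [e]; exact h.1⟩)]
      by_cases h3 : pairCoeff (D.y * Equiv.swap i j * Equiv.swap k l) k l i j ≤ D.coeff
      · rw [if_pos h3, if_pos]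
        · congr 1
          funext c r
          simp only [removeLast, Pi.sub_apply, pairCoeff, e]
          omega
        · refine ⟨h2, fun c r => ?_⟩
          have := h3 c r
          simp only [pairCoeff, e] at this
          simp only [removeLast]
          omega
      · rw [if_neg h3, if_neg]
        rintro ⟨-, h4⟩
        refine h3 fun c r => ?_
        have h5 := h4 c r
        have h6 : rectCoeff (D.y * Equiv.swap i j) i j c r ≤ D.coeff c r := h.2 c r
        simp only [removeLast] at h5
        simp only [pairCoeff, e]
        omega
    · rw [if_neg (fun h' : IsRectPair (D.y * Equiv.swap i j * Equiv.swap k l) k l i j => h2 h'.1),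
        if_neg fun h' => h2 h'.1]
  · rw [lastTerm_neg D h, map_zero]
    split_ifs with h1 h2
    · refine absurd ⟨by have := h1.2; rwa [e] at this, fun c r => ?_⟩ h
      have h3 : pairCoeff (D.y * Equiv.swap i j * Equiv.swap k l) k l i j c r ≤ D.coeff c r := h2 c r
      simp only [pairCoeff, e] at h3
      exact (Nat.le_add_left _ _).trans h3
    · rfl
    · rfl

theorem lin_sum_fun {X M ι : Type*} [AddCommGroup M] [Module (ZMod 2) M] (s : Finset ι)
    (f : ι → X → M) (z : X →₀ ZMod 2) : lin (fun x => ∑ i ∈ s, f i x) z = ∑ i ∈ s, lin (f i) z := by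
  simp only [lin, Finsupp.linearCombination_apply, Finsupp.sum, Finset.smul_sum]
  rw [Finset.sum_comm]

theorem sum_comm_pairs {M : Type*} [AddCommMonoid M] (f : Fin n → Fin n → Fin n → Fin n → M) :
    ∑ i, ∑ j, ∑ k, ∑ l, f i j k l = ∑ k, ∑ l, ∑ i, ∑ j, f i j k l := by
  have h : ∀ g : Fin n → Fin n → M, ∑ i, ∑ j, g i j = ∑ p : Fin n × Fin n, g p.1 p.2 := fun g =>
    (Fintype.sum_prod_type' g).symm
  simp only [h]
  exact Finset.sum_comm

open Classical in
/-- The domains obtained by removing one annulus. -/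
def annulusRemovals (D : PosDomain n) : DChain n :=
  (∑ c, if colCoeff c ≤ D.coeff then mkDom D.x D.y (D.coeff - colCoeff c) else 0)
  + ∑ r, if rowCoeff r ≤ D.coeff then mkDom D.x D.y (D.coeff - rowCoeff r) else 0

theorem firstOp_firstOp (hn : 2 ≤ n) (D : PosDomain n) :
    firstOp (firstOp (Finsupp.single D 1)) = annulusRemovals D := by
  classical
  rw [firstOp_single]
  simp only [map_sum]
  simp only [firstOp, lin_sum_fun, lin_firstTerm_firstTerm]
  exact sum_rectPair hn add_self_zmod_two D.x fun z T => if T ≤ D.coeff then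
    mkDom z D.y (D.coeff - T) else 0

theorem lastOp_lastOp (hn : 2 ≤ n) (D : PosDomain n) :
    lastOp (lastOp (Finsupp.single D 1)) = annulusRemovals D := by
  classical
  rw [lastOp_single]
  simp only [map_sum]
  simp only [lastOp, lin_sum_fun, lin_lastTerm_lastTerm]
  let G : Generator n → Generator n → (Fin n → Fin n → ℕ) → DChain n := fun z w T =>
    if w = D.y then (if T ≤ D.coeff then mkDom D.x z (D.coeff - T) else 0) else 0
  have h1 : ∀ i j k l : Fin n,
      (if IsRectPair (D.y * Equiv.swap i j * Equiv.swap k l) k l i j then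
        if pairCoeff (D.y * Equiv.swap i j * Equiv.swap k l) k l i j ≤ D.coeff then
          mkDom D.x (D.y * Equiv.swap i j * Equiv.swap k l)
            (D.coeff - pairCoeff (D.y * Equiv.swap i j * Equiv.swap k l) k l i j)
        else 0
      else 0) = ∑ z, if IsRectPair z k l i j then
        G z (z * Equiv.swap k l * Equiv.swap i j) (pairCoeff z k l i j) else 0 := by
    intro i j k l
    rw [Finset.sum_eq_single (D.y * Equiv.swap i j * Equiv.swap k l)]
    · simp only [G, mul_assoc, Equiv.swap_mul_self_mul, Equiv.swap_mul_self, mul_one, if_true]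
    · intro z _ hz
      have : z * Equiv.swap k l * Equiv.swap i j ≠ D.y := fun h =>
        hz (by rw [← h]; simp [mul_assoc])
      simp [G, this]
    · simp
  simp only [h1]
  have h2 : ∀ z, (∑ i, ∑ j, ∑ k, ∑ l, if IsRectPair z k l i j then
        G z (z * Equiv.swap k l * Equiv.swap i j) (pairCoeff z k l i j) else 0)
      = ∑ c, G z z (colCoeff c) + ∑ r, G z z (rowCoeff r) := by
    intro z
    rw [← sum_rectPair hn add_self_zmod_two z (G z)]
    exact sum_comm_pairs _
  have h3 : ∀ z, z ≠ D.y → (∑ c, G z z (colCoeff c) + ∑ r, G z z (rowCoeff r)) = 0 := by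
    intro z hz
    simp [G, hz]
  have h4 : ∑ z, (∑ c, G z z (colCoeff c) + ∑ r, G z z (rowCoeff r)) = annulusRemovals D := by
    rw [Finset.sum_eq_single D.y (fun z _ hz => h3 z hz) (by simp)]
    simp [G, annulusRemovals]
  rw [← h4, ← Finset.sum_congr rfl fun z _ => h2 z]
  symm
  rw [Finset.sum_comm]
  refine Finset.sum_congr rfl fun i _ => ?_
  rw [Finset.sum_comm]
  refine Finset.sum_congr rfl fun j _ => ?_
  rw [Finset.sum_comm]
  refine Finset.sum_congr rfl fun k _ => ?_
  rw [Finset.sum_comm]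

theorem firstTerm_lastTerm_comm (D : PosDomain n) (i j k l : Fin n) :
    lin (fun E => firstTerm E k l) (lastTerm D i j)
      = lin (fun E => lastTerm E i j) (firstTerm D k l) := by
  classical
  by_cases h1 : IsRect (D.y * Equiv.swap i j) i j ∧ rectCoeff (D.y * Equiv.swap i j) i j ≤ D.coeff
  · by_cases h2 : IsRect D.x k l ∧ rectCoeff D.x k l ≤ D.coeff
    · rw [lastTerm_pos D h1, lin_single, firstTerm_pos D h2, lin_single, firstTerm_eq,
        lastTerm_eq]
      by_cases h3 : ∀ c r, rectCoeff (D.y * Equiv.swap i j) i j c r + rectCoeff D.x k l c r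
          ≤ D.coeff c r
      · rw [if_pos, if_pos]
        · congr 1
          funext c r
          simp only [removeFirst, removeLast, Pi.sub_apply]
          omega
        · refine ⟨h1.1, fun c r => ?_⟩
          have := h3 c r
          simp only [removeFirst]; omega
        · refine ⟨h2.1, fun c r => ?_⟩
          have := h3 c r
          simp only [removeLast]; omega
      · rw [if_neg, if_neg]
        · rintro ⟨-, h4⟩
          refine h3 fun c r => ?_
          have h5 := h4 c r
          have h6 : rectCoeff D.x k l c r ≤ D.coeff c r := h2.2 c r
          simp only [removeFirst] at h5
          omega
        · rintro ⟨-, h4⟩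
          refine h3 fun c r => ?_
          have h5 := h4 c r
          have h6 : rectCoeff (D.y * Equiv.swap i j) i j c r ≤ D.coeff c r := h1.2 c r
          simp only [removeLast] at h5
          omega
    · rw [lastTerm_pos D h1, lin_single, firstTerm_eq, firstTerm_neg D h2, map_zero, if_neg]
      rintro ⟨h3, h4⟩
      refine h2 ⟨h3, fun c r => (h4 c r).trans ?_⟩
      simp only [removeLast]; omega
  · by_cases h2 : IsRect D.x k l ∧ rectCoeff D.x k l ≤ D.coeff
    · rw [lastTerm_neg D h1, map_zero, firstTerm_pos D h2, lin_single, lastTerm_eq, if_neg]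
      rintro ⟨h3, h4⟩
      refine h1 ⟨h3, fun c r => (h4 c r).trans ?_⟩
      simp only [removeFirst]; omega
    · rw [lastTerm_neg D h1, firstTerm_neg D h2, map_zero, map_zero]

theorem firstOp_lastOp (z : DChain n) : firstOp (lastOp z) = lastOp (firstOp z) := by
  have : (firstOp ∘ₗ lastOp : DChain n →ₗ[ZMod 2] DChain n) = lastOp ∘ₗ firstOp :=
    linearMap_ext_single fun D => by
      rw [LinearMap.comp_apply, LinearMap.comp_apply, firstOp_single, lastOp_single]
      simp only [map_sum]
      simp only [firstOp, lastOp, lin_sum_fun, firstTerm_lastTerm_comm]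
      exact sum_comm_pairs _
  exact LinearMap.congr_fun this z

/-- Removing two rectangles from the beginning or two from the end gives the same sum, namely the
removals of annuli; the other terms of the square cancel in pairs. -/
theorem domOp_domOp (hn : 2 ≤ n) (z : DChain n) : domOp (domOp z) = 0 := by
  have : (domOp ∘ₗ domOp : DChain n →ₗ[ZMod 2] DChain n) = 0 := linearMap_ext_single fun D => by
    simp only [LinearMap.comp_apply, domOp, LinearMap.add_apply, map_add, LinearMap.zero_apply,
      firstOp_firstOp hn, lastOp_lastOp hn, firstOp_lastOp]
    set X := annulusRemovals D
    set Y := lastOp (firstOp (Finsupp.single D 1))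
    calc _ = (X + X) + (Y + Y) := by abel
      _ = 0 := by rw [add_self_zmod_two, add_self_zmod_two, add_zero]
  exact LinearMap.congr_fun this z

/-! ### Counting annuli -/

open Classical in
/-- The number of terms with multiplicities `p` whose initial and final generators agree. -/
def annulusCount (p : Fin n → Fin n → ℕ) : DChain n →ₗ[ZMod 2] ZMod 2 :=
  lin fun D => if D.x = D.y ∧ D.coeff = p then 1 else 0

open Classical in
/-- The total multiplicity of a square in the rectangles of a chain. -/
def squareCount (c r : Fin n) : DChain n →ₗ[ZMod 2] ZMod 2 :=
  lin fun D => ∑ i, ∑ j, if IsRect D.x i j ∧ D.y = D.x * Equiv.swap i j ∧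
    D.coeff = rectCoeff D.x i j then (rectCoeff D.x i j c r : ZMod 2) else 0

theorem mul_swap_eq_iff (x y : Generator n) (i j : Fin n) :
    x * Equiv.swap i j = y ↔ x = y * Equiv.swap i j := by
  constructor <;> rintro rfl <;> rw [mul_assoc, Equiv.swap_mul_self, mul_one]

theorem annulusCount_domOp (p : Fin n → Fin n → ℕ) (z : DChain n) :
    annulusCount p (domOp z) = 0 := by
  classical
  have : (annulusCount p ∘ₗ domOp : DChain n →ₗ[ZMod 2] ZMod 2) = 0 :=
    linearMap_ext_single fun D => by
      rw [LinearMap.comp_apply, domOp, LinearMap.add_apply, firstOp_single, lastOp_single, map_add]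
      simp only [map_sum, LinearMap.zero_apply]
      rw [← add_self_zmod_two (∑ i, ∑ j, annulusCount p (firstTerm D i j))]
      congr 1
      refine Finset.sum_congr rfl fun i _ => Finset.sum_congr rfl fun j _ => ?_
      have h1 : ∀ z w : Generator n, ∀ (R : Fin n → Fin n → ℕ), R ≤ D.coeff →
          (D.coeff - R = p ↔ D.coeff = p + R) := fun z w R hR => tsub_eq_iff_eq_add_of_le hR
      by_cases he : D.x * Equiv.swap i j = D.y
      · have he' : D.y * Equiv.swap i j = D.x := by rw [← he, mul_assoc]; simp
        unfold firstTerm lastTerm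
        simp only [he']
        split_ifs with h
        · rw [annulusCount, lin_single, lin_single]
          simp only [removeFirst, removeLast, he, he']
        · rfl
      · have he' : D.y * Equiv.swap i j ≠ D.x := fun h => he (by rw [← h, mul_assoc]; simp)
        unfold firstTerm lastTerm
        split_ifs <;> simp only [annulusCount, lin_single, map_zero, removeFirst, removeLast, he,
          Ne.symm he', false_and, if_false]
  exact LinearMap.congr_fun this z

open Classical in
theorem squareCount_firstTerm (D : PosDomain n) (c r i j : Fin n) :
    squareCount c r (firstTerm D i j) = ∑ k, ∑ l, if IsRectPair D.x i j k l then
      (if D.x * Equiv.swap i j * Equiv.swap k l = D.y ∧ pairCoeff D.x i j k l = D.coeff then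
        (rectCoeff (D.x * Equiv.swap i j) k l c r : ZMod 2) else 0) else 0 := by
  by_cases h : IsRect D.x i j ∧ rectCoeff D.x i j ≤ D.coeff
  · rw [firstTerm_pos D h, squareCount, lin_single]
    refine Finset.sum_congr rfl fun k _ => Finset.sum_congr rfl fun l _ => ?_
    rw [← ite_and]
    refine if_congr ?_ rfl rfl
    have : (fun c r => D.coeff c r - rectCoeff D.x i j c r)
        = rectCoeff (D.x * Equiv.swap i j) k l ↔ pairCoeff D.x i j k l = D.coeff := by
      rw [show (fun c r => D.coeff c r - rectCoeff D.x i j c r) = D.coeff - rectCoeff D.x i j from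
        rfl, tsub_eq_iff_eq_add_of_le h.2, eq_comm, add_comm]
      rfl
    simp only [removeFirst, this, IsRectPair, h.1, true_and, eq_comm (a := D.y)]
  · rw [firstTerm_neg D h, map_zero]
    symm
    refine Finset.sum_eq_zero fun k _ => Finset.sum_eq_zero fun l _ => ?_
    split_ifs with h1 h2
    · refine absurd ⟨h1.1, ?_⟩ h
      rw [← h2.2]
      exact fun c r => Nat.le_add_right _ _
    · rfl
    · rfl

open Classical in
theorem squareCount_lastTerm (D : PosDomain n) (c r k l : Fin n) :
    squareCount c r (lastTerm D k l) = ∑ i, ∑ j, if IsRectPair D.x i j k l then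
      (if D.x * Equiv.swap i j * Equiv.swap k l = D.y ∧ pairCoeff D.x i j k l = D.coeff then
        (rectCoeff D.x i j c r : ZMod 2) else 0) else 0 := by
  by_cases h : IsRect (D.y * Equiv.swap k l) k l ∧ rectCoeff (D.y * Equiv.swap k l) k l ≤ D.coeff
  · rw [lastTerm_pos D h, squareCount, lin_single]
    refine Finset.sum_congr rfl fun i _ => Finset.sum_congr rfl fun j _ => ?_
    rw [← ite_and]
    refine if_congr ?_ rfl rfl
    simp only [removeLast]
    rw [mul_swap_eq_iff _ D.y]
    constructor
    · rintro ⟨h1, h2, h3⟩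
      have h4 : D.coeff - rectCoeff (D.y * Equiv.swap k l) k l = rectCoeff D.x i j := h3
      rw [tsub_eq_iff_eq_add_of_le h.2] at h4
      refine ⟨⟨h1, h2 ▸ h.1⟩, h2.symm, ?_⟩
      rw [h4, h2]; rfl
    · rintro ⟨h1, h2, h3⟩
      refine ⟨h1.1, h2.symm, ?_⟩
      rw [← h3, ← h2]
      funext c r
      simp [pairCoeff]
  · rw [lastTerm_neg D h, map_zero]
    symm
    refine Finset.sum_eq_zero fun i _ => Finset.sum_eq_zero fun j _ => ?_
    split_ifs with h1 h2
    · have h3 := (mul_swap_eq_iff _ D.y k l).1 h2.1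
      refine absurd ⟨h3 ▸ h1.2, ?_⟩ h
      rw [← h2.2, ← h3]
      exact fun c r => Nat.le_add_left _ _
    · rfl
    · rfl

/-- The total multiplicity of a square in the boundary of a domain of index two is even, except
for the two annuli through the square. -/
theorem squareCount_domOp (hn : 2 ≤ n) (c r : Fin n) (z : DChain n) :
    squareCount c r (domOp z) = annulusCount (colCoeff c) z + annulusCount (rowCoeff r) z := by
  classical
  have : (squareCount c r ∘ₗ domOp : DChain n →ₗ[ZMod 2] ZMod 2)
      = annulusCount (colCoeff c) + annulusCount (rowCoeff r) := linearMap_ext_single fun D => by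
    rw [LinearMap.comp_apply, domOp, LinearMap.add_apply, firstOp_single, lastOp_single, map_add]
    simp only [map_sum]
    have h1 : ∑ k, ∑ l, squareCount c r (lastTerm D k l) = ∑ i, ∑ j, ∑ k, ∑ l,
        if IsRectPair D.x i j k l then
        (if D.x * Equiv.swap i j * Equiv.swap k l = D.y ∧ pairCoeff D.x i j k l = D.coeff then
          (rectCoeff D.x i j c r : ZMod 2) else 0) else 0 := by
      simp only [squareCount_lastTerm]
      exact sum_comm_pairs _
    rw [h1]
    simp only [squareCount_firstTerm, ← Finset.sum_add_distrib]
    have h2 := sum_rectPair hn (M := ZMod 2) (add_self_zmod_two) D.x fun z T =>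
      if z = D.y ∧ T = D.coeff then (T c r : ZMod 2) else 0
    refine Eq.trans ?_ (h2.trans ?_)
    · refine Finset.sum_congr rfl fun i _ => Finset.sum_congr rfl fun j _ =>
        Finset.sum_congr rfl fun k _ => Finset.sum_congr rfl fun l _ => ?_
      split_ifs
      · simp only [pairCoeff]; push_cast; ring
      · simp
      · simp
    · rw [LinearMap.add_apply, annulusCount, annulusCount, lin_single, lin_single]
      congr 1
      · rw [Finset.sum_eq_single c]
        · simp [colCoeff, eq_comm]
        · intro c' _ hc
          simp [colCoeff, Ne.symm hc]
        · simp
      · rw [Finset.sum_eq_single r]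
        · simp [rowCoeff, eq_comm]
        · intro c' _ hc
          simp [rowCoeff, Ne.symm hc]
        · simp
  exact LinearMap.congr_fun this z

/-! ### The Maslov index -/

/-- The sum of the multiplicities around all points of the generator `z`. -/
def pointSum (z : Generator n) (a : Fin n → Fin n → ℕ) : ℕ := ∑ c, cornerSum a c (z c)

theorem maslov_eq (D : PosDomain n) :
    D.maslov = ((pointSum D.x D.coeff + pointSum D.y D.coeff : ℕ) : ℚ) / 4 := by
  rw [PosDomain.maslov, Finset.sum_add_distrib]; rfl

theorem maslov_nonneg (D : PosDomain n) : 0 ≤ D.maslov := by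
  rw [maslov_eq]; positivity

theorem pointSum_add (z : Generator n) (a b : Fin n → Fin n → ℕ) :
    pointSum z (a + b) = pointSum z a + pointSum z b := by
  simp only [pointSum, ← Finset.sum_add_distrib]
  refine Finset.sum_congr rfl fun c _ => ?_
  simp only [cornerSum, Pi.add_apply]; ring

/-- The mixed difference of multiplicities at a point of the grid. -/
def mixedDiff (a : Fin n → Fin n → ℕ) (c r : Fin n) : ℤ :=
  a c r + a (c - 1) (r - 1) - a (c - 1) r - a c (r - 1)

theorem BdryCond.mixedDiff_eq {x y : Generator n} {a : Fin n → Fin n → ℕ} (h : BdryCond x y a)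
    (c r : Fin n) : mixedDiff a c r = (if x c = r then 1 else 0) - (if y c = r then 1 else 0) := by
  have := h c r
  unfold mixedDiff
  split_ifs at this ⊢ <;> omega

/-- The mixed difference is symmetric with respect to the pairing by four-corner sums. -/
theorem sum_mixedDiff_mul_cornerSum (a b : Fin n → Fin n → ℕ) :
    ∑ c, ∑ r, mixedDiff a c r * (cornerSum b c r : ℤ)
      = ∑ c, ∑ r, mixedDiff b c r * (cornerSum a c r : ℤ) := by
  let P : Fin n → Fin n → ℤ := fun c r => a c r * b (c - 1) r - a (c - 1) r * b c r
  let Q : Fin n → Fin n → ℤ := fun c r => a c r * b c (r - 1) - a c (r - 1) * b c r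
  have h : ∀ c r, mixedDiff a c r * (cornerSum b c r : ℤ) - mixedDiff b c r * (cornerSum a c r : ℤ)
      = 2 * (P c r - P c (r - 1)) + 2 * (Q c r - Q (c - 1) r) := by
    intro c r
    simp only [mixedDiff, cornerSum, P, Q]
    push_cast
    ring
  rw [← sub_eq_zero, ← Finset.sum_sub_distrib]
  simp only [← Finset.sum_sub_distrib, h]
  simp only [Finset.sum_add_distrib, ← Finset.mul_sum, Finset.sum_sub_distrib]
  have e1 : ∀ c, ∑ r, P c (r - 1) = ∑ r, P c r := fun c => Equiv.sum_comp (Equiv.subRight 1) (P c)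
  have e2 : ∑ c, ∑ r, Q (c - 1) r = ∑ c, ∑ r, Q c r :=
    Equiv.sum_comp (Equiv.subRight 1) fun c => ∑ r, Q c r
  simp only [e1, e2, sub_self, mul_zero, add_zero]

theorem pointSum_sub {x y : Generator n} {a : Fin n → Fin n → ℕ} (h : BdryCond x y a)
    (b : Fin n → Fin n → ℕ) : (pointSum x b : ℤ) - pointSum y b
      = ∑ c, ∑ r, mixedDiff a c r * (cornerSum b c r : ℤ) := by
  have : ∀ z : Generator n, (pointSum z b : ℤ)
      = ∑ c, ∑ r, (if z c = r then 1 else 0) * (cornerSum b c r : ℤ) := fun z => by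
    simp [pointSum]
  rw [this, this]
  simp only [h.mixedDiff_eq, sub_mul, Finset.sum_sub_distrib]

/-- Lipshitz's expression for the index is additive under juxtaposition. -/
theorem pointSum_juxtapose {x z y : Generator n} {a b : Fin n → Fin n → ℕ} (ha : BdryCond x z a)
    (hb : BdryCond z y b) : pointSum x (a + b) + pointSum y (a + b)
      = (pointSum x a + pointSum z a) + (pointSum z b + pointSum y b) := by
  have h1 := pointSum_sub ha b
  have h2 := pointSum_sub hb a
  rw [sum_mixedDiff_mul_cornerSum] at h1
  rw [pointSum_add, pointSum_add]
  omega

theorem cyc_pred {i j : Fin n} (h : i ≠ j) (c : Fin n) :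
    cyc i j c + cyc i j (c - 1) =
      if c = i then 1 else if c = j then 1 else 2 * cyc i j c := by
  have := cyc_step h c
  have h1 := cyc_left h
  have h2 := cyc_right i j
  by_cases hi : c = i
  · subst hi
    rw [if_pos rfl]; rw [if_neg h, if_pos rfl] at this; omega
  · by_cases hj : c = j
    · subst hj
      rw [if_neg hi, if_pos rfl]; rw [if_pos rfl, if_neg hi] at this; omega
    · rw [if_neg hi, if_neg hj]; rw [if_neg hj, if_neg hi] at this; omega

theorem cornerSum_rect (x : Generator n) {i j : Fin n} (h : i ≠ j) (c r : Fin n) :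
    cornerSum (rectCoeff x i j) c r =
      (if c = i then 1 else if c = j then 1 else 2 * cyc i j c) *
      (if r = x i then 1 else if r = x j then 1 else 2 * cyc (x i) (x j) r) := by
  rw [← cyc_pred h, ← cyc_pred (x.injective.ne h), cornerSum]
  simp only [rectCoeff]; ring

theorem sum_eq_of_pair {i j : Fin n} (h : i ≠ j) (f : Fin n → ℕ)
    (h0 : ∀ c, c ≠ i → c ≠ j → f c = 0) : ∑ c, f c = f i + f j := by
  rw [← Finset.sum_pair h]
  symm
  refine Finset.sum_subset (Finset.subset_univ _) fun c _ hc => ?_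
  simp only [Finset.mem_insert, Finset.mem_singleton, not_or] at hc
  exact h0 c hc.1 hc.2

theorem IsRect.pointSum_eq {x : Generator n} {i j : Fin n} (h : IsRect x i j) :
    pointSum x (rectCoeff x i j) + pointSum (x * Equiv.swap i j) (rectCoeff x i j) = 4 := by
  have hij := h.1
  have xij := x.injective.ne hij
  have h0 : ∀ c, c ≠ i → c ≠ j → cornerSum (rectCoeff x i j) c (x c) = 0 := by
    intro c hi hj
    have := h.2 c hi hj
    rw [cornerSum_rect x hij, if_neg hi, if_neg hj, if_neg (x.injective.ne hi),
      if_neg (x.injective.ne hj)]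
    rw [rectCoeff] at this
    calc _ = 4 * (cyc i j c * cyc (x i) (x j) (x c)) := by ring
      _ = 0 := by rw [this]
  rw [pointSum, pointSum, sum_eq_of_pair hij _ h0, sum_eq_of_pair hij]
  · simp only [cornerSum_rect x hij, swap_val]
    simp [hij, hij.symm]
  · intro c hi hj
    rw [swap_val, if_neg hi, if_neg hj]
    exact h0 c hi hj

theorem maslov_of_first {D E : PosDomain n} {i j : Fin n} (h : IsRect D.x i j)
    (hx : E.x = D.x * Equiv.swap i j) (hy : E.y = D.y)
    (hc : D.coeff = rectCoeff D.x i j + E.coeff) : D.maslov = E.maslov + 1 := by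
  have h1 := pointSum_juxtapose (x := D.x) (z := E.x) (y := D.y) (a := rectCoeff D.x i j)
    (b := E.coeff) (by rw [hx]; exact rect_bdry h.1) (by rw [← hy]; exact E.bdry)
  have h2 := h.pointSum_eq
  rw [← hx] at h2
  rw [maslov_eq, maslov_eq, hc, h1, h2, hy]
  push_cast; ring

theorem maslov_of_last {D E : PosDomain n} {i j : Fin n} (h : IsRect E.y i j)
    (hx : E.x = D.x) (hy : D.y = E.y * Equiv.swap i j)
    (hc : D.coeff = rectCoeff E.y i j + E.coeff) : D.maslov = E.maslov + 1 := by
  have h1 := pointSum_juxtapose (x := D.x) (z := E.y) (y := D.y) (b := rectCoeff E.y i j)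
    (a := E.coeff) (by rw [← hx]; exact E.bdry) (by rw [hy]; exact rect_bdry h.1)
  have h2 := h.pointSum_eq
  rw [← hy] at h2
  rw [maslov_eq, maslov_eq, hc, add_comm (rectCoeff E.y i j), h1, h2, hx]
  push_cast; ring

theorem sum_indicator_shift (z : Generator n) (r₀ : Fin n) :
    ∑ c, ((if z c = r₀ then 1 else 0) + (if z c - 1 = r₀ then 1 else 0)) = 2 := by
  rw [Finset.sum_add_distrib, Equiv.sum_comp z fun r => if r = r₀ then 1 else 0,
    Equiv.sum_comp z fun r => if r - 1 = r₀ then 1 else 0]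
  simp [sub_eq_iff_eq_add]

theorem pointSum_col (z : Generator n) (c₀ : Fin n) : pointSum z (colCoeff c₀) = 4 := by
  have : ∀ c, cornerSum (colCoeff c₀) c (z c)
      = 2 * ((if c = c₀ then 1 else 0) + (if c - 1 = c₀ then 1 else 0)) := fun c => by
    simp only [cornerSum, colCoeff]; ring
  rw [pointSum, Finset.sum_congr rfl fun c _ => this c, ← Finset.mul_sum, Finset.sum_add_distrib]
  simp [sub_eq_iff_eq_add]

theorem pointSum_row (z : Generator n) (r₀ : Fin n) : pointSum z (rowCoeff r₀) = 4 := by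
  have : ∀ c, cornerSum (rowCoeff r₀) c (z c)
      = 2 * ((if z c = r₀ then 1 else 0) + (if z c - 1 = r₀ then 1 else 0)) := fun c => by
    simp only [cornerSum, rowCoeff]; ring
  rw [pointSum, Finset.sum_congr rfl fun c _ => this c, ← Finset.mul_sum, sum_indicator_shift]
  norm_num

/-- The multiplicities `p` are those of a horizontal or vertical annulus. -/
def IsAnnulusCoeff (p : Fin n → Fin n → ℕ) : Prop := (∃ c, p = colCoeff c) ∨ ∃ r, p = rowCoeff r

theorem IsAnnulusCoeff.pointSum_eq {p : Fin n → Fin n → ℕ} (h : IsAnnulusCoeff p)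
    (z : Generator n) : pointSum z p = 4 := by
  obtain ⟨c, rfl⟩ | ⟨r, rfl⟩ := h
  exacts [pointSum_col z c, pointSum_row z r]

theorem maslov_of_annulus {D E : PosDomain n} {p : Fin n → Fin n → ℕ} (h : IsAnnulusCoeff p)
    (hx : E.x = D.x) (hy : E.y = D.y) (hc : D.coeff = p + E.coeff) :
    D.maslov = E.maslov + 2 := by
  rw [maslov_eq, maslov_eq, hc, pointSum_add, pointSum_add, h.pointSum_eq, h.pointSum_eq, hx, hy]
  push_cast; ring

theorem maslov_removeAnnulus (D : PosDomain n) {p : Fin n → Fin n → ℕ} (h : IsAnnulusCoeff p)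
    (hp : IsPeriodic p) (hle : ∀ c r, p c r ≤ D.coeff c r) :
    D.maslov = (removeAnnulus D p hp hle).maslov + 2 := by
  refine maslov_of_annulus h rfl rfl ?_
  funext c r
  have := hle c r
  simp only [removeAnnulus, Pi.add_apply]; omega

theorem maslov_constDomain (x : Generator n) : (constDomain x).maslov = 0 := by
  simp [maslov_eq, pointSum, cornerSum, constDomain]

theorem fin_induction_add_one {P : Fin n → Prop} (a : Fin n) (ha : P a)
    (hs : ∀ c, P c → P (c + 1)) (c : Fin n) : P c := by
  have h : ∀ k : ℕ, P (a + (Fin.ofNat n k)) := by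
    intro k
    induction k with
    | zero => simpa using ha
    | succ k ih =>
      have := hs _ ih
      have e : Fin.ofNat n (k + 1) = Fin.ofNat n k + 1 := by
        ext
        simp [Fin.ofNat, Fin.val_add, Nat.add_mod]
      rw [e, ← add_assoc]; exact this
  have := h (c - a).val
  have e : Fin.ofNat n (c - a).val = c - a := by ext; simp [Fin.ofNat, Nat.mod_eq_of_lt]
  rw [e, add_sub_cancel] at this
  exact this

theorem fin_induction_sub_one {P : Fin n → Prop} (a : Fin n) (ha : P a)
    (hs : ∀ c, P (c - 1) → P c) (c : Fin n) : P c :=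
  fin_induction_add_one a ha (fun c h => hs (c + 1) (by simpa using h)) c

/-- A domain of index zero is constant. -/
theorem eq_constDomain_of_maslov {D : PosDomain n} (h : D.maslov = 0) : D = constDomain D.x := by
  have h0 : pointSum D.x D.coeff = 0 := by
    rw [maslov_eq] at h
    have h1 : ((pointSum D.x D.coeff + pointSum D.y D.coeff : ℕ) : ℚ) = 0 := by
      rcases div_eq_zero_iff.1 h with h | h
      · exact h
      · norm_num at h
    have h2 : pointSum D.x D.coeff + pointSum D.y D.coeff = 0 := by exact_mod_cast h1
    omega
  have h1 : ∀ c, cornerSum D.coeff c (D.x c) = 0 := fun c =>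
    (Finset.sum_eq_zero_iff.1 h0) c (Finset.mem_univ c)
  have h2 : ∀ c r, D.coeff c r = D.coeff (c - 1) r := by
    intro c
    have hc := h1 c
    simp only [cornerSum] at hc
    have hb := D.bdry c (D.x c)
    have hy : D.y c = D.x c := by
      by_contra hne
      rw [if_pos rfl, if_neg hne] at hb
      omega
    refine fin_induction_sub_one (D.x c) (by omega) fun r hr => ?_
    have := D.bdry c r
    rw [hy] at this
    omega
  have h3 : ∀ c r, D.coeff c r = 0 := by
    intro c r
    obtain ⟨d, rfl⟩ := D.x.surjective r
    have hd : D.coeff d (D.x d) = 0 := by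
      have := h1 d
      simp only [cornerSum] at this
      omega
    exact fin_induction_sub_one (P := fun c => D.coeff c (D.x d) = 0) d hd
      (fun c hc => by rw [h2]; exact hc) c
  have hy : D.y = D.x := by
    ext c
    have := D.bdry c (D.x c)
    simp only [h3, if_true] at this
    by_cases hne : D.y c = D.x c
    · rw [hne]
    · rw [if_neg hne] at this; omega
  ext1
  · rfl
  · exact hy
  · funext c r; exact h3 c r

/-! ### Removing annuli -/

open Classical in
/-- Remove the annulus with multiplicities `p`; zero if the domain does not contain it. -/
def annulusOp (p : Fin n → Fin n → ℕ) (hp : IsPeriodic p) : DChain n →ₗ[ZMod 2] DChain n :=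
  lin fun D => if h : ∀ c r, p c r ≤ D.coeff c r then
    Finsupp.single (removeAnnulus D p hp h) 1 else 0

theorem annulusOp_pos {p : Fin n → Fin n → ℕ} (hp : IsPeriodic p) (D : PosDomain n)
    (h : p ≤ D.coeff) :
    annulusOp p hp (Finsupp.single D 1) = Finsupp.single (removeAnnulus D p hp h) 1 := by
  rw [annulusOp, lin_single]; exact dif_pos h

theorem annulusOp_neg {p : Fin n → Fin n → ℕ} (hp : IsPeriodic p) (D : PosDomain n)
    (h : ¬ p ≤ D.coeff) : annulusOp p hp (Finsupp.single D 1) = 0 := by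
  rw [annulusOp, lin_single]; exact dif_neg h

open Classical in
theorem annulusOp_eq {p : Fin n → Fin n → ℕ} (hp : IsPeriodic p) (D : PosDomain n) :
    annulusOp p hp (Finsupp.single D 1) =
      if p ≤ D.coeff then mkDom D.x D.y (D.coeff - p) else 0 := by
  by_cases h : p ≤ D.coeff
  · rw [annulusOp_pos hp D h, if_pos h, ← mkDom_self]; rfl
  · rw [annulusOp_neg hp D h, if_neg h]

theorem le_tsub_iff_add_le {p q a : Fin n → Fin n → ℕ} (h : q ≤ a) : p ≤ a - q ↔ p + q ≤ a := by
  constructor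
  · intro h1 c r
    have h2 : p c r ≤ a c r - q c r := h1 c r
    have h3 : q c r ≤ a c r := h c r
    simp only [Pi.add_apply]; omega
  · intro h1 c r
    have h2 : p c r + q c r ≤ a c r := h1 c r
    simp only [Pi.sub_apply]; omega

theorem le_of_add_le_left {p q a : Fin n → Fin n → ℕ} (h : p + q ≤ a) : p ≤ a := fun c r =>
  (Nat.le_add_right _ _).trans (h c r)

theorem le_of_add_le_right {p q a : Fin n → Fin n → ℕ} (h : p + q ≤ a) : q ≤ a := fun c r =>
  (Nat.le_add_left _ _).trans (h c r)

theorem annulusOp_annulusOp {p q : Fin n → Fin n → ℕ} (hp : IsPeriodic p) (hq : IsPeriodic q)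
    (D : PosDomain n) : annulusOp p hp (annulusOp q hq (Finsupp.single D 1))
      = annulusOp q hq (annulusOp p hp (Finsupp.single D 1)) := by
  classical
  have key : ∀ {p q : Fin n → Fin n → ℕ} (hp : IsPeriodic p) (hq : IsPeriodic q),
      annulusOp p hp (annulusOp q hq (Finsupp.single D 1))
        = if p + q ≤ D.coeff then mkDom D.x D.y (D.coeff - (p + q)) else 0 := by
    intro p q hp hq
    by_cases h : q ≤ D.coeff
    · rw [annulusOp_pos hq D h, annulusOp_eq]
      refine if_congr (le_tsub_iff_add_le h) ?_ rfl
      congr 1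
      funext c r
      simp only [removeAnnulus, Pi.sub_apply, Pi.add_apply]; omega
    · rw [annulusOp_neg hq D h, map_zero, if_neg fun h1 => h (le_of_add_le_right h1)]
  rw [key, key, add_comm]

theorem annulusOp_firstTerm {p : Fin n → Fin n → ℕ} (hp : IsPeriodic p) (D : PosDomain n)
    (i j : Fin n) : annulusOp p hp (firstTerm D i j)
      = lin (fun E => firstTerm E i j) (annulusOp p hp (Finsupp.single D 1)) := by
  classical
  have key : annulusOp p hp (firstTerm D i j) =
      if IsRect D.x i j ∧ p + rectCoeff D.x i j ≤ D.coeff then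
        mkDom (D.x * Equiv.swap i j) D.y (D.coeff - (p + rectCoeff D.x i j)) else 0 := by
    by_cases h : IsRect D.x i j ∧ rectCoeff D.x i j ≤ D.coeff
    · rw [firstTerm_pos D h, annulusOp_eq]
      refine if_congr ((le_tsub_iff_add_le h.2).trans ⟨fun h1 => ⟨h.1, h1⟩, fun h1 => h1.2⟩) ?_ rfl
      congr 1
      funext c r
      simp only [removeFirst, Pi.sub_apply, Pi.add_apply]; omega
    · rw [firstTerm_neg D h, map_zero, if_neg fun h1 => h ⟨h1.1, le_of_add_le_right h1.2⟩]
  rw [key]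
  by_cases h : p ≤ D.coeff
  · rw [annulusOp_pos hp D h, lin_single, firstTerm_eq]
    refine if_congr (and_congr Iff.rfl ?_) ?_ rfl
    · rw [add_comm]; exact (le_tsub_iff_add_le h).symm
    · congr 1
      funext c r
      simp only [removeAnnulus, Pi.sub_apply, Pi.add_apply]; omega
  · rw [annulusOp_neg hp D h, map_zero, if_neg fun h1 => h (le_of_add_le_left h1.2)]

theorem annulusOp_lastTerm {p : Fin n → Fin n → ℕ} (hp : IsPeriodic p) (D : PosDomain n)
    (i j : Fin n) : annulusOp p hp (lastTerm D i j)
      = lin (fun E => lastTerm E i j) (annulusOp p hp (Finsupp.single D 1)) := by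
  classical
  have key : annulusOp p hp (lastTerm D i j) =
      if IsRect (D.y * Equiv.swap i j) i j ∧
          p + rectCoeff (D.y * Equiv.swap i j) i j ≤ D.coeff then
        mkDom D.x (D.y * Equiv.swap i j)
          (D.coeff - (p + rectCoeff (D.y * Equiv.swap i j) i j)) else 0 := by
    by_cases h : IsRect (D.y * Equiv.swap i j) i j ∧
        rectCoeff (D.y * Equiv.swap i j) i j ≤ D.coeff
    · rw [lastTerm_pos D h, annulusOp_eq]
      refine if_congr ((le_tsub_iff_add_le h.2).trans ⟨fun h1 => ⟨h.1, h1⟩, fun h1 => h1.2⟩) ?_ rfl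
      congr 1
      funext c r
      simp only [removeLast, Pi.sub_apply, Pi.add_apply]; omega
    · rw [lastTerm_neg D h, map_zero, if_neg fun h1 => h ⟨h1.1, le_of_add_le_right h1.2⟩]
  rw [key]
  by_cases h : p ≤ D.coeff
  · rw [annulusOp_pos hp D h, lin_single, lastTerm_eq]
    refine if_congr (and_congr Iff.rfl ?_) ?_ rfl
    · rw [add_comm]; exact (le_tsub_iff_add_le h).symm
    · congr 1
      funext c r
      simp only [removeAnnulus, Pi.sub_apply, Pi.add_apply]; omega
  · rw [annulusOp_neg hp D h, map_zero, if_neg fun h1 => h (le_of_add_le_left h1.2)]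

theorem annulusOp_comm_domOp {p : Fin n → Fin n → ℕ} (hp : IsPeriodic p) :
    (annulusOp p hp ∘ₗ domOp : DChain n →ₗ[ZMod 2] DChain n) = domOp ∘ₗ annulusOp p hp :=
  linearMap_ext_single fun D => by
    simp only [LinearMap.comp_apply, domOp, LinearMap.add_apply, map_add, firstOp_single,
      lastOp_single, map_sum, annulusOp_firstTerm, annulusOp_lastTerm]
    simp only [firstOp, lastOp, lin_sum_fun]

/-! ### Domains with partitions as a tensor product -/

/-- Equip the domains of a chain with the partitions `μ`. -/
def tag (μ : Fin n → List ℕ+) : DChain n →ₗ[ZMod 2] Chain n := lin fun D => gen ⟨D, μ⟩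

/-- Replace the `j`-th partition of a triple by formal sums of partitions. -/
def setOp (t : Triple n) (j : Fin n) : ListChain →ₗ[ZMod 2] Chain n :=
  lin fun l => gen (t.setPart j l)

/-- An operator on domains, acting on triples. -/
def domLift (φ : DChain n →ₗ[ZMod 2] DChain n) : Module.End (ZMod 2) (Chain n) :=
  lin fun t => tag t.part (φ (Finsupp.single t.dom 1))

/-- An operator on partitions, acting on the `j`-th partition of triples. -/
def partLift (j : Fin n) (ψ : ListChain →ₗ[ZMod 2] ListChain) : Module.End (ZMod 2) (Chain n) :=
  lin fun t => setOp t j (ψ (Finsupp.single (t.part j) 1))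

theorem tag_single (μ : Fin n → List ℕ+) (D : PosDomain n) :
    tag μ (Finsupp.single D 1) = gen ⟨D, μ⟩ := lin_single _ _

theorem setOp_single (t : Triple n) (j : Fin n) (l : List ℕ+) :
    setOp t j (Finsupp.single l 1) = gen (t.setPart j l) := lin_single _ _

theorem domLift_gen (φ : DChain n →ₗ[ZMod 2] DChain n) (t : Triple n) :
    domLift φ (gen t) = tag t.part (φ (Finsupp.single t.dom 1)) := lin_single _ _

theorem partLift_gen (j : Fin n) (ψ : ListChain →ₗ[ZMod 2] ListChain) (t : Triple n) :
    partLift j ψ (gen t) = setOp t j (ψ (Finsupp.single (t.part j) 1)) := lin_single _ _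

theorem domLift_tag (φ : DChain n →ₗ[ZMod 2] DChain n) (μ : Fin n → List ℕ+) (z : DChain n) :
    domLift φ (tag μ z) = tag μ (φ z) := by
  have : domLift φ ∘ₗ tag μ = tag μ ∘ₗ φ := linearMap_ext_single fun D => by
    rw [LinearMap.comp_apply, tag_single, domLift_gen]; rfl
  exact LinearMap.congr_fun this z

theorem setPart_setPart (t : Triple n) (j : Fin n) (l m : List ℕ+) :
    (t.setPart j l).setPart j m = t.setPart j m := by
  simp [Triple.setPart]

theorem setPart_part (t : Triple n) (j : Fin n) (l : List ℕ+) : (t.setPart j l).part j = l := by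
  simp [Triple.setPart]

theorem partLift_setOp (j : Fin n) (ψ : ListChain →ₗ[ZMod 2] ListChain) (t : Triple n)
    (m : ListChain) : partLift j ψ (setOp t j m) = setOp t j (ψ m) := by
  have : partLift j ψ ∘ₗ setOp t j = setOp t j ∘ₗ ψ := linearMap_ext_single fun l => by
    rw [LinearMap.comp_apply, setOp_single, partLift_gen, setPart_part, LinearMap.comp_apply]
    have : setOp (t.setPart j l) j = setOp t j := linearMap_ext_single fun m => by
      rw [setOp_single, setOp_single, setPart_setPart]
    rw [this]
  exact LinearMap.congr_fun this m

theorem domLift_mul (φ φ' : DChain n →ₗ[ZMod 2] DChain n) :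
    domLift φ * domLift φ' = domLift (φ ∘ₗ φ') := linearMap_ext_single fun t => by
  rw [Module.End.mul_apply]
  change domLift φ (domLift φ' (gen t)) = domLift (φ ∘ₗ φ') (gen t)
  rw [domLift_gen, domLift_tag, domLift_gen]; rfl

theorem partLift_mul (j : Fin n) (ψ ψ' : ListChain →ₗ[ZMod 2] ListChain) :
    partLift j ψ * partLift j ψ' = partLift (n := n) j (ψ ∘ₗ ψ') := linearMap_ext_single fun t => by
  rw [Module.End.mul_apply]
  change partLift j ψ (partLift j ψ' (gen t)) = partLift j (ψ ∘ₗ ψ') (gen t)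
  rw [partLift_gen, partLift_setOp, partLift_gen]; rfl

theorem lin_comm {X Y M : Type*} [AddCommGroup M] [Module (ZMod 2) M] (f : X → Y → M)
    (z : X →₀ ZMod 2) (w : Y →₀ ZMod 2) :
    lin (fun x => lin (f x) w) z = lin (fun y => lin (fun x => f x y) z) w := by
  simp only [lin, Finsupp.linearCombination_apply, Finsupp.sum, Finset.smul_sum]
  rw [Finset.sum_comm]
  exact Finset.sum_congr rfl fun _ _ => Finset.sum_congr rfl fun _ _ => smul_comm _ _ _

theorem lin_apply_lin {X M N : Type*} [AddCommGroup M] [Module (ZMod 2) M] [AddCommGroup N]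
    [Module (ZMod 2) N] (g : M →ₗ[ZMod 2] N) (f : X → M) (z : X →₀ ZMod 2) :
    g (lin f z) = lin (fun x => g (f x)) z := by
  simp [lin, Finsupp.linearCombination_apply, Finsupp.sum]

theorem lin_congr {X M : Type*} [AddCommGroup M] [Module (ZMod 2) M] {f g : X → M}
    (h : ∀ x, f x = g x) (z : X →₀ ZMod 2) : lin f z = lin g z := by
  rw [funext h]

theorem domLift_partLift_commute (φ : DChain n →ₗ[ZMod 2] DChain n) (j : Fin n)
    (ψ : ListChain →ₗ[ZMod 2] ListChain) : Commute (domLift φ) (partLift j ψ) :=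
  linearMap_ext_single fun t => by
    rw [Module.End.mul_apply, Module.End.mul_apply]
    change domLift φ (partLift j ψ (gen t)) = partLift j ψ (domLift φ (gen t))
    rw [partLift_gen, domLift_gen, setOp, tag, lin_apply_lin, lin_apply_lin]
    have e1 : ∀ l, domLift φ (gen (t.setPart j l)) = lin (fun E : PosDomain n =>
        gen (Triple.setPart ⟨E, t.part⟩ j l)) (φ (Finsupp.single t.dom 1)) := fun l =>
      domLift_gen φ _
    have e2 : ∀ E : PosDomain n, partLift j ψ (gen ⟨E, t.part⟩) = lin (fun l =>
        gen (Triple.setPart ⟨E, t.part⟩ j l)) (ψ (Finsupp.single (t.part j) 1)) := fun E =>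
      partLift_gen j ψ _
    rw [lin_congr e1, lin_congr e2]
    exact (lin_comm (fun (E : PosDomain n) l => gen (Triple.setPart ⟨E, t.part⟩ j l)) _ _).symm

theorem partLift_partLift_commute {j k : Fin n} (hjk : j ≠ k)
    (ψ ψ' : ListChain →ₗ[ZMod 2] ListChain) :
    Commute (partLift (n := n) j ψ) (partLift k ψ') :=
  linearMap_ext_single fun t => by
    rw [Module.End.mul_apply, Module.End.mul_apply]
    change partLift j ψ (partLift k ψ' (gen t)) = partLift k ψ' (partLift j ψ (gen t))
    rw [partLift_gen, partLift_gen, setOp, setOp, lin_apply_lin, lin_apply_lin]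
    have e1 : ∀ l, (t.setPart k l).part j = t.part j := fun l => by simp [Triple.setPart, hjk]
    have e2 : ∀ l, (t.setPart j l).part k = t.part k := fun l => by
      simp [Triple.setPart, hjk.symm]
    simp only [partLift_gen, e1, e2, setOp]
    refine (lin_comm (fun l m => gen ((t.setPart k l).setPart j m)) _ _).trans ?_
    refine lin_congr (fun l => lin_congr (fun m => ?_) _) _
    rw [Triple.setPart, Triple.setPart, Triple.setPart, Triple.setPart,
      Function.update_comm hjk]

/-- The removal of the two annuli through `O_j`. -/
def GridDiagram.bubbleOp (G : GridDiagram n) (j : Fin n) : DChain n →ₗ[ZMod 2] DChain n :=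
  annulusOp (G.hCoeff j) (G.hCoeff_periodic j) + annulusOp (G.vCoeff j) (G.vCoeff_periodic j)

theorem bdry1_eq (t : Triple n) : bdry1 t = tag t.part (domOp (Finsupp.single t.dom 1)) := by
  classical
  rw [domOp, LinearMap.add_apply, firstOp_single, lastOp_single, map_add, bdry1]
  simp only [map_sum]
  congr 1
  · refine Finset.sum_congr rfl fun i _ => Finset.sum_congr rfl fun j _ => ?_
    unfold firstTerm
    split_ifs
    · rw [tag_single]
    · rw [map_zero]
  · refine Finset.sum_congr rfl fun i _ => Finset.sum_congr rfl fun j _ => ?_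
    unfold lastTerm
    split_ifs
    · rw [tag_single]
    · rw [map_zero]

theorem bubbleTerms_eq (t : Triple n) (j : Fin n) (p : Fin n → Fin n → ℕ) (hp : IsPeriodic p) :
    bubbleTerms t j p hp = partLift j enlargeOp (domLift (annulusOp p hp) (gen t)) := by
  rw [domLift_gen, bubbleTerms]
  by_cases h : ∀ c r, p c r ≤ t.dom.coeff c r
  · rw [dif_pos h, annulusOp_pos hp _ h, tag_single, partLift_gen, enlargeOp, lin_single,
      setOp, lin_sumSingle]
  · rw [dif_neg h, annulusOp_neg hp _ h, map_zero, map_zero]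

theorem bdry34_eq (t : Triple n) : bdry3 t + bdry4 t = ∑ j, partLift j partOp (gen t) := by
  rw [bdry3, bdry4, ← Finset.sum_add_distrib, ← Finset.sum_add_distrib]
  refine Finset.sum_congr rfl fun j _ => ?_
  rw [partLift_gen, partOp, LinearMap.add_apply, initOp, tailOp, lin_single, lin_single, setOp,
    map_add, map_add, lin_sumSingle, lin_sumSingle, lin_sumSingle]
  abel

theorem GridDiagram.boundary_eq (G : GridDiagram n) :
    G.boundary = domLift domOp + ∑ j, partLift j enlargeOp * domLift (G.bubbleOp j)
      + ∑ j, partLift j partOp := linearMap_ext_single fun t => by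
  rw [GridDiagram.boundary]
  change lin _ (Finsupp.single t 1) = _
  rw [lin_single, add_assoc, bdry34_eq, LinearMap.add_apply, LinearMap.add_apply, bdry1_eq]
  change _ = domLift domOp (gen t) + _ + _
  rw [domLift_gen]
  congr 1
  · congr 1
    rw [GridDiagram.bdry2, LinearMap.sum_apply]
    refine Finset.sum_congr rfl fun j _ => ?_
    rw [bubbleTerms_eq, bubbleTerms_eq, ← map_add, Module.End.mul_apply]
    congr 1
    rw [domLift_gen, domLift_gen, ← map_add]
    change _ = domLift _ (gen t)
    rw [domLift_gen]; rfl
  · rw [LinearMap.sum_apply]; rfl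

theorem bubbleOp_commute_domOp (G : GridDiagram n) (j : Fin n) :
    (G.bubbleOp j ∘ₗ domOp : DChain n →ₗ[ZMod 2] DChain n) = domOp ∘ₗ G.bubbleOp j := by
  rw [GridDiagram.bubbleOp, LinearMap.add_comp, LinearMap.comp_add, annulusOp_comm_domOp,
    annulusOp_comm_domOp]

theorem bubbleOp_commute_bubbleOp (G : GridDiagram n) (j k : Fin n) :
    (G.bubbleOp j ∘ₗ G.bubbleOp k : DChain n →ₗ[ZMod 2] DChain n)
      = G.bubbleOp k ∘ₗ G.bubbleOp j := linearMap_ext_single fun D => by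
  simp only [GridDiagram.bubbleOp, LinearMap.comp_apply, LinearMap.add_apply, map_add]
  rw [annulusOp_annulusOp (G.hCoeff_periodic j) (G.hCoeff_periodic k),
    annulusOp_annulusOp (G.hCoeff_periodic j) (G.vCoeff_periodic k),
    annulusOp_annulusOp (G.vCoeff_periodic j) (G.hCoeff_periodic k),
    annulusOp_annulusOp (G.vCoeff_periodic j) (G.vCoeff_periodic k)]
  abel

theorem domLift_commute {φ φ' : DChain n →ₗ[ZMod 2] DChain n} (h : φ ∘ₗ φ' = φ' ∘ₗ φ) :
    Commute (domLift φ) (domLift φ') := by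
  rw [Commute, SemiconjBy, domLift_mul, domLift_mul, h]

theorem partLift_commute {j k : Fin n} {ψ ψ' : ListChain →ₗ[ZMod 2] ListChain}
    (h : ψ ∘ₗ ψ' = ψ' ∘ₗ ψ) : Commute (partLift (n := n) j ψ) (partLift k ψ') := by
  by_cases hjk : j = k
  · subst hjk
    rw [Commute, SemiconjBy, partLift_mul, partLift_mul, h]
  · exact partLift_partLift_commute hjk ψ ψ'

theorem domLift_zero : domLift (0 : DChain n →ₗ[ZMod 2] DChain n) = 0 :=
  linearMap_ext_single fun t => by
    change domLift 0 (gen t) = _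
    rw [domLift_gen]; simp

theorem partLift_zero (j : Fin n) : partLift (n := n) j 0 = 0 :=
  linearMap_ext_single fun t => by
    change partLift j 0 (gen t) = _
    rw [partLift_gen]; simp

/-- The differential squares to zero: it is a sum of pairwise commuting operators of square zero,
one for the domains, and two for each of the partitions. -/
theorem GridDiagram.boundary_boundary (G : GridDiagram n) (hn : 2 ≤ n) (z : Chain n) :
    G.boundary (G.boundary z) = 0 := by
  have char2 : ∀ a : Module.End (ZMod 2) (Chain n), a + a = 0 := fun a => add_self_zmod_two a
  have c1 : ∀ j, Commute (domLift domOp) (partLift (n := n) j enlargeOp * domLift (G.bubbleOp j)) :=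
    fun j => (domLift_partLift_commute _ _ _).mul_right
      (domLift_commute (bubbleOp_commute_domOp G j).symm)
  have c2 : ∀ j, Commute (domLift domOp) (partLift (n := n) j partOp) := fun j =>
    domLift_partLift_commute _ _ _
  have c3 : ∀ j k, Commute (partLift (n := n) j enlargeOp * domLift (G.bubbleOp j))
      (partLift k partOp) := fun j k =>
    (partLift_commute (LinearMap.ext fun m => (partOp_enlargeOp m).symm)).mul_left
      (domLift_partLift_commute _ _ _)
  have c4 : ∀ j k, Commute (partLift (n := n) j enlargeOp * domLift (G.bubbleOp j))
      (partLift k enlargeOp * domLift (G.bubbleOp k)) := fun j k =>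
    ((partLift_commute rfl).mul_right (domLift_partLift_commute _ _ _).symm).mul_left
      ((domLift_partLift_commute _ _ _).mul_right
        (domLift_commute (bubbleOp_commute_bubbleOp G j k)))
  have s1 : domLift (domOp (n := n)) * domLift domOp = 0 := by
    rw [domLift_mul, show domOp (n := n) ∘ₗ domOp = 0 from LinearMap.ext fun z => domOp_domOp hn z,
      domLift_zero]
  have s2 : ∀ j, (partLift (n := n) j enlargeOp * domLift (G.bubbleOp j)) *
      (partLift j enlargeOp * domLift (G.bubbleOp j)) = 0 := fun j => by
    have e : partLift (n := n) j enlargeOp * partLift j enlargeOp = 0 := by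
      rw [partLift_mul, show enlargeOp ∘ₗ enlargeOp = 0 from
        LinearMap.ext fun z => enlargeOp_enlargeOp z, partLift_zero]
    rw [mul_assoc, ← mul_assoc (domLift _), (domLift_partLift_commute (G.bubbleOp j) j enlargeOp).eq,
      mul_assoc, ← mul_assoc, e, zero_mul]
  have s3 : ∀ j, partLift (n := n) j partOp * partLift j partOp = 0 := fun j => by
    rw [partLift_mul, show partOp ∘ₗ partOp = 0 from LinearMap.ext fun z => partOp_partOp z,
      partLift_zero]
  have main : G.boundary * G.boundary = 0 := by
    rw [G.boundary_eq]
    refine add_mul_self_eq_zero (R := Module.End (ZMod 2) (Chain n)) char2 ?_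
      (add_mul_self_eq_zero (R := Module.End (ZMod 2) (Chain n)) char2 ?_ (by exact s1) ?_) ?_
    · exact Commute.sum_right _ _ _ fun j _ => (c2 j).add_left
        (Commute.sum_left _ _ _ fun k _ => c3 k j)
    · exact Commute.sum_right _ _ _ fun j _ => c1 j
    · exact sum_mul_self_eq_zero (R := Module.End (ZMod 2) (Chain n)) char2 _ _ (fun j _ k _ => c4 j k)
        fun j _ => s2 j
    · exact sum_mul_self_eq_zero (R := Module.End (ZMod 2) (Chain n)) char2 _ _ (fun j _ k _ => partLift_commute rfl)
        fun j _ => s3 j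
  exact LinearMap.congr_fun main z

/-! ### The terms of the differential -/

/-- The chains supported on a set of basis elements. -/
abbrev chainsOn {X : Type*} (S : Set X) : Submodule (ZMod 2) (X →₀ ZMod 2) :=
  Finsupp.supported (ZMod 2) (ZMod 2) S

theorem single_mem_chainsOn {X : Type*} {S : Set X} {x : X} (h : x ∈ S) :
    (Finsupp.single x 1 : X →₀ ZMod 2) ∈ chainsOn S := Finsupp.single_mem_supported _ _ h

theorem chainsOn_mono {X : Type*} {S T : Set X} (h : S ⊆ T) {z : X →₀ ZMod 2}
    (hz : z ∈ chainsOn S) : z ∈ chainsOn T := Finsupp.supported_mono h hz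

theorem lin_mem {X M : Type*} [AddCommGroup M] [Module (ZMod 2) M] {S : Set X} {f : X → M}
    {N : Submodule (ZMod 2) M} (h : ∀ x ∈ S, f x ∈ N) {z : X →₀ ZMod 2} (hz : z ∈ chainsOn S) :
    lin f z ∈ N := by
  rw [lin, Finsupp.linearCombination_apply]
  exact Submodule.sum_mem _ fun x hx => N.smul_mem _ (h x (hz hx))

theorem map_mem_of_chainsOn {X M : Type*} [AddCommGroup M] [Module (ZMod 2) M] {S : Set X}
    {N : Submodule (ZMod 2) M} (f : (X →₀ ZMod 2) →ₗ[ZMod 2] M)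
    (h : ∀ x ∈ S, f (Finsupp.single x 1) ∈ N) {z : X →₀ ZMod 2} (hz : z ∈ chainsOn S) :
    f z ∈ N := by
  have : f = lin fun x => f (Finsupp.single x 1) := linearMap_ext_single fun x => by
    rw [lin_single]
  rw [this]
  exact lin_mem h hz

/-- `E` is obtained from `D` by removing the rectangle `(i, j)` from the beginning. -/
structure IsFirst (D E : PosDomain n) (i j : Fin n) : Prop where
  rect : IsRect D.x i j
  x_eq : E.x = D.x * Equiv.swap i j
  y_eq : E.y = D.y
  coeff_eq : D.coeff = rectCoeff D.x i j + E.coeff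

/-- `E` is obtained from `D` by removing the rectangle `(i, j)` from the end. -/
structure IsLast (D E : PosDomain n) (i j : Fin n) : Prop where
  rect : IsRect E.y i j
  x_eq : E.x = D.x
  y_eq : D.y = E.y * Equiv.swap i j
  coeff_eq : D.coeff = rectCoeff E.y i j + E.coeff

theorem isFirst_iff (D E : PosDomain n) (i j : Fin n) : IsFirst D E i j ↔
    ∃ h : IsRect D.x i j ∧ rectCoeff D.x i j ≤ D.coeff, removeFirst D i j h.1.1 h.2 = E := by
  constructor
  · intro h
    have hle : rectCoeff D.x i j ≤ D.coeff := by
      rw [h.coeff_eq]; exact fun c r => Nat.le_add_right _ _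
    refine ⟨⟨h.rect, hle⟩, ?_⟩
    ext1
    · exact h.x_eq.symm
    · exact h.y_eq.symm
    · funext c r
      have := congrFun (congrFun h.coeff_eq c) r
      simp only [Pi.add_apply] at this
      simp only [removeFirst]; omega
  · rintro ⟨h, rfl⟩
    refine ⟨h.1, rfl, rfl, ?_⟩
    funext c r
    have : rectCoeff D.x i j c r ≤ D.coeff c r := h.2 c r
    simp only [removeFirst, Pi.add_apply]; omega

theorem isLast_iff (D E : PosDomain n) (i j : Fin n) : IsLast D E i j ↔
    ∃ h : IsRect (D.y * Equiv.swap i j) i j ∧ rectCoeff (D.y * Equiv.swap i j) i j ≤ D.coeff,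
      removeLast D i j h.1.1 h.2 = E := by
  constructor
  · intro h
    have hy : D.y * Equiv.swap i j = E.y := by
      rw [h.y_eq, mul_assoc, Equiv.swap_mul_self, mul_one]
    have hle : rectCoeff (D.y * Equiv.swap i j) i j ≤ D.coeff := by
      rw [h.coeff_eq, hy]; exact fun c r => Nat.le_add_right _ _
    refine ⟨⟨by rw [hy]; exact h.rect, hle⟩, ?_⟩
    ext1
    · exact h.x_eq.symm
    · exact hy
    · funext c r
      have := congrFun (congrFun h.coeff_eq c) r
      simp only [Pi.add_apply] at this
      simp only [removeLast, hy]; omega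
  · rintro ⟨h, rfl⟩
    refine ⟨h.1, rfl, by simp [removeLast, mul_assoc], ?_⟩
    funext c r
    have : rectCoeff (D.y * Equiv.swap i j) i j c r ≤ D.coeff c r := h.2 c r
    simp only [removeLast, Pi.add_apply]; omega

open Classical in
theorem firstTerm_apply (D E : PosDomain n) (i j : Fin n) :
    firstTerm D i j E = if IsFirst D E i j then 1 else 0 := by
  by_cases h : IsRect D.x i j ∧ rectCoeff D.x i j ≤ D.coeff
  · rw [firstTerm_pos D h, Finsupp.single_apply, isFirst_iff]
    by_cases e : removeFirst D i j h.1.1 h.2 = E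
    · rw [if_pos e, if_pos ⟨h, e⟩]
    · rw [if_neg e, if_neg fun e' => e e'.2]
  · rw [firstTerm_neg D h, isFirst_iff, if_neg fun h' => h h'.1]; rfl

open Classical in
theorem lastTerm_apply (D E : PosDomain n) (i j : Fin n) :
    lastTerm D i j E = if IsLast D E i j then 1 else 0 := by
  by_cases h : IsRect (D.y * Equiv.swap i j) i j ∧ rectCoeff (D.y * Equiv.swap i j) i j ≤ D.coeff
  · rw [lastTerm_pos D h, Finsupp.single_apply, isLast_iff]
    by_cases e : removeLast D i j h.1.1 h.2 = E
    · rw [if_pos e, if_pos ⟨h, e⟩]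
    · rw [if_neg e, if_neg fun e' => e e'.2]
  · rw [lastTerm_neg D h, isLast_iff, if_neg fun h' => h h'.1]; rfl

open Classical in
theorem domOp_apply (D E : PosDomain n) : domOp (Finsupp.single D 1) E =
    (∑ i, ∑ j, if IsFirst D E i j then 1 else 0) + ∑ i, ∑ j, if IsLast D E i j then 1 else 0 := by
  rw [domOp, LinearMap.add_apply, firstOp_single, lastOp_single, Finsupp.add_apply]
  simp only [Finsupp.finsetSum_apply, firstTerm_apply, lastTerm_apply]

/-- `E` is obtained from `D` by removing a rectangle from the beginning or from the end. -/
def IsFacet (D E : PosDomain n) : Prop := ∃ i j, IsFirst D E i j ∨ IsLast D E i j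

theorem isFacet_of_apply_ne_zero {D E : PosDomain n} (h : domOp (Finsupp.single D 1) E ≠ 0) :
    IsFacet D E := by
  classical
  by_contra hne
  apply h
  rw [domOp_apply]
  have h1 : ∀ i j, ¬ IsFirst D E i j := fun i j hf => hne ⟨i, j, Or.inl hf⟩
  have h2 : ∀ i j, ¬ IsLast D E i j := fun i j hf => hne ⟨i, j, Or.inr hf⟩
  simp [h1, h2]

theorem domOp_mem (D : PosDomain n) : domOp (Finsupp.single D 1) ∈ chainsOn {E | IsFacet D E} :=
  fun _ hE => isFacet_of_apply_ne_zero (Finsupp.mem_support_iff.1 hE)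

theorem IsFacet.maslov_eq {D E : PosDomain n} (h : IsFacet D E) : D.maslov = E.maslov + 1 := by
  obtain ⟨i, j, h | h⟩ := h
  · exact maslov_of_first h.rect h.x_eq h.y_eq h.coeff_eq
  · exact maslov_of_last h.rect h.x_eq h.y_eq h.coeff_eq

theorem IsFacet.coeff_le {D E : PosDomain n} (h : IsFacet D E) (c r : Fin n) :
    E.coeff c r ≤ D.coeff c r := by
  obtain ⟨i, j, h | h⟩ := h <;> rw [h.coeff_eq] <;> exact Nat.le_add_left _ _

/-- `E` is obtained from `D` by removing an annulus. -/
def IsBubble (D E : PosDomain n) : Prop :=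
  ∃ p, IsAnnulusCoeff p ∧ E.x = D.x ∧ E.y = D.y ∧ D.coeff = p + E.coeff

theorem IsBubble.maslov_eq {D E : PosDomain n} (h : IsBubble D E) : D.maslov = E.maslov + 2 := by
  obtain ⟨p, hp, hx, hy, hc⟩ := h
  exact maslov_of_annulus hp hx hy hc

theorem IsBubble.coeff_le {D E : PosDomain n} (h : IsBubble D E) (c r : Fin n) :
    E.coeff c r ≤ D.coeff c r := by
  obtain ⟨p, hp, hx, hy, hc⟩ := h
  rw [hc]; exact Nat.le_add_left _ _

theorem annulusOp_mem {p : Fin n → Fin n → ℕ} (hp : IsPeriodic p) (ha : IsAnnulusCoeff p)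
    (D : PosDomain n) : annulusOp p hp (Finsupp.single D 1) ∈ chainsOn {E | IsBubble D E} := by
  by_cases h : p ≤ D.coeff
  · rw [annulusOp_pos hp D h]
    refine single_mem_chainsOn (show IsBubble _ _ from ⟨p, ha, rfl, rfl, ?_⟩)
    funext c r
    have : p c r ≤ D.coeff c r := h c r
    simp only [removeAnnulus, Pi.add_apply]; omega
  · rw [annulusOp_neg hp D h]; exact Submodule.zero_mem _

theorem GridDiagram.hCoeff_eq (G : GridDiagram n) (j : Fin n) :
    G.hCoeff j = rowCoeff (G.Orow j) := rfl

theorem GridDiagram.vCoeff_eq (G : GridDiagram n) (j : Fin n) :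
    G.vCoeff j = colCoeff (G.Ocol j) := rfl

theorem bubbleOp_mem (G : GridDiagram n) (j : Fin n) (D : PosDomain n) :
    G.bubbleOp j (Finsupp.single D 1) ∈ chainsOn {E | IsBubble D E} :=
  Submodule.add_mem _ (annulusOp_mem _ (Or.inr ⟨_, rfl⟩) D) (annulusOp_mem _ (Or.inl ⟨_, rfl⟩) D)

/-- The number which an ordered partition partitions. -/
def weight (l : List ℕ+) : ℕ := (l.map PNat.val).sum

theorem weight_nil : weight [] = 0 := rfl

theorem weight_cons (a : ℕ+) (l : List ℕ+) : weight (a :: l) = a + weight l := by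
  simp [weight]

theorem tailOp_mem (l : List ℕ+) : tailOp (Finsupp.single l 1) ∈ chainsOn {m | m.length + 1 = l.length
    ∧ (weight m < weight l ∨ (weight m = weight l ∧ m ≠ []))} := by
  induction l with
  | nil => rw [tailOp_nil]; exact Submodule.zero_mem _
  | cons a l ih =>
    rw [tailOp_cons]
    refine Submodule.add_mem _ ?_ ?_
    · cases l with
      | nil =>
        rw [mergeOp_nil]
        refine single_mem_chainsOn ⟨rfl, Or.inl ?_⟩
        rw [weight_nil, weight_cons]
        have := a.pos
        omega
      | cons b l =>
        rw [mergeOp_cons]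
        refine single_mem_chainsOn ⟨rfl, Or.inr ⟨?_, List.cons_ne_nil _ _⟩⟩
        simp only [weight_cons, PNat.add_coe]; omega
    · refine lin_mem (fun m hm => single_mem_chainsOn ?_) ih
      have h1 := hm.1
      refine ⟨by simp [h1], ?_⟩
      rcases hm.2 with h | h
      · left; simp only [weight_cons]; omega
      · right; simp only [weight_cons]; exact ⟨by omega, List.cons_ne_nil _ _⟩

theorem partOp_mem (l : List ℕ+) : partOp (Finsupp.single l 1) ∈ chainsOn {m | m.length + 1 = l.length
    ∧ (weight m < weight l ∨ (weight m = weight l ∧ m ≠ []))} := by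
  refine Submodule.add_mem (chainsOn _) ?_ (tailOp_mem l)
  cases l with
  | nil => rw [initOp_nil]; exact Submodule.zero_mem _
  | cons a l =>
    rw [initOp_cons]
    have := a.pos
    exact single_mem_chainsOn ⟨rfl, Or.inl (by rw [weight_cons]; omega)⟩

theorem enlargeOp_mem (l : List ℕ+) : enlargeOp (Finsupp.single l 1) ∈
    chainsOn {m | m.length = l.length + 1} := by
  induction l with
  | nil => rw [enlargeOp_nil]; exact single_mem_chainsOn rfl
  | cons a l ih =>
    rw [enlargeOp_cons]
    refine Submodule.add_mem _ (single_mem_chainsOn rfl) ?_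
    exact lin_mem (fun m hm => single_mem_chainsOn (by
      have h : m.length = l.length + 1 := hm
      simp [h])) ih

/-- The total number of parts. -/
def totalLength (μ : Fin n → List ℕ+) : ℕ := ∑ j, (μ j).length

theorem hasDegree_iff (t : Triple n) (k : ℕ) :
    t.HasDegree k ↔ t.dom.maslov + (totalLength t.part : ℚ) = k := Iff.rfl

theorem totalLength_update (μ : Fin n → List ℕ+) (j : Fin n) (l : List ℕ+) :
    totalLength (Function.update μ j l) + (μ j).length = totalLength μ + l.length := by
  classical
  unfold totalLength
  rw [← Finset.add_sum_erase _ _ (Finset.mem_univ j), ← Finset.add_sum_erase _ (fun i =>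
    (μ i).length) (Finset.mem_univ j), Function.update_self]
  have : ∑ i ∈ Finset.univ.erase j, (Function.update μ j l i).length
      = ∑ i ∈ Finset.univ.erase j, (μ i).length :=
    Finset.sum_congr rfl fun i hi => by
      rw [Function.update_of_ne (Finset.ne_of_mem_erase hi)]
  rw [this]; ring

theorem boundary_gen (G : GridDiagram n) (t : Triple n) : G.boundary (gen t) =
    tag t.part (domOp (Finsupp.single t.dom 1))
      + ∑ j, partLift j enlargeOp (tag t.part (G.bubbleOp j (Finsupp.single t.dom 1)))
      + ∑ j, setOp t j (partOp (Finsupp.single (t.part j) 1)) := by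
  rw [G.boundary_eq, LinearMap.add_apply, LinearMap.add_apply, LinearMap.sum_apply,
    LinearMap.sum_apply, domLift_gen]
  simp only [Module.End.mul_apply, domLift_gen, partLift_gen]

theorem bubbleTerms_mem (G : GridDiagram n) (t : Triple n) (j : Fin n) :
    partLift j enlargeOp (tag t.part (G.bubbleOp j (Finsupp.single t.dom 1))) ∈
      chainsOn {s : Triple n | IsBubble t.dom s.dom ∧ totalLength s.part = totalLength t.part + 1} := by
  refine map_mem_of_chainsOn (S := {s : Triple n | ∃ E, IsBubble t.dom E ∧ s = ⟨E, t.part⟩}) _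
    ?_ (lin_mem (N := chainsOn _) (fun E hE => single_mem_chainsOn (by exact ⟨E, hE, rfl⟩))
      (bubbleOp_mem G j t.dom))
  rintro _ ⟨E, hE, rfl⟩
  change partLift j enlargeOp (gen _) ∈ _
  rw [partLift_gen]
  refine lin_mem (N := chainsOn _) (fun l hl => single_mem_chainsOn ?_) (enlargeOp_mem _)
  refine ⟨hE, ?_⟩
  have h2 := totalLength_update t.part j l
  have hl' : l.length = (t.part j).length + 1 := hl
  change totalLength (Function.update t.part j l) = _
  omega

/-- The differential lowers the degree by one and does not increase multiplicities. -/
theorem boundary_gen_mem (G : GridDiagram n) {t : Triple n} {k : ℕ} (ht : t.HasDegree (k + 1)) :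
    G.boundary (gen t) ∈ chainsOn {s : Triple n | s.HasDegree k ∧
      ∀ c r, s.dom.coeff c r ≤ t.dom.coeff c r} := by
  rw [hasDegree_iff] at ht
  push_cast at ht
  rw [boundary_gen]
  refine Submodule.add_mem _ (Submodule.add_mem _ ?_ ?_) ?_
  · refine lin_mem (N := chainsOn _) (fun E hE => single_mem_chainsOn ?_) (domOp_mem t.dom)
    refine ⟨?_, IsFacet.coeff_le hE⟩
    rw [hasDegree_iff]
    have := IsFacet.maslov_eq hE
    linarith
  · refine Submodule.sum_mem _ fun j _ => chainsOn_mono (fun s hs => ?_) (bubbleTerms_mem G t j)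
    refine ⟨?_, hs.1.coeff_le⟩
    rw [hasDegree_iff, hs.2]
    have h1 := hs.1.maslov_eq
    push_cast
    linarith
  · refine Submodule.sum_mem _ fun j _ => ?_
    refine lin_mem (N := chainsOn _) (fun l hl => single_mem_chainsOn ?_) (partOp_mem _)
    refine ⟨?_, fun c r => le_rfl⟩
    rw [hasDegree_iff]
    have h2 := totalLength_update t.part j l
    have hl' : l.length + 1 = (t.part j).length := hl.1
    have h3 : (totalLength (Function.update t.part j l) : ℚ) + 1 = totalLength t.part := by
      exact_mod_cast (by omega : totalLength (Function.update t.part j l) + 1 = totalLength t.part)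
    change t.dom.maslov + (totalLength (Function.update t.part j l) : ℚ) = k
    linarith

/-! ### The part of a chain without partitions -/

open Classical in
/-- The terms without partitions. -/
def emptyPart : Chain n →ₗ[ZMod 2] DChain n :=
  lin fun t => if t.part = (fun _ => []) then Finsupp.single t.dom 1 else 0

open Classical in
theorem emptyPart_tag (μ : Fin n → List ℕ+) (z : DChain n) :
    emptyPart (tag μ z) = if μ = (fun _ => []) then z else 0 := by
  by_cases h : μ = fun _ => []
  · rw [if_pos h]
    have : emptyPart ∘ₗ tag μ = LinearMap.id := linearMap_ext_single fun D => by
      rw [LinearMap.comp_apply, tag_single, emptyPart, gen, lin_single, if_pos h]; rfl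
    exact LinearMap.congr_fun this z
  · rw [if_neg h]
    have : emptyPart ∘ₗ tag μ = 0 := linearMap_ext_single fun D => by
      rw [LinearMap.comp_apply, tag_single, emptyPart, gen, lin_single, if_neg h]; rfl
    exact LinearMap.congr_fun this z

theorem emptyPart_setOp (t : Triple n) (j : Fin n) {m : ListChain} (hm : m [] = 0) :
    emptyPart (setOp t j m) = 0 := by
  have h : setOp t j m ∈ chainsOn {s : Triple n | s.part j ≠ []} := by
    refine lin_mem (S := {l | l ≠ []}) (fun l hl => single_mem_chainsOn ?_) fun l hl => ?_
    · change (t.setPart j l).part j ≠ []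
      rw [setPart_part]; exact hl
    · rintro rfl
      exact Finsupp.mem_support_iff.1 hl hm
  rw [← Submodule.mem_bot (ZMod 2), emptyPart]
  refine lin_mem (fun s hs => ?_) h
  rw [if_neg fun h1 => hs (by rw [h1]), Submodule.mem_bot]

theorem consOp_apply_nil (a : ℕ+) (m : ListChain) : consOp a m [] = 0 := by
  have h : consOp a m ∈ chainsOn {l : List ℕ+ | l ≠ []} :=
    map_mem_of_chainsOn (S := Set.univ) _
      (fun l _ => by rw [consOp_single]; exact single_mem_chainsOn (List.cons_ne_nil _ _))
      (fun _ _ => trivial)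
  by_contra hne
  exact h (Finsupp.mem_support_iff.2 hne) rfl

theorem enlargeOp_apply_nil (m : ListChain) : enlargeOp m [] = 0 := by
  have h : enlargeOp m ∈ chainsOn {l : List ℕ+ | l ≠ []} :=
    map_mem_of_chainsOn (S := Set.univ) _ (fun l _ => chainsOn_mono (fun l' (hl' : _ = _) => by
      rintro rfl; simp at hl') (enlargeOp_mem l)) (fun _ _ => trivial)
  by_contra hne
  exact h (Finsupp.mem_support_iff.2 hne) rfl

/-- The two reductions of a partition with one part cancel. -/
theorem partOp_apply_nil (l : List ℕ+) : partOp (Finsupp.single l 1) [] = 0 := by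
  rw [partOp, LinearMap.add_apply]
  match l with
  | [] => simp
  | [a] =>
    rw [initOp_cons, tailOp_cons, mergeOp_nil, tailOp_nil, map_zero, add_zero, add_self_zmod_two]
    rfl
  | a :: b :: l =>
    rw [initOp_cons, tailOp_cons, mergeOp_cons, Finsupp.add_apply, Finsupp.add_apply,
      consOp_apply_nil, Finsupp.single_apply, Finsupp.single_apply]
    simp

/-- Forgetting all terms with partitions commutes with the differentials. -/
theorem emptyPart_boundary (G : GridDiagram n) (z : Chain n) :
    emptyPart (G.boundary z) = domOp (emptyPart z) := by
  classical
  have : emptyPart ∘ₗ G.boundary = domOp ∘ₗ emptyPart := linearMap_ext_single fun t => by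
    change emptyPart (G.boundary (gen t)) = domOp (emptyPart (gen t))
    rw [G.boundary_eq, LinearMap.add_apply, LinearMap.add_apply, LinearMap.sum_apply,
      LinearMap.sum_apply, map_add, map_add, map_sum, map_sum]
    have e1 : ∀ j, emptyPart ((partLift j enlargeOp * domLift (G.bubbleOp j)) (gen t)) = 0 := by
      intro j
      rw [Module.End.mul_apply, ← Submodule.mem_bot (ZMod 2)]
      refine map_mem_of_chainsOn (S := Set.univ) (emptyPart ∘ₗ partLift j enlargeOp)
        (fun s _ => ?_) (fun _ _ => trivial)
      rw [LinearMap.comp_apply, Submodule.mem_bot]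
      change emptyPart (partLift j enlargeOp (gen s)) = 0
      rw [partLift_gen]
      exact emptyPart_setOp _ _ (enlargeOp_apply_nil _)
    have e2 : ∀ j, emptyPart (partLift j partOp (gen t)) = 0 := by
      intro j
      rw [partLift_gen]
      exact emptyPart_setOp _ _ (partOp_apply_nil _)
    rw [Finset.sum_eq_zero fun j _ => e1 j, Finset.sum_eq_zero fun j _ => e2 j, add_zero, add_zero,
      domLift_gen, emptyPart_tag, emptyPart, gen, lin_single]
    split_ifs
    · rfl
    · rw [map_zero]
  exact LinearMap.congr_fun this z

/-! ### Cutting the torus open along a row and a column -/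

/-- The position of `c` in the linear order obtained by cutting the circle open after `p`: the
first element is `p + 1` and the last one is `p`. -/
def pos (p c : Fin n) : ℕ := (c - (p + 1)).val

theorem pos_lt (p c : Fin n) : pos p c < n := (c - (p + 1)).isLt

theorem pos_injective (p : Fin n) : Function.Injective (pos p) := fun c d h => by
  by_contra hne
  exact val_sub_ne (p + 1) hne h

theorem pos_succ_self (p : Fin n) : pos p (p + 1) = 0 := by simp [pos]

theorem pos_self (p : Fin n) : pos p p = n - 1 := by
  rw [pos, sub_add_cancel_left]
  have hn : n ≠ 0 := NeZero.ne n
  obtain ⟨m, rfl⟩ : ∃ m, n = m + 1 := ⟨n - 1, by omega⟩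
  simp [Fin.coe_neg_one]

theorem pos_add_one {p c : Fin n} (h : c ≠ p) : pos p (c + 1) = pos p c + 1 := by
  have h1 : (c + 1 - (p + 1)) = (c - (p + 1)) + 1 := by abel
  have h2 : pos p c ≠ n - 1 := fun h' => h (pos_injective p (h'.trans (pos_self p).symm))
  have h3 := pos_lt p c
  rw [pos, h1]
  unfold pos at h2 h3 ⊢
  have hn : n ≠ 0 := NeZero.ne n
  obtain ⟨m, rfl⟩ : ∃ m, n = m + 1 := ⟨n - 1, by omega⟩
  rw [Fin.val_add_one]
  rw [if_neg]
  intro h4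
  rw [h4] at h2
  simp at h2

theorem pos_surjective (p : Fin n) {m : ℕ} (hm : m < n) : ∃ c, pos p c = m :=
  ⟨⟨m, hm⟩ + (p + 1), by simp [pos]⟩

theorem cyc_of_pos_lt {p i j : Fin n} (h : pos p i < pos p j) (c : Fin n) :
    cyc i j c = if pos p i ≤ pos p c ∧ pos p c < pos p j then 1 else 0 := by
  have h1 := pos_lt p j
  have h2 := pos_lt p c
  rw [cyc, val_sub_rel (p + 1) i c, val_sub_rel (p + 1) i j]
  unfold pos at *
  split_ifs <;> omega

theorem cyc_pos_self {p i j : Fin n} (hij : i ≠ j) : cyc i j p = 0 ↔ pos p i < pos p j := by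
  have h0 := (pos_injective p).ne hij
  have hp := pos_self p
  constructor
  · intro h
    by_contra hlt
    have h1 := cyc_of_pos_lt (p := p) (i := j) (j := i) (by omega) p
    have h2 := cyc_add_cyc hij p
    have h3 := pos_lt p i
    rw [if_neg (by omega)] at h1
    omega
  · intro h
    have h3 := pos_lt p j
    rw [cyc_of_pos_lt h, if_neg (by omega)]

/-- The rectangle determined by `i` and `j` does not meet column `p` and row `q`. -/
def IsPlanar (p q : Fin n) (x : Generator n) (i j : Fin n) : Prop :=
  pos p i < pos p j ∧ pos q (x i) < pos q (x j)

theorem IsPlanar.rectCoeff_col {p q : Fin n} {x : Generator n} {i j : Fin n}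
    (h : IsPlanar p q x i j) (r : Fin n) : rectCoeff x i j p r = 0 := by
  have hij : i ≠ j := fun e => by rw [IsPlanar, e] at h; omega
  rw [rectCoeff, (cyc_pos_self hij).2 h.1, zero_mul]

theorem IsPlanar.rectCoeff_row {p q : Fin n} {x : Generator n} {i j : Fin n}
    (h : IsPlanar p q x i j) (c : Fin n) : rectCoeff x i j c q = 0 := by
  have hij : i ≠ j := fun e => by rw [IsPlanar, e] at h; omega
  rw [rectCoeff, (cyc_pos_self (x.injective.ne hij)).2 h.2, mul_zero]

theorem isPlanar_of_rectCoeff {p q : Fin n} {x : Generator n} {i j : Fin n} (hij : i ≠ j)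
    (hc : ∀ r, rectCoeff x i j p r = 0) (hr : ∀ c, rectCoeff x i j c q = 0) :
    IsPlanar p q x i j := by
  have h1 := hc (x i)
  have h2 := hr i
  rw [rectCoeff, cyc_left (x.injective.ne hij), mul_one, cyc_pos_self hij] at h1
  rw [rectCoeff, cyc_left hij, one_mul, cyc_pos_self (x.injective.ne hij)] at h2
  exact ⟨h1, h2⟩

/-- The horizontal differences of the multiplicities are determined by those in row `q`. -/
theorem BdryCond.sub_eq {x y : Generator n} {a : Fin n → Fin n → ℕ} (h : BdryCond x y a)
    (q c r : Fin n) : (a c r : ℤ) - a (c - 1) r = a c q - a (c - 1) q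
      + (if pos q (x c) ≤ pos q r then 1 else 0) - (if pos q (y c) ≤ pos q r then 1 else 0) := by
  have hg : ∀ m r : Fin n, ((if pos q m ≤ pos q (r + 1) then 1 else 0 : ℤ))
      = (if pos q m ≤ pos q r then 1 else 0) + (if m = r + 1 then 1 else 0)
        - (if r = q then 1 else 0) := by
    intro m r
    have e1 : m = r + 1 ↔ pos q m = pos q (r + 1) := (pos_injective q).eq_iff.symm
    have e2 := pos_lt q m
    simp only [e1]
    by_cases hr : r = q
    · rw [hr, pos_succ_self, pos_self]
      split_ifs <;> omega
    · rw [pos_add_one hr]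
      split_ifs <;> omega
  induction r using fin_induction_add_one (a := q) with
  | ha =>
    have := pos_self q
    have := pos_lt q (x c)
    have := pos_lt q (y c)
    rw [if_pos (by omega), if_pos (by omega)]; ring
  | hs r ih =>
    have h1 := h c (r + 1)
    rw [add_sub_cancel_right] at h1
    have h2 := hg (x c) r
    have h3 := hg (y c) r
    have h4 : (a (c - 1) (r + 1) : ℤ) + a c r + (if x c = r + 1 then 1 else 0)
        = a c (r + 1) + a (c - 1) r + (if y c = r + 1 then 1 else 0) := by exact_mod_cast h1
    linarith

theorem BdryCond.transpose {x y : Generator n} {a : Fin n → Fin n → ℕ} (h : BdryCond x y a) :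
    BdryCond x⁻¹ y⁻¹ (fun r c => a c r) := by
  intro r c
  have h1 := h c r
  have e : ∀ z : Generator n, z⁻¹ r = c ↔ z c = r := fun z => by
    rw [Equiv.Perm.inv_eq_iff_eq, eq_comm]
  simp only [e]
  linarith

/-! ### The diagonal generator -/

/-- The generator which is increasing with respect to the orders that start after `p` and
after `q`. -/
def diagonal (p q : Fin n) : Generator n := (Equiv.subRight p).trans (Equiv.addRight q)

theorem diagonal_apply (p q c : Fin n) : diagonal p q c = c - p + q := rfl

theorem pos_diagonal (p q c : Fin n) : pos q (diagonal p q c) = pos p c := by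
  rw [pos, pos, diagonal_apply]
  congr 1; abel

theorem eq_diagonal_iff {p q : Fin n} {y : Generator n} :
    y = diagonal p q ↔ ∀ c, pos q (y c) = pos p c := by
  constructor
  · rintro rfl c
    exact pos_diagonal p q c
  · intro h
    ext1 c
    exact pos_injective q ((h c).trans (pos_diagonal p q c).symm)

theorem sum_pos (p : Fin n) (y : Generator n) : ∑ c, pos p (y c) = ∑ c : Fin n, c.val := by
  rw [Equiv.sum_comp y (pos p)]
  exact Equiv.sum_comp (Equiv.subRight (p + 1)) Fin.val

theorem eq_diagonal_of_le {p q : Fin n} {y : Generator n} (h : ∀ c, pos p c ≤ pos q (y c)) :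
    y = diagonal p q := by
  rw [eq_diagonal_iff]
  have h1 : ∑ c, pos p c = ∑ c, pos q (y c) := by
    rw [sum_pos, ← sum_pos p 1]; rfl
  intro c
  exact ((Finset.sum_eq_sum_iff_of_le fun c _ => h c).1 h1 c (Finset.mem_univ c)).symm

/-- The square distance of a generator from the diagonal one. -/
def potential (p q : Fin n) (y : Generator n) : ℕ :=
  ∑ c, ((pos p c : ℤ) - pos q (y c)).natAbs ^ 2

theorem potential_eq_zero {p q : Fin n} {y : Generator n} :
    potential p q y = 0 ↔ y = diagonal p q := by
  rw [eq_diagonal_iff, potential, Finset.sum_eq_zero_iff]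
  refine ⟨fun h c => ?_, fun h c _ => ?_⟩
  · have := h c (Finset.mem_univ c)
    rw [pow_eq_zero_iff two_ne_zero] at this
    omega
  · rw [h c]; simp

theorem potential_swap_lt {p q : Fin n} {y : Generator n} {i j : Fin n} (h1 : pos p i < pos p j)
    (h2 : pos q (y j) < pos q (y i)) :
    potential p q (y * Equiv.swap i j) < potential p q y := by
  have hij : i ≠ j := fun e => by rw [e] at h1; omega
  have key : ∀ z : Generator n, (potential p q z : ℤ) = ∑ c ∈ ({i, j} : Finset (Fin n))ᶜ,
      ((pos p c : ℤ) - pos q (z c)) ^ 2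
      + (((pos p i : ℤ) - pos q (z i)) ^ 2 + ((pos p j : ℤ) - pos q (z j)) ^ 2) := by
    intro z
    rw [potential, ← Finset.sum_pair hij (f := fun c => ((pos p c : ℤ) - pos q (z c)) ^ 2),
      Finset.sum_compl_add_sum]
    push_cast
    simp only [sq_abs]
  have h3 := key y
  have h4 := key (y * Equiv.swap i j)
  simp only [swap_val, if_true, if_neg hij.symm] at h4
  rw [Finset.sum_congr rfl (g := fun c => ((pos p c : ℤ) - pos q (y c)) ^ 2) (fun c hc => by
    simp only [Finset.mem_compl, Finset.mem_insert, Finset.mem_singleton, not_or] at hc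
    rw [if_neg hc.1, if_neg hc.2])] at h4
  have h5 : (0 : ℤ) < ((pos p j : ℤ) - pos p i) * ((pos q (y i) : ℤ) - pos q (y j)) :=
    mul_pos (by omega) (by omega)
  zify
  rw [h3, h4]
  nlinarith

/-- A domain that ends at the diagonal generator and does not meet row `q` and column `p` is
constant. -/
theorem eq_constDomain_of_planar {p q : Fin n} {D : PosDomain n} (hy : D.y = diagonal p q)
    (hr : ∀ c, D.coeff c q = 0) (hc : ∀ r, D.coeff p r = 0) : D = constDomain (diagonal p q) := by
  have key : ∀ m, ∀ c, pos p c = m → (∀ r, D.coeff c r = 0) ∧ D.x c = diagonal p q c := by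
    intro m
    induction m using Nat.strong_induction_on with
    | _ m ih =>
    intro c hm
    have hprev : ∀ r, D.coeff (c - 1) r = 0 := by
      by_cases h0 : c - 1 = p
      · rw [h0]; exact hc
      · have := pos_add_one h0
        rw [sub_add_cancel] at this
        exact (ih (pos p (c - 1)) (by omega) _ rfl).1
    have hd : ∀ r, (D.coeff c r : ℤ) = (if pos q (D.x c) ≤ pos q r then 1 else 0)
        - (if pos p c ≤ pos q r then 1 else 0) := by
      intro r
      have := BdryCond.sub_eq D.bdry q c r
      rw [hprev, hr, hr, hy, pos_diagonal] at this
      push_cast at this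
      linarith
    have hle : pos q (D.x c) ≤ pos p c := by
      have := hd (diagonal p q c)
      rw [pos_diagonal, if_pos le_rfl] at this
      by_contra h
      rw [if_neg h] at this
      omega
    have hx : D.x c = diagonal p q c := by
      rcases hle.lt_or_eq with hlt | heq
      · obtain ⟨d, hd'⟩ := pos_surjective p (hlt.trans (pos_lt p c))
        have h1 := (ih (pos p d) (by omega) d rfl).2
        have h2 : D.x d = D.x c := pos_injective q (by rw [h1, pos_diagonal, hd'])
        rw [D.x.injective h2] at hd'
        omega
      · exact pos_injective q (heq.trans (pos_diagonal p q c).symm)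
    refine ⟨fun r => ?_, hx⟩
    have := hd r
    rw [hx, pos_diagonal, sub_self] at this
    exact_mod_cast this
  ext1
  · ext1 c; exact (key _ c rfl).2
  · exact hy
  · funext c r; exact (key _ c rfl).1 r

/-! ### Facets determine the removed rectangle -/

theorem IsFirst.unique {D E : PosDomain n} {i j k l : Fin n} (h : IsFirst D E i j)
    (h' : IsFirst D E k l) : k = i ∧ l = j := by
  have h0 := h.x_eq.symm.trans h'.x_eq
  have h1 : Equiv.swap i j = Equiv.swap k l := mul_left_cancel h0
  have h2 : rectCoeff D.x i j = rectCoeff D.x k l :=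
    add_right_cancel (h.coeff_eq.symm.trans h'.coeff_eq)
  have hij := h.rect.1
  have h3 := DFunLike.congr_fun h1 i
  rw [Equiv.swap_apply_left] at h3
  have h4 : k = i ∨ l = i := by
    by_contra hne
    rw [not_or] at hne
    rw [Equiv.swap_apply_of_ne_of_ne (Ne.symm hne.1) (Ne.symm hne.2)] at h3
    exact hij h3.symm
  rcases h4 with rfl | rfl
  · rw [Equiv.swap_apply_left] at h3
    exact ⟨rfl, h3.symm⟩
  · -- the complementary choice would give a rectangle that does not contain column `i`
    have h5 := congrFun (congrFun h2 l) (D.x l)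
    rw [rectCoeff, rectCoeff, cyc_left hij, cyc_left (D.x.injective.ne hij), cyc_right] at h5
    simp at h5

theorem IsLast.unique {D E : PosDomain n} {i j k l : Fin n} (h : IsLast D E i j)
    (h' : IsLast D E k l) : k = i ∧ l = j :=
  IsFirst.unique (D := ⟨E.y, D.y, rectCoeff E.y i j, by rw [h.y_eq]; exact rect_bdry h.rect.1⟩)
    (E := constDomain D.y)
    ⟨h.rect, h.y_eq, rfl, rfl⟩
    ⟨h'.rect, h'.y_eq, rfl, add_right_cancel (h.coeff_eq.symm.trans h'.coeff_eq)⟩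

theorem IsFirst.not_isLast {D E : PosDomain n} {i j k l : Fin n} (h : IsFirst D E i j) :
    ¬ IsLast D E k l := fun h' => by
  have h1 := h'.x_eq.symm.trans h.x_eq
  have h2 := DFunLike.congr_fun h1 i
  rw [Equiv.Perm.mul_apply, Equiv.swap_apply_left] at h2
  exact h.rect.1 (D.x.injective h2)

open Classical in
/-- All coefficients of the differential of a domain are 0 or 1 even before reduction modulo 2. -/
theorem domOp_apply_eq (D E : PosDomain n) :
    domOp (Finsupp.single D 1) E = if IsFacet D E then 1 else 0 := by
  have hs : ∀ (P : Fin n → Fin n → Prop) (i j : Fin n), P i j → (∀ k l, P k l → k = i ∧ l = j) →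
      ∑ k, ∑ l, (if P k l then (1 : ZMod 2) else 0) = 1 := by
    intro P i j hP hu
    rw [Finset.sum_eq_single i, Finset.sum_eq_single j, if_pos hP]
    · exact fun l _ hl => if_neg fun h => hl (hu _ _ h).2
    · exact fun h => absurd (Finset.mem_univ _) h
    · exact fun k _ hk => Finset.sum_eq_zero fun l _ => if_neg fun h => hk (hu _ _ h).1
    · exact fun h => absurd (Finset.mem_univ _) h
  have hz : ∀ P : Fin n → Fin n → Prop, (∀ k l, ¬ P k l) →
      ∑ k, ∑ l, (if P k l then (1 : ZMod 2) else 0) = 0 := fun P hP =>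
    Finset.sum_eq_zero fun k _ => Finset.sum_eq_zero fun l _ => if_neg (hP k l)
  rw [domOp_apply]
  split_ifs with h
  · obtain ⟨i, j, h | h⟩ := h
    · rw [hs _ i j h fun k l h' => h.unique h', hz _ fun k l => h.not_isLast, add_zero]
    · rw [hs _ i j h fun k l h' => h.unique h', hz _ fun k l h' => h'.not_isLast h, zero_add]
  · rw [hz _ fun k l h' => h ⟨k, l, Or.inl h'⟩, hz _ fun k l h' => h ⟨k, l, Or.inr h'⟩, add_zero]

theorem apply_inv_apply (x : Generator n) (r : Fin n) : x (x⁻¹ r) = r := x.apply_symm_apply r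

/-! ### Strips and the rank of a domain -/

/-- A condition on the multiplicities `a` in row `q` and on the heights `f` of the end points of a
domain.  It ensures that the domain contains the rectangle in column `i` that starts at its initial
generator, if this rectangle avoids row `q`; see `BdryCond.one_le_of_isGood`. -/
def IsGood (a f : Fin n → ℕ) (i : Fin n) : Prop :=
  a (i - 1) < a i ∨ a (i + 1) < a i ∨ (a (i - 1) = a i ∧ a i = a (i + 1) ∧ f (i + 1) < f i)

theorem BdryCond.one_le_of_isGood {x y : Generator n} {a : Fin n → Fin n → ℕ} (h : BdryCond x y a)
    {q i r : Fin n} (hg : IsGood (fun c => a c q) (fun c => pos q (y c)) i)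
    (h1 : pos q (x i) ≤ pos q r) (h2 : pos q r < pos q (x (i + 1))) : 1 ≤ a i r := by
  have e1 := h.sub_eq q i r
  have e2 := h.sub_eq q (i + 1) r
  rw [add_sub_cancel_right, if_neg (by omega)] at e2
  rw [if_pos h1] at e1
  simp only [IsGood] at hg
  split_ifs at e1 e2 <;> omega

/-- A strip is a column (`inl`) or a row (`inr`).  It is good if it is not column `p` or row `q` and
satisfies `IsGood`, for rows with the two coordinates exchanged. -/
def GoodStrip (p q : Fin n) (a b : Fin n → ℕ) (y : Generator n) : Fin n ⊕ Fin n → Prop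
  | .inl i => i ≠ p ∧ IsGood a (fun c => pos q (y c)) i
  | .inr j => j ≠ q ∧ IsGood b (fun r => pos p (y⁻¹ r)) j

open Classical in
/-- The choice of a good strip, if there is one.  It depends only on the final generator and on the
multiplicities in row `q` and in column `p`. -/
def chooseStrip (p q : Fin n) (a b : Fin n → ℕ) (y : Generator n) : Option (Fin n ⊕ Fin n) :=
  if h : ∃ s, GoodStrip p q a b y s then some h.choose else none

/-- The strip used to match a domain, if it has a good one. -/
def strip (p q : Fin n) (D : PosDomain n) : Option (Fin n ⊕ Fin n) :=
  chooseStrip p q (fun c => D.coeff c q) (fun r => D.coeff p r) D.y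

theorem goodStrip_of_strip {p q : Fin n} {D : PosDomain n} {s : Fin n ⊕ Fin n}
    (h : strip p q D = some s) :
    GoodStrip p q (fun c => D.coeff c q) (fun r => D.coeff p r) D.y s := by
  rw [strip, chooseStrip] at h
  split_ifs at h with h'
  rw [← Option.some_injective _ h]
  exact h'.choose_spec

theorem not_goodStrip_of_strip {p q : Fin n} {D : PosDomain n} (h : strip p q D = none)
    (s : Fin n ⊕ Fin n) : ¬ GoodStrip p q (fun c => D.coeff c q) (fun r => D.coeff p r) D.y s := by
  rw [strip, chooseStrip] at h
  split_ifs at h with h'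
  exact fun hs => h' ⟨s, hs⟩

theorem strip_congr {p q : Fin n} {D E : PosDomain n} (hy : D.y = E.y)
    (hq : ∀ c, D.coeff c q = E.coeff c q) (hp : ∀ r, D.coeff p r = E.coeff p r) :
    strip p q D = strip p q E := by
  rw [strip, strip, hy, funext hq, funext hp]

/-- The square in column `c` and row `r` lies in the strip. -/
def InStrip : Fin n ⊕ Fin n → Fin n → Fin n → Prop
  | .inl i, c, _ => c = i
  | .inr j, _, r => r = j

/-- The indices `(i, j)` of the rectangle which is contained in the strip and starts at `x`. -/
def stripPair : Fin n ⊕ Fin n → Generator n → Fin n × Fin n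
  | .inl i, _ => (i, i + 1)
  | .inr j, x => (x⁻¹ j, x⁻¹ (j + 1))

/-- The generator reached from `x` by a rectangle in the strip. -/
def flip (s : Fin n ⊕ Fin n) (x : Generator n) : Generator n :=
  x * Equiv.swap (stripPair s x).1 (stripPair s x).2

theorem isRect_stripPair (hn : 2 ≤ n) (s : Fin n ⊕ Fin n) (x : Generator n) :
    IsRect x (stripPair s x).1 (stripPair s x).2 := by
  cases s with
  | inl i => exact isRect_col hn x i
  | inr j => exact isRect_row hn x (by simp [stripPair])

theorem inStrip_of_rectCoeff (hn : 2 ≤ n) {s : Fin n ⊕ Fin n} {x : Generator n} {c r : Fin n}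
    (h : rectCoeff x (stripPair s x).1 (stripPair s x).2 c r ≠ 0) : InStrip s c r := by
  cases s with
  | inl i =>
    change c = i
    by_contra hc
    exact h (by rw [rectCoeff, stripPair, cyc_succ hn, if_neg hc, zero_mul])
  | inr j =>
    change r = j
    by_contra hr
    refine h ?_
    simp only [rectCoeff, stripPair, apply_inv_apply]
    rw [cyc_succ hn, if_neg hr, mul_zero]

theorem eq_stripPair {s : Fin n ⊕ Fin n} {x : Generator n} {i j : Fin n} (hij : i ≠ j)
    (h : ∀ c r, rectCoeff x i j c r ≠ 0 → InStrip s c r) : stripPair s x = (i, j) := by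
  have hx := x.injective.ne hij
  have h0 := h i (x i) (by rw [rectCoeff, cyc_left hij, cyc_left hx]; simp)
  cases s with
  | inl k =>
    have h1 : i = k := h0
    have h2 : j = i + 1 := eq_succ_of_cyc hij fun c hc =>
      (h c (x i) (by rw [rectCoeff, hc, cyc_left hx]; simp) : c = k).trans h1.symm
    rw [h2, h1]; rfl
  | inr k =>
    have h1 : x i = k := h0
    have h2 : x j = x i + 1 := eq_succ_of_cyc hx fun r hr =>
      (h i r (by rw [rectCoeff, hr, cyc_left hij]; simp) : r = k).trans h1.symm
    rw [stripPair, ← h1, ← h2]; simp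

theorem stripPair_flip (s : Fin n ⊕ Fin n) (x : Generator n) :
    Equiv.swap (stripPair s (flip s x)).1 (stripPair s (flip s x)).2
      = Equiv.swap (stripPair s x).1 (stripPair s x).2 := by
  cases s with
  | inl i => rfl
  | inr j =>
    rw [Equiv.swap_comm]
    simp only [stripPair, flip, mul_inv_rev, Equiv.swap_inv, Equiv.Perm.mul_apply,
      Equiv.swap_apply_left, Equiv.swap_apply_right]

theorem flip_flip (s : Fin n ⊕ Fin n) (x : Generator n) : flip s (flip s x) = x := by
  rw [flip, stripPair_flip, flip, mul_assoc, Equiv.swap_mul_self, mul_one]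

/-- One of the two complementary rectangles in a good strip does not meet row `q` and
column `p`. -/
theorem isPlanar_or_flip (hn : 2 ≤ n) {p q : Fin n} {a b : Fin n → ℕ} {y : Generator n}
    {s : Fin n ⊕ Fin n} (hs : GoodStrip p q a b y s) (x : Generator n) :
    IsPlanar p q x (stripPair s x).1 (stripPair s x).2 ∨
      IsPlanar p q (flip s x) (stripPair s (flip s x)).1 (stripPair s (flip s x)).2 := by
  have hne := (isRect_stripPair hn s x).1
  have hx := (pos_injective q).ne (x.injective.ne hne)
  have hp := (pos_injective p).ne hne
  cases s with
  | inl i =>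
    have h1 := pos_add_one hs.1
    simp only [IsPlanar, stripPair, flip, Equiv.Perm.mul_apply, Equiv.swap_apply_left,
      Equiv.swap_apply_right] at hx hp ⊢
    omega
  | inr j =>
    have h1 := pos_add_one hs.1
    simp only [IsPlanar, stripPair, flip, Equiv.Perm.mul_apply, Equiv.swap_apply_left,
      Equiv.swap_apply_right, mul_inv_rev, Equiv.swap_inv, apply_inv_apply] at hx hp ⊢
    omega

/-- A domain contains the rectangle in its strip that starts at its initial generator, if this
rectangle does not meet row `q` and column `p`. -/
theorem rectCoeff_stripPair_le (hn : 2 ≤ n) {p q : Fin n} {D : PosDomain n} {s : Fin n ⊕ Fin n}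
    (hs : strip p q D = some s) (hpl : IsPlanar p q D.x (stripPair s D.x).1 (stripPair s D.x).2) :
    rectCoeff D.x (stripPair s D.x).1 (stripPair s D.x).2 ≤ D.coeff := by
  intro c r
  have hg := goodStrip_of_strip hs
  have hb : BdryCond D.x D.y D.coeff := D.bdry
  cases s with
  | inl i =>
    simp only [stripPair] at hpl ⊢
    rw [rectCoeff, cyc_of_pos_lt hpl.2, cyc_succ hn]
    split_ifs with h1 h2 <;> simp only [mul_zero, zero_mul, mul_one, zero_le]
    rw [h1]
    exact hb.one_le_of_isGood hg.2 h2.1 h2.2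
  | inr j =>
    simp only [stripPair] at hpl ⊢
    rw [rectCoeff, cyc_of_pos_lt hpl.1, apply_inv_apply, apply_inv_apply,
      cyc_succ hn]
    split_ifs with h1 h2 <;> simp only [mul_zero, zero_mul, mul_one, zero_le]
    rw [h2]
    exact hb.transpose.one_le_of_isGood hg.2 h1.1 h1.2

open Classical in
/-- The total multiplicity of a domain outside its strip, or everywhere if it has no strip. -/
def outside (p q : Fin n) (D : PosDomain n) : ℕ :=
  ∑ c, ∑ r, if ∃ s, strip p q D = some s ∧ InStrip s c r then 0 else D.coeff c r

/-- The rank of a domain, with respect to which the matching is triangular.  The first entry is the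
most significant one; its place ensures that elimination stays in the subcomplex of domains that
avoid the corner square. -/
def domRank (p q : Fin n) (D : PosDomain n) : ℕ ×ₗ ℕ ×ₗ ℕ ×ₗ ℕ :=
  toLex (D.coeff p q, toLex (∑ c, D.coeff c q + ∑ r, D.coeff p r,
    toLex (potential p q D.y, outside p q D)))

theorem domRank_lt_iff {p q : Fin n} {D E : PosDomain n} : domRank p q E < domRank p q D ↔
    E.coeff p q < D.coeff p q ∨ E.coeff p q = D.coeff p q ∧
      (∑ c, E.coeff c q + ∑ r, E.coeff p r < ∑ c, D.coeff c q + ∑ r, D.coeff p r ∨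
      ∑ c, E.coeff c q + ∑ r, E.coeff p r = ∑ c, D.coeff c q + ∑ r, D.coeff p r ∧
        (potential p q E.y < potential p q D.y ∨ potential p q E.y = potential p q D.y ∧
          outside p q E < outside p q D)) := by
  simp only [domRank, Prod.Lex.toLex_lt_toLex]

/-- Removing something that meets row `q` or column `p` lowers the rank. -/
theorem domRank_lt_of_meets {p q : Fin n} {D E : PosDomain n}
    (hle : ∀ c r, E.coeff c r ≤ D.coeff c r)
    (h : (∃ c, E.coeff c q < D.coeff c q) ∨ ∃ r, E.coeff p r < D.coeff p r) :
    domRank p q E < domRank p q D := by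
  rw [domRank_lt_iff]
  rcases (hle p q).lt_or_eq with h1 | h1
  · exact Or.inl h1
  refine Or.inr ⟨h1, Or.inl ?_⟩
  have h2 : ∑ c, E.coeff c q ≤ ∑ c, D.coeff c q := Finset.sum_le_sum fun c _ => hle c q
  have h3 : ∑ r, E.coeff p r ≤ ∑ r, D.coeff p r := Finset.sum_le_sum fun r _ => hle p r
  rcases h with ⟨c, hc⟩ | ⟨r, hr⟩
  · have := Finset.sum_lt_sum (fun c _ => hle c q) ⟨c, Finset.mem_univ c, hc⟩
    omega
  · have := Finset.sum_lt_sum (fun r _ => hle p r) ⟨r, Finset.mem_univ r, hr⟩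
    omega

theorem IsBubble.domRank_lt {p q : Fin n} {D E : PosDomain n} (h : IsBubble D E) :
    domRank p q E < domRank p q D := by
  refine domRank_lt_of_meets h.coeff_le ?_
  obtain ⟨a, ⟨c, rfl⟩ | ⟨r, rfl⟩, -, -, hD⟩ := h
  · exact Or.inl ⟨c, by rw [hD]; simp [colCoeff]⟩
  · exact Or.inr ⟨r, by rw [hD]; simp [rowCoeff]⟩

theorem domRank_of_planar {p q : Fin n} {D E : PosDomain n}
    (hy : D.y = E.y) (hq : ∀ c, D.coeff c q = E.coeff c q) (hp : ∀ r, D.coeff p r = E.coeff p r)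
    (ho : outside p q E = outside p q D) : domRank p q E = domRank p q D := by
  rw [domRank, domRank, hy, ho, hp q]
  simp only [hq, hp]

/-- Facets do not have larger rank, and the rank drops unless the facet arises by removing the
rectangle in the strip from the beginning. -/
theorem IsFacet.domRank_lt_or {p q : Fin n} {D E : PosDomain n} (h : IsFacet D E) :
    domRank p q E < domRank p q D ∨ domRank p q E = domRank p q D ∧
      ∃ s, strip p q D = some s ∧ strip p q E = some s ∧
        IsFirst D E (stripPair s D.x).1 (stripPair s D.x).2 := by
  classical
  by_cases hm : (∃ c, E.coeff c q < D.coeff c q) ∨ ∃ r, E.coeff p r < D.coeff p r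
  · exact Or.inl (domRank_lt_of_meets h.coeff_le hm)
  rw [not_or, not_exists, not_exists] at hm
  have hq : ∀ c, D.coeff c q = E.coeff c q := fun c => by
    have := hm.1 c; have := h.coeff_le c q; omega
  have hp : ∀ r, D.coeff p r = E.coeff p r := fun r => by
    have := hm.2 r; have := h.coeff_le p r; omega
  obtain ⟨i, j, hf | hl⟩ := h
  · have hst := strip_congr hf.y_eq.symm hq hp
    by_cases hin : ∀ c r, rectCoeff D.x i j c r ≠ 0 → ∃ s, strip p q D = some s ∧ InStrip s c r
    · right
      obtain ⟨s, hs, -⟩ := hin i (D.x i) (by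
        rw [rectCoeff, cyc_left hf.rect.1, cyc_left (D.x.injective.ne hf.rect.1)]; simp)
      have hpair : stripPair s D.x = (i, j) := eq_stripPair hf.rect.1 fun c r hcr => by
        obtain ⟨s', hs', hin'⟩ := hin c r hcr
        rw [hs] at hs'
        rw [Option.some_injective _ hs']; exact hin'
      refine ⟨domRank_of_planar hf.y_eq.symm hq hp ?_, s, hs, hst ▸ hs, by rw [hpair]; exact hf⟩
      rw [outside, outside, ← hst]
      refine Finset.sum_congr rfl fun c _ => Finset.sum_congr rfl fun r _ => ?_
      split_ifs with h'
      · rfl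
      · rw [hf.coeff_eq, Pi.add_apply, Pi.add_apply, not_imp_comm.1 (hin c r) h', zero_add]
    · left
      push Not at hin
      obtain ⟨c, r, hcr, hnot⟩ := hin
      rw [domRank_lt_iff]
      refine Or.inr ⟨(hp q).symm, Or.inr ⟨by simp only [hp, hq], Or.inr ⟨by rw [hf.y_eq], ?_⟩⟩⟩
      rw [outside, outside, ← hst]
      have hle : ∀ c r, (if ∃ s, strip p q D = some s ∧ InStrip s c r then 0 else E.coeff c r)
          ≤ if ∃ s, strip p q D = some s ∧ InStrip s c r then 0 else D.coeff c r := by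
        intro c r
        split_ifs
        · exact le_rfl
        · rw [hf.coeff_eq]; exact Nat.le_add_left _ _
      refine Finset.sum_lt_sum (fun c _ => Finset.sum_le_sum fun r _ => hle c r)
        ⟨c, Finset.mem_univ c, Finset.sum_lt_sum (fun r _ => hle c r) ⟨r, Finset.mem_univ r, ?_⟩⟩
      have : ¬ ∃ s, strip p q D = some s ∧ InStrip s c r := fun ⟨s, h1, h2⟩ => hnot s h1 h2
      rw [if_neg this, if_neg this, hf.coeff_eq, Pi.add_apply, Pi.add_apply]
      omega
  · left
    have hpl : IsPlanar p q E.y i j := isPlanar_of_rectCoeff hl.rect.1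
      (fun r => by have := hp r; rw [hl.coeff_eq, Pi.add_apply, Pi.add_apply] at this; omega)
      (fun c => by have := hq c; rw [hl.coeff_eq, Pi.add_apply, Pi.add_apply] at this; omega)
    rw [domRank_lt_iff]
    refine Or.inr ⟨(hp q).symm, Or.inr ⟨by simp only [hp, hq], Or.inl ?_⟩⟩
    have hE : E.y = D.y * Equiv.swap i j := ((mul_swap_eq_iff _ _ i j).1 hl.y_eq.symm)
    rw [hE]
    refine potential_swap_lt hpl.1 ?_
    have := hpl.2
    simpa [hE] using this

/-! ### The matching of domains -/

/-- `w` is a facet of `D` by which `D` can be recognized among the domains whose rank is at most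
that of `D`. -/
structure IsDetectedBy (p q : Fin n) (D w : PosDomain n) : Prop where
  facet : IsFacet D w
  rank_eq : domRank p q w = domRank p q D
  unique : ∀ D', IsFacet D' w → domRank p q D' ≤ domRank p q D → D' = D

/-- `D` is a facet of `U`, and everything else obtained from `U` by removing a rectangle or an annulus
has smaller rank than `D`. -/
structure IsReducedBy (p q : Fin n) (D U : PosDomain n) : Prop where
  facet : IsFacet U D
  corner_eq : U.coeff p q = D.coeff p q
  facet_lt : ∀ E, IsFacet U E → E ≠ D → domRank p q E < domRank p q D
  bubble_lt : ∀ E, IsBubble U E → domRank p q E < domRank p q D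

theorem IsFirst.eq_left {D D' E : PosDomain n} {i j : Fin n} (h : IsFirst D E i j)
    (h' : IsFirst D' E i j) : D' = D := by
  have hx : D'.x = D.x := mul_right_cancel (h'.x_eq.symm.trans h.x_eq)
  ext1
  · exact hx
  · exact h'.y_eq.symm.trans h.y_eq
  · rw [h'.coeff_eq, h.coeff_eq, hx]

theorem IsFirst.eq_right {D E E' : PosDomain n} {i j : Fin n} (h : IsFirst D E i j)
    (h' : IsFirst D E' i j) : E' = E := by
  ext1
  · exact h'.x_eq.trans h.x_eq.symm
  · exact h'.y_eq.trans h.y_eq.symm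
  · exact add_left_cancel (h'.coeff_eq.symm.trans h.coeff_eq)

theorem IsFirst.domRank_eq (hn : 2 ≤ n) {p q : Fin n} {D E : PosDomain n} {s : Fin n ⊕ Fin n}
    (hpl : IsPlanar p q D.x (stripPair s D.x).1 (stripPair s D.x).2)
    (hf : IsFirst D E (stripPair s D.x).1 (stripPair s D.x).2)
    (hs : strip p q D = some s ∨ strip p q E = some s) :
    domRank p q E = domRank p q D ∧ strip p q D = some s ∧ strip p q E = some s := by
  have hq : ∀ c, D.coeff c q = E.coeff c q := fun c => by
    rw [hf.coeff_eq, Pi.add_apply, Pi.add_apply, hpl.rectCoeff_row, zero_add]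
  have hp : ∀ r, D.coeff p r = E.coeff p r := fun r => by
    rw [hf.coeff_eq, Pi.add_apply, Pi.add_apply, hpl.rectCoeff_col, zero_add]
  have hst := strip_congr hf.y_eq.symm hq hp
  have hsD : strip p q D = some s := by
    rcases hs with h | h
    · exact h
    · rw [hst]; exact h
  rcases (show IsFacet D E from ⟨_, _, Or.inl hf⟩).domRank_lt_or (p := p) (q := q) with h | h
  · refine ⟨domRank_of_planar hf.y_eq.symm hq hp ?_, hsD, hst ▸ hsD⟩
    rw [outside, outside, ← hst]
    refine Finset.sum_congr rfl fun c _ => Finset.sum_congr rfl fun r _ => ?_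
    split_ifs with h'
    · rfl
    · rw [hf.coeff_eq, Pi.add_apply, Pi.add_apply]
      by_cases h0 : rectCoeff D.x (stripPair s D.x).1 (stripPair s D.x).2 c r = 0
      · rw [h0, zero_add]
      · exact absurd ⟨s, hsD, inStrip_of_rectCoeff hn h0⟩ h'
  · exact ⟨h.1, hsD, hst ▸ hsD⟩

/-- The matching of the domains that have a good strip: if the rectangle in the strip that starts at
the initial generator avoids row `q` and column `p`, it is removed; otherwise the complementary
rectangle is added. -/
theorem detected_or_reduced (hn : 2 ≤ n) {p q : Fin n} {D : PosDomain n} {s : Fin n ⊕ Fin n}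
    (hs : strip p q D = some s) : (∃ w, IsDetectedBy p q D w) ∨ ∃ U, IsReducedBy p q D U := by
  rcases isPlanar_or_flip hn (goodStrip_of_strip hs) D.x with hpl | hpl
  · left
    have hle := rectCoeff_stripPair_le hn hs hpl
    have hr := isRect_stripPair hn s D.x
    have hw := (isFirst_iff D _ _ _).2 ⟨⟨hr, hle⟩, rfl⟩
    obtain ⟨hrank, -, hsw⟩ := hw.domRank_eq hn hpl (Or.inl hs)
    refine ⟨_, ⟨_, _, Or.inl hw⟩, hrank, fun D' hD' hle' => ?_⟩
    rcases hD'.domRank_lt_or (p := p) (q := q) with h | ⟨-, s', -, hs'2, hf⟩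
    · rw [hrank] at h
      exact absurd hle' (not_le.2 h)
    · rw [hsw] at hs'2
      obtain rfl := Option.some_injective _ hs'2
      have hx : D'.x = D.x := by
        rw [← flip_flip s D'.x, ← flip_flip s D.x]
        exact congrArg _ (hf.x_eq.symm.trans hw.x_eq)
      rw [hx] at hf
      exact hw.eq_left hf
  · right
    have hfl : D.x = flip s D.x * Equiv.swap (stripPair s (flip s D.x)).1
      (stripPair s (flip s D.x)).2 := (flip_flip s D.x).symm
    have hr := isRect_stripPair hn s (flip s D.x)
    have hb : BdryCond (flip s D.x) D.y (rectCoeff (flip s D.x) (stripPair s (flip s D.x)).1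
        (stripPair s (flip s D.x)).2 + D.coeff) := by
      intro c r
      have h1 := rect_bdry (x := flip s D.x) hr.1 c r
      have h2 := D.bdry c r
      rw [← hfl] at h1
      simp only [Pi.add_apply]
      omega
    let U : PosDomain n := ⟨flip s D.x, D.y, _, hb⟩
    have hU : IsFirst U D (stripPair s U.x).1 (stripPair s U.x).2 := ⟨hr, hfl, rfl, rfl⟩
    obtain ⟨hrank, hsU, -⟩ := hU.domRank_eq hn hpl (Or.inr hs)
    refine ⟨U, ⟨_, _, Or.inl hU⟩, ?_, fun E hE hne => ?_, fun E hE => ?_⟩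
    · rw [hU.coeff_eq, Pi.add_apply, Pi.add_apply, hpl.rectCoeff_col, zero_add]
    · rw [hrank]
      rcases hE.domRank_lt_or (p := p) (q := q) with h | ⟨-, s', hs', -, hf⟩
      · exact h
      · rw [hsU] at hs'
        obtain rfl := Option.some_injective _ hs'
        exact absurd (hU.eq_right hf) hne
    · rw [hrank]
      exact hE.domRank_lt

/-! ### Domains without a good strip -/

theorem const_of_not_isGood (hn : 2 ≤ n) {p : Fin n} {a f : Fin n → ℕ}
    (h : ∀ i, i ≠ p → ¬ IsGood a f i) : (∀ c, c ≠ p → a c = a (p + 1)) ∧ a (p + 1) ≤ a p := by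
  have h1 : ∀ i, i ≠ p → a i ≤ a (i - 1) ∧ a i ≤ a (i + 1) := fun i hi => by
    have := h i hi
    simp only [IsGood, not_or, not_lt] at this
    exact ⟨this.1, this.2.1⟩
  refine ⟨fun c => ?_, ?_⟩
  · induction c using fin_induction_add_one (a := p + 1) with
    | ha => exact fun _ => rfl
    | hs c ih =>
      intro hc
      by_cases hcp : c = p
      · rw [hcp]
      · have e1 := (h1 (c + 1) hc).1
        have e2 := (h1 c hcp).2
        rw [add_sub_cancel_right] at e1
        have e3 := ih hcp
        omega
  · have := (h1 (p + 1) (succ_ne hn p).symm).1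
    rwa [add_sub_cancel_right] at this

theorem lt_of_not_isGood (hn : 2 ≤ n) {q i : Fin n} {a : Fin n → ℕ} {y : Generator n}
    (h : ¬ IsGood a (fun c => pos q (y c)) i) (h1 : a (i - 1) = a i) (h2 : a i = a (i + 1)) :
    pos q (y i) < pos q (y (i + 1)) := by
  have := (pos_injective q).ne (y.injective.ne (succ_ne hn i))
  simp only [IsGood, not_or, not_and, not_lt] at h
  have := h.2.2 h1 h2
  omega

theorem eq_diagonal_of_lt {p q : Fin n} {y : Generator n}
    (h : ∀ i, i ≠ p → pos q (y i) < pos q (y (i + 1))) : y = diagonal p q := by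
  refine eq_diagonal_of_le fun c => ?_
  induction c using fin_induction_add_one (a := p + 1) with
  | ha => rw [pos_succ_self]; exact Nat.zero_le _
  | hs c ih =>
    by_cases hc : c = p
    · rw [hc, pos_succ_self]; exact Nat.zero_le _
    · have := h c hc
      rw [pos_add_one hc]; omega

theorem inv_diagonal (p q : Fin n) : (diagonal q p)⁻¹ = diagonal p q := by
  rw [inv_eq_iff_mul_eq_one]
  ext1 c
  rw [Equiv.Perm.mul_apply, diagonal_apply, diagonal_apply, Equiv.Perm.one_apply]
  abel

theorem diagonal_self (p q : Fin n) : diagonal p q p = q := by rw [diagonal_apply]; abel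

theorem diagonal_succ (p q : Fin n) : diagonal p q (p + 1) = q + 1 := by
  rw [diagonal_apply]; abel

theorem colCoeff_periodic (c : Fin n) : IsPeriodic (colCoeff c) := fun c r => by
  simp only [colCoeff]; ring

theorem rowCoeff_periodic (r : Fin n) : IsPeriodic (rowCoeff r) := fun _ _ => rfl

theorem eq_annulus_of_le {D : PosDomain n} {a : Fin n → Fin n → ℕ} (ha : IsAnnulusCoeff a)
    (hp : IsPeriodic a) (hle : ∀ c r, a c r ≤ D.coeff c r) (hD : D.maslov ≤ 2) :
    D = annulus a hp D.y := by
  have h1 := maslov_removeAnnulus D ha hp hle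
  have h2 := maslov_nonneg (removeAnnulus D a hp hle)
  have h3 := eq_constDomain_of_maslov (D := removeAnnulus D a hp hle) (by linarith)
  ext1
  · exact (congrArg PosDomain.y h3).symm
  · rfl
  · funext c r
    have h4 := congrFun (congrFun (congrArg PosDomain.coeff h3) c) r
    have h5 := hle c r
    simp only [removeAnnulus, constDomain] at h4
    change D.coeff c r = a c r
    omega

/-- The small square at the corner, as a domain that starts at the diagonal generator. -/
def cornerSquare (hn : 2 ≤ n) (p q : Fin n) : PosDomain n where
  x := diagonal p q
  y := diagonal p q * Equiv.swap p (p + 1)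
  coeff := rectCoeff (diagonal p q) p (p + 1)
  bdry := rect_bdry (succ_ne hn p)

theorem eq_one_of_ite_eq {P Q : Prop} [Decidable P] [Decidable Q] {k u : ℕ} (hk : k ≠ 0)
    (h : (if P then 1 else 0) = k + u + if Q then 1 else 0) : P ∧ k = 1 := by
  split_ifs at h with h1 <;> first | omega | exact ⟨h1, by omega⟩

theorem eq_cornerSquare (hn : 2 ≤ n) {p q : Fin n} {D : PosDomain n}
    (hq : ∀ c, c ≠ p → D.coeff c q = 0) (hp : ∀ r, r ≠ q → D.coeff p r = 0)
    (h0 : D.coeff p q ≠ 0)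
    (hy : ∀ i, i - 1 ≠ p → i ≠ p → i + 1 ≠ p → pos q (D.y i) < pos q (D.y (i + 1))) :
    D = cornerSquare hn p q := by
  have hpn := succ_ne hn p
  have hqn := succ_ne hn q
  have hpm : p - 1 ≠ p := fun e => succ_ne hn (p - 1) (by rw [sub_add_cancel]; exact e)
  have hqm : q - 1 ≠ q := fun e => succ_ne hn (q - 1) (by rw [sub_add_cancel]; exact e)
  have b1 := D.bdry p q
  rw [hq _ hpm, hp _ hqm] at b1
  have b2 := D.bdry (p + 1) (q + 1)
  rw [add_sub_cancel_right, add_sub_cancel_right, hq _ hpn.symm, hp _ hqn.symm] at b2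
  have b3 := D.bdry (p + 1) q
  rw [add_sub_cancel_right, hq _ hpn.symm, hp _ hqm] at b3
  have b4 := D.bdry p (q + 1)
  rw [add_sub_cancel_right, hq _ hpm, hp _ hqn.symm] at b4
  obtain ⟨x1, hk⟩ := eq_one_of_ite_eq (P := D.x p = q) (Q := D.y p = q)
    (u := D.coeff (p - 1) (q - 1)) h0 (by linarith [b1])
  obtain ⟨x2, -⟩ := eq_one_of_ite_eq (P := D.x (p + 1) = q + 1) (Q := D.y (p + 1) = q + 1)
    (u := D.coeff (p + 1) (q + 1)) h0 (by linarith [b2])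
  obtain ⟨y2, -⟩ := eq_one_of_ite_eq (P := D.y (p + 1) = q) (Q := D.x (p + 1) = q)
    (u := D.coeff (p + 1) (q - 1)) h0 (by linarith [b3])
  obtain ⟨y1, -⟩ := eq_one_of_ite_eq (P := D.y p = q + 1) (Q := D.x p = q + 1)
    (u := D.coeff (p - 1) (q + 1)) h0 (by linarith [b4])
  -- the rectangle at the corner can be removed from the end
  set z : Generator n := D.y * Equiv.swap p (p + 1) with hz
  have z1 : z p = q := by rw [hz, swap_val, if_pos rfl, y2]
  have z2 : z (p + 1) = q + 1 := by rw [hz, swap_val, if_neg hpn.symm, if_pos rfl, y1]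
  have hzd : z = diagonal p q := by
    refine eq_diagonal_of_le fun c => ?_
    induction c using fin_induction_add_one (a := p + 1) with
    | ha => rw [pos_succ_self]; exact Nat.zero_le _
    | hs c ih =>
      by_cases hc : c = p
      · rw [hc, pos_succ_self]; exact Nat.zero_le _
      by_cases hc1 : c + 1 = p
      · rw [hc1, z1, pos_self, pos_self]
      rw [pos_add_one hc]
      by_cases hc2 : c = p + 1
      · have h3 : z (c + 1) ≠ q + 1 := fun e => by
          have := z.injective (e.trans z2.symm)
          rw [hc2] at this
          exact succ_ne hn (p + 1) this.symm
        have h4 := (pos_injective q).ne h3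
        rw [pos_succ_self] at h4
        rw [hc2, pos_succ_self, ← hc2]
        omega
      · have h3 := hy c (fun e => hc2 (by rw [← e, sub_add_cancel])) hc hc1
        have h4 : c + 1 ≠ p + 1 := fun e => hc (add_right_cancel e)
        rw [hz, swap_val, if_neg hc1, if_neg h4]
        rw [hz, swap_val, if_neg hc, if_neg hc2] at ih
        omega
  have hsq : ∀ c r, rectCoeff z p (p + 1) c r = if c = p ∧ r = q then 1 else 0 := fun c r => by
    rw [rectCoeff, z1, z2, cyc_succ hn, cyc_succ hn]
    by_cases h1 : c = p <;> by_cases h2 : r = q <;> simp [h1, h2]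
  have hle : ∀ c r, rectCoeff z p (p + 1) c r ≤ D.coeff c r := fun c r => by
    rw [hsq]
    split_ifs with h
    · rw [h.1, h.2, hk]
    · exact Nat.zero_le _
  have hE := eq_constDomain_of_planar (p := p) (q := q) (D := removeLast D p (p + 1) hpn hle) hzd
    (fun c => by
      change D.coeff c q - rectCoeff z p (p + 1) c q = 0
      rw [hsq]
      by_cases h : c = p
      · rw [h, hk, if_pos ⟨rfl, rfl⟩]
      · rw [hq c h, Nat.zero_sub])
    (fun r => by
      change D.coeff p r - rectCoeff z p (p + 1) p r = 0
      rw [hsq]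
      by_cases h : r = q
      · rw [h, hk, if_pos ⟨rfl, rfl⟩]
      · rw [hp r h, Nat.zero_sub])
  ext1
  · have h1 := congrArg PosDomain.x hE
    exact h1
  · change D.y = diagonal p q * Equiv.swap p (p + 1)
    rw [← hzd, hz, mul_assoc, Equiv.swap_mul_self, mul_one]
  · funext c r
    have h1 := congrFun (congrFun (congrArg PosDomain.coeff hE) c) r
    have h2 : D.coeff c r - rectCoeff z p (p + 1) c r = 0 := h1
    have h3 := hle c r
    change D.coeff c r = rectCoeff (diagonal p q) p (p + 1) c r
    rw [← hzd]
    omega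

theorem eq_of_strip_eq_none (hn : 2 ≤ n) {p q : Fin n} {D : PosDomain n}
    (hs : strip p q D = none) (hD : D.maslov ≤ 2) :
    D = constDomain (diagonal p q) ∨ D = annulus (rowCoeff q) (rowCoeff_periodic q) (diagonal p q) ∨
      D = annulus (colCoeff p) (colCoeff_periodic p) (diagonal p q) ∨ D = cornerSquare hn p q := by
  have hcol : ∀ i, i ≠ p → ¬ IsGood (fun c => D.coeff c q) (fun c => pos q (D.y c)) i :=
    fun i hi hg => not_goodStrip_of_strip hs (.inl i) ⟨hi, hg⟩
  have hrow : ∀ j, j ≠ q → ¬ IsGood (fun r => D.coeff p r) (fun r => pos p (D.y⁻¹ r)) j :=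
    fun j hj hg => not_goodStrip_of_strip hs (.inr j) ⟨hj, hg⟩
  obtain ⟨ha, hak⟩ := const_of_not_isGood hn hcol
  obtain ⟨hb, hbk⟩ := const_of_not_isGood hn hrow
  have hH : D.coeff (p + 1) q ≠ 0 →
      D = annulus (rowCoeff q) (rowCoeff_periodic q) D.y := fun h =>
    eq_annulus_of_le (Or.inr ⟨q, rfl⟩) _ (fun c r => by
      rw [rowCoeff]
      split_ifs with hr
      · rw [hr]
        by_cases hc : c = p
        · rw [hc]; omega
        · rw [ha c hc]; omega
      · exact Nat.zero_le _) hD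
  have hV : D.coeff p (q + 1) ≠ 0 →
      D = annulus (colCoeff p) (colCoeff_periodic p) D.y := fun h =>
    eq_annulus_of_le (Or.inl ⟨p, rfl⟩) _ (fun c r => by
      rw [colCoeff]
      split_ifs with hc
      · rw [hc]
        by_cases hr : r = q
        · rw [hr]; omega
        · rw [hb r hr]; omega
      · exact Nat.zero_le _) hD
  by_cases h1 : D.coeff (p + 1) q = D.coeff p q
  · have hall : ∀ c, D.coeff c q = D.coeff p q := fun c => by
      by_cases hc : c = p
      · rw [hc]
      · rw [ha c hc, h1]
    have hy : D.y = diagonal p q := eq_diagonal_of_lt fun i hi =>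
      lt_of_not_isGood hn (hcol i hi) (by rw [hall, hall i]) (by rw [hall, hall (i + 1)])
    by_cases h0 : D.coeff (p + 1) q = 0
    · left
      refine eq_constDomain_of_planar hy (fun c => by rw [hall, ← h1, h0]) fun r => ?_
      by_cases hr : r = q
      · rw [hr, ← h1, h0]
      · rw [hb r hr]; omega
    · right; left
      rw [← hy]; exact hH h0
  by_cases h2 : D.coeff p (q + 1) = D.coeff p q
  · have hall : ∀ r, D.coeff p r = D.coeff p q := fun r => by
      by_cases hr : r = q
      · rw [hr]
      · rw [hb r hr, h2]
    have hy : D.y⁻¹ = diagonal q p := eq_diagonal_of_lt fun j hj =>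
      lt_of_not_isGood hn (hrow j hj) (by rw [hall, hall j]) (by rw [hall, hall (j + 1)])
    right; right; left
    rw [← inv_diagonal, ← hy, inv_inv]
    exact hV (by omega)
  right; right; right
  have h3 : D.coeff (p + 1) q = 0 := by
    by_contra h
    have h4 := congrArg PosDomain.coeff (hH h)
    apply h1
    rw [h4]; rfl
  have h5 : D.coeff p (q + 1) = 0 := by
    by_contra h
    have h4 := congrArg PosDomain.coeff (hV h)
    apply h2
    rw [h4]; rfl
  refine eq_cornerSquare hn (fun c hc => by rw [ha c hc, h3]) (fun r hr => by rw [hb r hr, h5])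
    (by omega) fun i hi1 hi2 hi3 => lt_of_not_isGood hn (hcol i hi2) ?_ ?_
  · rw [ha _ hi1, ha _ hi2]
  · rw [ha _ hi2, ha _ hi3]

theorem IsLast.eq_right {D E E' : PosDomain n} {i j : Fin n} (h : IsLast D E i j)
    (h' : IsLast D E' i j) : E' = E := by
  have hy : E'.y = E.y := mul_right_cancel (h'.y_eq.symm.trans h.y_eq)
  ext1
  · exact h'.x_eq.trans h.x_eq.symm
  · exact hy
  · refine add_left_cancel (a := rectCoeff E.y i j) ?_
    rw [← h.coeff_eq, h'.coeff_eq, hy]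

theorem maslov_annulus {a : Fin n → Fin n → ℕ} (ha : IsAnnulusCoeff a) (hp : IsPeriodic a)
    (x : Generator n) : (annulus a hp x).maslov = 2 := by
  rw [maslov_of_annulus (D := annulus a hp x) (E := constDomain x) ha rfl rfl (add_zero a).symm,
    maslov_constDomain]
  norm_num

/-- The multiplicities of the annulus which consists of a strip. -/
def stripCoeff : Fin n ⊕ Fin n → Fin n → Fin n → ℕ
  | .inl i => colCoeff i
  | .inr j => rowCoeff j

theorem stripCoeff_isAnnulusCoeff (s : Fin n ⊕ Fin n) : IsAnnulusCoeff (stripCoeff s) := by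
  cases s with
  | inl i => exact Or.inl ⟨i, rfl⟩
  | inr j => exact Or.inr ⟨j, rfl⟩

theorem stripCoeff_periodic (s : Fin n ⊕ Fin n) : IsPeriodic (stripCoeff s) := by
  cases s with
  | inl i => exact colCoeff_periodic i
  | inr j => exact rowCoeff_periodic j

theorem inStrip_of_stripCoeff {s : Fin n ⊕ Fin n} {c r : Fin n} (h : stripCoeff s c r ≠ 0) :
    InStrip s c r := by
  cases s with
  | inl i => exact by_contra fun hc => h (if_neg hc)
  | inr j => exact by_contra fun hr => h (if_neg hr)

/-- A strip is the union of two complementary rectangles. -/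
theorem rectCoeff_add_flip (hn : 2 ≤ n) (s : Fin n ⊕ Fin n) (x : Generator n) :
    rectCoeff x (stripPair s x).1 (stripPair s x).2
      + rectCoeff (flip s x) (stripPair s (flip s x)).1 (stripPair s (flip s x)).2
      = stripCoeff s := by
  cases s with
  | inl i => exact rectCoeff_col hn x i
  | inr j =>
    have h1 : x (x⁻¹ (j + 1)) = x (x⁻¹ j) + 1 := by rw [apply_inv_apply, apply_inv_apply]
    have h2 := rectCoeff_row hn x h1
    rw [apply_inv_apply] at h2
    rw [stripCoeff, ← h2]
    simp only [stripPair, flip, mul_inv_rev, Equiv.swap_inv, Equiv.Perm.mul_apply,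
      Equiv.swap_apply_left, Equiv.swap_apply_right]
    rfl

theorem stripPair_diagonal_inr (p q : Fin n) : stripPair (.inr q) (diagonal p q) = (p, p + 1) := by
  have h : (diagonal p q)⁻¹ = diagonal q p := inv_diagonal q p
  rw [stripPair, h, diagonal_self, diagonal_succ]

theorem cornerSquare_corner (hn : 2 ≤ n) (p q : Fin n) : (cornerSquare hn p q).coeff p q = 1 := by
  change rectCoeff (diagonal p q) p (p + 1) p q = 1
  rw [rectCoeff, diagonal_self, diagonal_succ, cyc_succ hn, cyc_succ hn, if_pos rfl, if_pos rfl]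

/-- The corner square is the only facet through the corner of the horizontal or vertical annulus
through the corner. -/
theorem isFacet_annulus_corner (hn : 2 ≤ n) {p q : Fin n} {s : Fin n ⊕ Fin n}
    (hs : stripPair s (diagonal p q) = (p, p + 1)) (hc : stripCoeff s p q = 1) :
    IsFacet (annulus (stripCoeff s) (stripCoeff_periodic s) (diagonal p q)) (cornerSquare hn p q) ∧
      ∀ E, IsFacet (annulus (stripCoeff s) (stripCoeff_periodic s) (diagonal p q)) E →
        E ≠ cornerSquare hn p q → E.coeff p q = 0 := by
  have hflip : flip s (diagonal p q) = (cornerSquare hn p q).y := by rw [flip, hs]; rfl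
  have hl : IsLast (annulus (stripCoeff s) (stripCoeff_periodic s) (diagonal p q))
      (cornerSquare hn p q) (stripPair s (cornerSquare hn p q).y).1
      (stripPair s (cornerSquare hn p q).y).2 := by
    refine ⟨isRect_stripPair hn s _, rfl, ?_, ?_⟩
    · change _ = flip s _
      rw [← hflip, flip_flip]; rfl
    · change stripCoeff s = _
      rw [← rectCoeff_add_flip hn s (diagonal p q), hs, hflip, add_comm]
      rfl
  refine ⟨⟨_, _, Or.inr hl⟩, fun E hE hne => ?_⟩
  have hstrip : ∀ (x : Generator n) (i j : Fin n), i ≠ j →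
      stripCoeff s = rectCoeff x i j + E.coeff → stripPair s x = (i, j) := by
    intro x i j hij h
    refine eq_stripPair hij fun c r hcr => inStrip_of_stripCoeff ?_
    rw [h, Pi.add_apply, Pi.add_apply]
    omega
  obtain ⟨i, j, hf | hl'⟩ := hE
  · have hpair := hstrip _ i j hf.rect.1 hf.coeff_eq
    have h1 : stripCoeff s p q = rectCoeff (diagonal p q) i j p q + E.coeff p q :=
      congrFun (congrFun hf.coeff_eq p) q
    obtain ⟨rfl, rfl⟩ := Prod.mk.inj (hs.symm.trans hpair)
    have h2 := cornerSquare_corner hn p q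
    change rectCoeff (diagonal p q) p (p + 1) p q = 1 at h2
    omega
  · have hpair := hstrip _ i j hl'.rect.1 hl'.coeff_eq
    have h1 : diagonal p q = flip s E.y := by
      rw [flip, hpair]; exact hl'.y_eq
    have h2 : E.y = (cornerSquare hn p q).y := by rw [← hflip, h1, flip_flip]
    rw [h2] at hpair
    rw [hpair] at hl
    exact absurd (hl.eq_right hl') hne

/-- The square at the corner is reduced by the horizontal annulus through the corner. -/
theorem cornerSquare_isReducedBy (hn : 2 ≤ n) (p q : Fin n) : IsReducedBy p q (cornerSquare hn p q)
    (annulus (rowCoeff q) (rowCoeff_periodic q) (diagonal p q)) := by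
  have hcorner := cornerSquare_corner hn p q
  have hAc : (annulus (rowCoeff q) (rowCoeff_periodic q) (diagonal p q)).coeff p q = 1 :=
    if_pos rfl
  have hlt : ∀ E : PosDomain n, E.coeff p q = 0 →
      domRank p q E < domRank p q (cornerSquare hn p q) := fun E h => by
    rw [domRank_lt_iff, hcorner, h]
    exact Or.inl one_pos
  obtain ⟨h1, h2⟩ := isFacet_annulus_corner hn (s := .inr q) (stripPair_diagonal_inr p q)
    (if_pos rfl)
  refine ⟨h1, hAc.trans hcorner.symm, fun E hE hne => hlt E (h2 E hE hne), fun E hE => hlt E ?_⟩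
  have h3 := hE.maslov_eq
  rw [maslov_annulus (Or.inr ⟨q, rfl⟩)] at h3
  rw [eq_constDomain_of_maslov (D := E) (by linarith)]
  rfl

/-- In degrees at most two, the only unmatched domains are a constant one and two annuli. -/
theorem domain_cases (hn : 2 ≤ n) (p q : Fin n) {D : PosDomain n} (hD : D.maslov ≤ 2) :
    (∃ w, IsDetectedBy p q D w) ∨ (∃ U, IsReducedBy p q D U) ∨
      D = constDomain (diagonal p q) ∨
      D = annulus (rowCoeff q) (rowCoeff_periodic q) (diagonal p q) ∨
      D = annulus (colCoeff p) (colCoeff_periodic p) (diagonal p q) := by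
  cases hs : strip p q D with
  | some s =>
    rcases detected_or_reduced hn hs with h | h
    · exact Or.inl h
    · exact Or.inr (Or.inl h)
  | none =>
    rcases eq_of_strip_eq_none hn hs hD with h | h | h | h
    · exact Or.inr (Or.inr (Or.inl h))
    · exact Or.inr (Or.inr (Or.inr (Or.inl h)))
    · exact Or.inr (Or.inr (Or.inr (Or.inr h)))
    · rw [h]
      exact Or.inr (Or.inl ⟨_, cornerSquare_isReducedBy hn p q⟩)

/-! ### Cycles of domains of low degree -/

/-- Detection of `D` by a coefficient of the differential. -/
theorem IsDetectedBy.domOp_apply {p q : Fin n} {D w : PosDomain n} (h : IsDetectedBy p q D w) :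
    domOp (Finsupp.single D 1) w = 1 := by
  rw [domOp_apply_eq, if_pos h.facet]

theorem IsDetectedBy.domOp_apply_of_ne {p q : Fin n} {D w D' : PosDomain n}
    (h : IsDetectedBy p q D w) (hne : D' ≠ D) (hle : domRank p q D' ≤ domRank p q D) :
    domOp (Finsupp.single D' 1) w = 0 := by
  rw [domOp_apply_eq, if_neg fun hf => hne (h.unique D' hf hle)]

theorem IsReducedBy.domOp_sub_mem {p q : Fin n} {D U : PosDomain n} (h : IsReducedBy p q D U) :
    domOp (Finsupp.single U 1) - Finsupp.single D 1 ∈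
      chainsOn {E | IsFacet U E ∧ domRank p q E < domRank p q D} := by
  intro E hE
  classical
  have h1 := Finsupp.mem_support_iff.1 hE
  rw [Finsupp.sub_apply, domOp_apply_eq, Finsupp.single_apply] at h1
  by_cases hED : D = E
  · rw [if_pos hED, if_pos (hED ▸ h.facet), sub_self] at h1
    exact absurd rfl h1
  · rw [if_neg hED, sub_zero] at h1
    have hf : IsFacet U E := by
      by_contra hf
      rw [if_neg hf] at h1
      exact h1 rfl
    exact ⟨hf, h.facet_lt E hf (Ne.symm hED)⟩

/-- The domains of Maslov index `k` which do not contain the corner square. -/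
def cornerFree (p q : Fin n) (k : ℕ) : Set (PosDomain n) := {D | D.maslov = k ∧ D.coeff p q = 0}

/-- The constant domains at any two generators are homologous away from the corner square. -/
theorem const_add_const_mem (hn : 2 ≤ n) (p q : Fin n) (x x' : Generator n) :
    Finsupp.single (constDomain x) 1 + Finsupp.single (constDomain x') 1 ∈
      (chainsOn (cornerFree p q 1)).map domOp := by
  refine mem_of_triangular (domRank p q) (cornerFree p q 0) _ {annulusCount 0} ?_ ?_ _ ?_ ?_
  · rintro _ rfl _ ⟨z, -, rfl⟩
    exact annulusCount_domOp 0 z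
  · intro D hD
    have hD0 : D.maslov = 0 := by simpa using hD.1
    rcases domain_cases hn p q (D := D) (by rw [hD0]; norm_num) with
      ⟨w, hw⟩ | ⟨U, hU⟩ | h | h | h
    · have h1 := hw.facet.maslov_eq
      have h2 := maslov_nonneg w
      linarith
    · left
      have h1 := hU.facet.maslov_eq
      have hU1 : U ∈ cornerFree p q 1 := ⟨by rw [h1, hD0]; norm_num, hU.corner_eq.trans hD.2⟩
      refine ⟨_, Submodule.mem_map_of_mem (single_mem_chainsOn hU1),
        chainsOn_mono (fun E hE => (show (_ ∧ _) ∧ _ from ⟨⟨?_, ?_⟩, hE.2⟩)) hU.domOp_sub_mem⟩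
      · have := hE.1.maslov_eq
        push_cast
        linarith
      · have := hE.1.coeff_le p q
        have := hU1.2
        omega
    · right
      refine ⟨_, rfl, ?_, fun E hE hne hle => ?_⟩
      · rw [annulusCount, lin_single, h, if_pos ⟨rfl, rfl⟩]
        exact one_ne_zero
      · exfalso
        have hE0 := eq_constDomain_of_maslov (D := E) (by simpa using hE.1)
        have h1 : potential p q E.y ≠ 0 := fun h1 => by
          rw [potential_eq_zero] at h1
          apply hne
          rw [h, ← h1, hE0]; rfl
        have h2 : potential p q D.y = 0 := by rw [potential_eq_zero, h]; rfl
        refine absurd hle (not_le.2 ?_)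
        rw [domRank_lt_iff, hE0, h]
        refine Or.inr ⟨rfl, Or.inr ⟨rfl, Or.inl ?_⟩⟩
        rw [← h, h2, ← hE0]; omega
    · rw [h, maslov_annulus (Or.inr ⟨_, rfl⟩)] at hD0; norm_num at hD0
    · rw [h, maslov_annulus (Or.inl ⟨_, rfl⟩)] at hD0; norm_num at hD0
  · refine Submodule.add_mem _ (single_mem_chainsOn ⟨?_, rfl⟩) (single_mem_chainsOn ⟨?_, rfl⟩) <;>
    rw [maslov_constDomain] <;> norm_num
  · rintro _ rfl
    rw [map_add, annulusCount, lin_single, lin_single, if_pos ⟨rfl, rfl⟩, if_pos ⟨rfl, rfl⟩]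
    exact add_self_zmod_two 1

/-- A chain of constant domains with an even number of terms is the differential of a chain of
rectangles that avoid the corner square. -/
theorem degree_zero_mem (hn : 2 ≤ n) (p q : Fin n) {z : DChain n}
    (hz : z ∈ chainsOn {D | D.maslov = 0}) (h0 : annulusCount 0 z = 0) :
    z ∈ (chainsOn (cornerFree p q 1)).map domOp := by
  have key : ∀ w ∈ chainsOn {D : PosDomain n | D.maslov = 0},
      w + annulusCount 0 w • Finsupp.single (constDomain 1) 1
        ∈ (chainsOn (cornerFree p q 1)).map domOp := by
    intro w hw
    refine map_mem_of_chainsOn (LinearMap.id + (annulusCount 0).smulRight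
      (Finsupp.single (constDomain 1) 1)) (fun D hD => ?_) hw
    have h1 := eq_constDomain_of_maslov hD
    rw [LinearMap.add_apply, LinearMap.smulRight_apply, annulusCount, lin_single, h1,
      if_pos ⟨rfl, rfl⟩, one_smul]
    exact const_add_const_mem hn p q _ _
  have := key z hz
  rwa [h0, zero_smul, add_zero] at this

/-- One-dimensional cycles away from the corner square bound. -/
theorem degree_one_mem (hn : 2 ≤ n) (p q : Fin n) {z : DChain n}
    (hz : z ∈ chainsOn (cornerFree p q 1)) (h0 : domOp z = 0) :
    z ∈ (chainsOn (cornerFree p q 2)).map domOp := by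
  refine mem_of_triangular (domRank p q) (cornerFree p q 1) _
    {ψ | ∃ w, ψ = Finsupp.lapply w ∘ₗ domOp} ?_ ?_ z hz ?_
  · rintro _ ⟨w, rfl⟩ _ ⟨y, -, rfl⟩
    rw [LinearMap.comp_apply, domOp_domOp hn, map_zero]
  · intro D hD
    have hD1 : D.maslov = 1 := by simpa using hD.1
    rcases domain_cases hn p q (D := D) (by rw [hD1]; norm_num) with
      ⟨w, hw⟩ | ⟨U, hU⟩ | h | h | h
    · right
      refine ⟨_, ⟨w, rfl⟩, ?_, fun E _ hne hle => hw.domOp_apply_of_ne hne hle⟩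
      rw [LinearMap.comp_apply, Finsupp.lapply_apply, hw.domOp_apply]
      exact one_ne_zero
    · left
      have h1 := hU.facet.maslov_eq
      have hU1 : U ∈ cornerFree p q 2 := ⟨by rw [h1, hD1]; norm_num, hU.corner_eq.trans hD.2⟩
      refine ⟨_, Submodule.mem_map_of_mem (single_mem_chainsOn hU1),
        chainsOn_mono (fun E hE => (show (_ ∧ _) ∧ _ from ⟨⟨?_, ?_⟩, hE.2⟩)) hU.domOp_sub_mem⟩
      · have := hE.1.maslov_eq
        push_cast
        linarith
      · have := hE.1.coeff_le p q
        have := hU1.2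
        omega
    · rw [h, maslov_constDomain] at hD1; norm_num at hD1
    · rw [h, maslov_annulus (Or.inr ⟨_, rfl⟩)] at hD1; norm_num at hD1
    · rw [h, maslov_annulus (Or.inl ⟨_, rfl⟩)] at hD1; norm_num at hD1
  · rintro _ ⟨w, rfl⟩
    rw [LinearMap.comp_apply, h0, map_zero]

/-! ### Coefficients of the differential -/

open Classical in
theorem tag_apply (μ : Fin n → List ℕ+) (z : DChain n) (w : Triple n) :
    tag μ z w = if w.part = μ then z w.dom else 0 := by
  have : Finsupp.lapply w ∘ₗ tag μ
      = if w.part = μ then Finsupp.lapply w.dom else (0 : DChain n →ₗ[ZMod 2] ZMod 2) :=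
    linearMap_ext_single fun D => by
      rw [LinearMap.comp_apply, tag_single, Finsupp.lapply_apply, gen, Finsupp.single_apply]
      by_cases h : w.part = μ
      · rw [if_pos h, Finsupp.lapply_apply, Finsupp.single_apply]
        refine if_congr ⟨fun e => by rw [← e], fun e => ?_⟩ rfl rfl
        ext1
        · exact e
        · exact h.symm
      · rw [if_neg h, if_neg fun e => h (by rw [← e])]; rfl
  have := LinearMap.congr_fun this z
  rw [LinearMap.comp_apply, Finsupp.lapply_apply] at this
  rw [this]
  split_ifs <;> rfl

open Classical in
theorem setOp_apply (t : Triple n) (j : Fin n) (m : ListChain) (w : Triple n) :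
    setOp t j m w = if w.dom = t.dom ∧ ∀ k, k ≠ j → w.part k = t.part k then m (w.part j) else 0 := by
  have : Finsupp.lapply w ∘ₗ setOp t j
      = if w.dom = t.dom ∧ ∀ k, k ≠ j → w.part k = t.part k then Finsupp.lapply (w.part j)
        else (0 : ListChain →ₗ[ZMod 2] ZMod 2) :=
    linearMap_ext_single fun l => by
      rw [LinearMap.comp_apply, setOp_single, Finsupp.lapply_apply, gen, Finsupp.single_apply]
      by_cases h : w.dom = t.dom ∧ ∀ k, k ≠ j → w.part k = t.part k
      · rw [if_pos h, Finsupp.lapply_apply, Finsupp.single_apply]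
        refine if_congr ⟨fun e => by rw [← e, setPart_part], fun e => ?_⟩ rfl rfl
        ext1
        · exact h.1.symm
        · funext k
          by_cases hk : k = j
          · rw [hk, setPart_part, e]
          · rw [h.2 k hk]; exact Function.update_of_ne hk _ _
      · rw [if_neg h, if_neg fun e => h ?_]
        · rfl
        · rw [← e]
          exact ⟨rfl, fun k hk => Function.update_of_ne hk _ _⟩
  have := LinearMap.congr_fun this m
  rw [LinearMap.comp_apply, Finsupp.lapply_apply] at this
  rw [this]
  split_ifs <;> rfl

open Classical in
/-- Triples whose domain does not have larger rank are not obtained by removing annuli. -/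
theorem boundary_gen_apply (G : GridDiagram n) {p q : Fin n} {t w : Triple n}
    (h : domRank p q t.dom ≤ domRank p q w.dom) : G.boundary (gen t) w =
      (if w.part = t.part then domOp (Finsupp.single t.dom 1) w.dom else 0)
      + ∑ j, if w.dom = t.dom ∧ ∀ k, k ≠ j → w.part k = t.part k then
          partOp (Finsupp.single (t.part j) 1) (w.part j) else 0 := by
  rw [boundary_gen, Finsupp.add_apply, Finsupp.add_apply, tag_apply, Finsupp.finsetSum_apply,
    Finsupp.finsetSum_apply]
  simp only [setOp_apply]
  rw [Finset.sum_eq_zero (f := fun j => (partLift j enlargeOp (tag t.part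
    (G.bubbleOp j (Finsupp.single t.dom 1)))) w), add_zero]
  intro j _
  by_contra hne
  have h1 := bubbleTerms_mem G t j (Finsupp.mem_support_iff.2 hne)
  exact absurd h (not_le.2 h1.1.domRank_lt)

/-! ### The rank of a triple -/

/-- The ordered partitions other than the empty one and the one of `1`. -/
def IsBadPart (l : List ℕ+) : Prop := l ≠ [] ∧ l ≠ [1]

theorem length_le_weight (l : List ℕ+) : l.length ≤ weight l := by
  induction l with
  | nil => exact le_rfl
  | cons a l ih =>
    rw [weight_cons, List.length_cons]
    have := a.pos
    omega

theorem weight_le_one {l : List ℕ+} (h : ¬ IsBadPart l) : weight l ≤ 1 := by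
  by_cases h1 : l = []
  · rw [h1, weight_nil]; omega
  · by_cases h2 : l = [1]
    · rw [h2]; exact le_rfl
    · exact absurd ⟨h1, h2⟩ h

theorem isBadPart_of_length {l : List ℕ+} (h : 2 ≤ l.length) : IsBadPart l := by
  constructor <;> rintro rfl <;> simp at h

theorem partOp_of_not_isBadPart {l : List ℕ+} (h : ¬ IsBadPart l) :
    partOp (Finsupp.single l 1) = 0 := by
  rw [partOp, LinearMap.add_apply]
  by_cases h1 : l = []
  · rw [h1, initOp_nil, tailOp_nil, add_zero]
  · by_cases h2 : l = [1]
    · rw [h2, initOp_cons, tailOp_cons, mergeOp_nil, tailOp_nil, map_zero, add_zero,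
        add_self_zmod_two]
    · exact absurd ⟨h1, h2⟩ h

theorem partOp_apply_ne_zero {l m : List ℕ+} (h : partOp (Finsupp.single l 1) m ≠ 0) :
    m.length + 1 = l.length ∧ (weight m < weight l ∨ (weight m = weight l ∧ m ≠ [])) :=
  partOp_mem l (Finsupp.mem_support_iff.2 h)

/-- The total weight of a family of partitions. -/
def totalWeight (μ : Fin n → List ℕ+) : ℕ := ∑ j, weight (μ j)

theorem totalWeight_eq {μ ν : Fin n → List ℕ+} {j : Fin n} (h : ∀ k, k ≠ j → μ k = ν k) :
    totalWeight μ + weight (ν j) = totalWeight ν + weight (μ j) := by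
  classical
  unfold totalWeight
  rw [← Finset.add_sum_erase _ _ (Finset.mem_univ j), ← Finset.add_sum_erase _ (fun i =>
    weight (ν i)) (Finset.mem_univ j), Finset.sum_congr rfl fun i hi => by
      rw [h i (Finset.ne_of_mem_erase hi)]]
  ring

/-- `j` is the first index at which the partition is neither empty nor the one of `1`. -/
def IsFirstBad (μ : Fin n → List ℕ+) (j : Fin n) : Prop :=
  IsBadPart (μ j) ∧ ∀ k, k < j → ¬ IsBadPart (μ k)

theorem IsFirstBad.unique {μ : Fin n → List ℕ+} {j k : Fin n} (h : IsFirstBad μ j)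
    (h' : IsFirstBad μ k) : k = j := by
  rcases lt_trichotomy j k with h1 | h1 | h1
  · exact absurd h.1 (h'.2 j h1)
  · exact h1.symm
  · exact absurd h'.1 (h.2 k h1)

theorem exists_isFirstBad {μ : Fin n → List ℕ+} {j : Fin n} (h : IsBadPart (μ j)) :
    ∃ k, IsFirstBad μ k := by
  obtain ⟨k, hk, hm⟩ := wellFounded_lt.has_min {k | IsBadPart (μ k)} ⟨j, h⟩
  exact ⟨k, hk, fun i hi hb => hm i hb hi⟩

open Classical in
/-- The first part of the first partition that is neither empty nor the one of `1`; zero if there is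
no such partition. -/
def firstPart (μ : Fin n → List ℕ+) : ℕ :=
  if h : ∃ j, IsFirstBad μ j then (μ h.choose).headD 1 else 0

theorem firstPart_eq {μ : Fin n → List ℕ+} {j : Fin n} (h : IsFirstBad μ j) :
    firstPart μ = (μ j).headD 1 := by
  have h' : ∃ j, IsFirstBad μ j := ⟨j, h⟩
  rw [firstPart, dif_pos h', h.unique h'.choose_spec]

/-- The rank of a triple: the rank of the domain, then the total weight of the partitions, which
reductions lower, then the first part, by which `(1, b, …)` precedes `(1 + b, …)`. -/
def tripleRank (p q : Fin n) (t : Triple n) : (ℕ ×ₗ ℕ ×ₗ ℕ ×ₗ ℕ) ×ₗ ℕ ×ₗ ℕ :=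
  toLex (domRank p q t.dom, toLex (totalWeight t.part, firstPart t.part))

theorem tripleRank_lt_iff {p q : Fin n} {s t : Triple n} : tripleRank p q s < tripleRank p q t ↔
    domRank p q s.dom < domRank p q t.dom ∨ domRank p q s.dom = domRank p q t.dom ∧
      (totalWeight s.part < totalWeight t.part ∨ totalWeight s.part = totalWeight t.part ∧
        firstPart s.part < firstPart t.part) := by
  simp only [tripleRank, Prod.Lex.toLex_lt_toLex]

theorem tripleRank_lt {p q : Fin n} {s t : Triple n} (h : domRank p q s.dom ≤ domRank p q t.dom)
    (h' : totalWeight s.part < totalWeight t.part ∨ totalWeight s.part ≤ totalWeight t.part ∧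
      firstPart s.part < firstPart t.part) : tripleRank p q s < tripleRank p q t := by
  rw [tripleRank_lt_iff]
  rcases h.lt_or_eq with h1 | h1
  · exact Or.inl h1
  · exact Or.inr ⟨h1, by omega⟩

theorem tripleRank_le {p q : Fin n} {s t : Triple n} (h : tripleRank p q s ≤ tripleRank p q t) :
    domRank p q s.dom ≤ domRank p q t.dom ∧ (domRank p q s.dom = domRank p q t.dom →
      totalWeight s.part ≤ totalWeight t.part ∧ (totalWeight s.part = totalWeight t.part →
        firstPart s.part ≤ firstPart t.part)) := by
  have h1 := not_lt.2 h
  rw [tripleRank_lt_iff] at h1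
  push Not at h1
  refine ⟨h1.1, fun e => ⟨(h1.2 e.symm).1, fun e' => (h1.2 e.symm).2 e'.symm⟩⟩

theorem IsFacet.domRank_le {p q : Fin n} {D E : PosDomain n} (h : IsFacet D E) :
    domRank p q E ≤ domRank p q D := by
  rcases h.domRank_lt_or (p := p) (q := q) with h | h
  · exact h.le
  · exact h.1.le

/-! ### Elimination of triples -/

/-- `t` can be recognized by the coefficient of `w` in the differential among the triples whose rank
is at most that of `t`. -/
def Detects (G : GridDiagram n) (p q : Fin n) (t w : Triple n) : Prop :=
  G.boundary (gen t) w ≠ 0 ∧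
    ∀ t', t' ≠ t → tripleRank p q t' ≤ tripleRank p q t → G.boundary (gen t') w = 0

/-- `t` is congruent to triples of smaller rank modulo the differential of `u`. -/
def Reduces (G : GridDiagram n) (p q : Fin n) (t u : Triple n) : Prop :=
  G.boundary (gen u) - gen t ∈ chainsOn {s | tripleRank p q s < tripleRank p q t}

theorem detects_of_isDetectedBy (G : GridDiagram n) {p q : Fin n} {t : Triple n} {w : PosDomain n}
    (hw : IsDetectedBy p q t.dom w) (ht : ∀ j, ¬ IsBadPart (t.part j)) :
    Detects G p q t ⟨w, t.part⟩ := by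
  classical
  constructor
  · rw [boundary_gen_apply G (p := p) (q := q) hw.rank_eq.ge, if_pos rfl, hw.domOp_apply,
      Finset.sum_eq_zero, add_zero]
    · exact one_ne_zero
    · intro j _
      rw [partOp_of_not_isBadPart (ht j)]
      split_ifs <;> rfl
  · intro t' hne hle
    obtain ⟨h1, h2⟩ := tripleRank_le hle
    rw [boundary_gen_apply G (p := p) (q := q) (by rw [hw.rank_eq]; exact h1),
      Finset.sum_eq_zero, add_zero]
    · split_ifs with hpart
      · refine hw.domOp_apply_of_ne (fun hd => hne ?_) h1
        ext1
        exacts [hd, hpart.symm]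
      · rfl
    · intro j _
      split_ifs with h3
      · by_contra h0
        have h4 := partOp_apply_ne_zero h0
        have h5 := totalWeight_eq (j := j) (μ := t.part) (ν := t'.part) h3.2
        have h6 := h2 (by rw [← h3.1]; exact hw.rank_eq)
        have h7 := weight_le_one (ht j)
        have h8 := length_le_weight (t'.part j)
        have h9 : (t.part j).length ≠ 0 := fun e => by
          have : t.part j = [] := List.length_eq_zero_iff.1 e
          change _ ∧ (weight (t.part j) < _ ∨ weight (t.part j) = _ ∧ t.part j ≠ []) at h4
          rcases h4.2 with h | h
          · omega
          · exact h.2 this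
        change (t.part j).length + 1 = _ ∧
          (weight (t.part j) < _ ∨ weight (t.part j) = _ ∧ t.part j ≠ []) at h4
        omega
      · rfl

theorem reduces_of_isReducedBy (G : GridDiagram n) {p q : Fin n} {t : Triple n} {U : PosDomain n}
    (hU : IsReducedBy p q t.dom U) (ht : ∀ j, ¬ IsBadPart (t.part j)) :
    Reduces G p q t ⟨U, t.part⟩ := by
  rw [Reduces, boundary_gen, Finset.sum_eq_zero (f := fun j => setOp _ j _), add_zero,
    add_sub_right_comm]
  · refine Submodule.add_mem _ ?_ (Submodule.sum_mem _ fun j _ => ?_)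
    · have : gen t = tag t.part (Finsupp.single t.dom 1) := (tag_single _ _).symm
      rw [this, ← map_sub]
      refine lin_mem (N := chainsOn _) (fun E hE => single_mem_chainsOn ?_) hU.domOp_sub_mem
      exact tripleRank_lt_iff.2 (Or.inl hE.2)
    · exact chainsOn_mono (fun s hs => tripleRank_lt_iff.2 (Or.inl (hU.bubble_lt _ hs.1)))
        (bubbleTerms_mem G _ j)
  · intro j _
    rw [partOp_of_not_isBadPart (ht j), map_zero]

theorem consOp_mem {a : ℕ+} {S : Set (List ℕ+)} {m : ListChain} (hm : m ∈ chainsOn S) :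
    consOp a m ∈ chainsOn {l | ∃ l' ∈ S, l = a :: l'} :=
  map_mem_of_chainsOn _ (fun l hl => by
    rw [consOp_single]; exact single_mem_chainsOn ⟨l, hl, rfl⟩) hm

/-- The differential of `(1, b, …)`. -/
theorem partOp_one_cons (b : ℕ+) (m : List ℕ+) : partOp (Finsupp.single (1 :: b :: m) 1)
    = Finsupp.single (b :: m) 1 + (Finsupp.single ((1 + b) :: m) 1
      + consOp 1 (tailOp (Finsupp.single (b :: m) 1))) := by
  rw [partOp, LinearMap.add_apply, initOp_cons, tailOp_cons 1, mergeOp_cons]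

theorem one_add_ne (b : ℕ+) : b ≠ 1 + b := fun h => by
  have := congrArg PNat.val h
  rw [PNat.add_coe, PNat.one_coe] at this
  omega

theorem one_ne_one_add (b : ℕ+) : 1 ≠ 1 + b := fun h => by
  have := congrArg PNat.val h
  rw [PNat.add_coe, PNat.one_coe] at this
  have := b.pos
  omega

theorem partOp_one_cons_apply (b b' : ℕ+) (m m' : List ℕ+) :
    partOp (Finsupp.single (1 :: b' :: m') 1) ((1 + b) :: m)
      = if b' :: m' = (1 + b) :: m then 1 else if b' :: m' = b :: m then 1 else 0 := by
  have h1 : consOp 1 (tailOp (Finsupp.single (b' :: m') 1)) ((1 + b) :: m) = 0 := by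
    by_contra hne
    obtain ⟨l', -, h⟩ := consOp_mem (S := Set.univ) (fun _ _ => trivial)
      (Finsupp.mem_support_iff.2 hne)
    exact one_ne_one_add b (List.cons.inj h).1.symm
  rw [partOp_one_cons, Finsupp.add_apply, Finsupp.add_apply, h1, add_zero, Finsupp.single_apply,
    Finsupp.single_apply]
  have h2 : (1 + b') :: m' = (1 + b) :: m ↔ b' :: m' = b :: m := by
    rw [List.cons.injEq, List.cons.injEq, add_right_inj]
  simp only [h2]
  by_cases e1 : b' :: m' = (1 + b) :: m
  · rw [if_pos e1, if_pos e1, if_neg, add_zero]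
    intro e2
    exact one_add_ne b (List.cons.inj (e2.symm.trans e1)).1
  · rw [if_neg e1, if_neg e1, zero_add]

/-- Triples with a partition `(1, b, …)` are matched with those in which it is `(1 + b, …)`. -/
theorem detects_of_one_cons (G : GridDiagram n) (p q : Fin n) {t : Triple n} {j : Fin n}
    (hj : IsFirstBad t.part j) {b : ℕ+} {m : List ℕ+} (hl : t.part j = 1 :: b :: m) :
    Detects G p q t (t.setPart j ((1 + b) :: m)) := by
  classical
  have hwj : (t.setPart j ((1 + b) :: m)).part j = (1 + b) :: m := setPart_part _ _ _
  have hwk : ∀ k, k ≠ j → (t.setPart j ((1 + b) :: m)).part k = t.part k := fun k hk =>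
    Function.update_of_ne hk _ _
  have hbad : IsBadPart ((1 + b) :: m) := ⟨List.cons_ne_nil _ _, fun e =>
    one_ne_one_add b (List.cons.inj e).1.symm⟩
  have hweight : weight ((1 + b) :: m) = weight (t.part j) := by
    simp only [hl, weight_cons, PNat.add_coe, PNat.one_coe]; ring
  have hfirst : firstPart t.part = 1 := by rw [firstPart_eq hj, hl]; rfl
  have hb0 := b.pos
  set w := t.setPart j ((1 + b) :: m) with hw
  have hwfirst : IsFirstBad w.part j := by
    refine ⟨by rw [hwj]; exact hbad, fun k hk => ?_⟩
    rw [hwk k hk.ne]; exact hj.2 k hk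
  have hwd : w.dom = t.dom := rfl
  have hwt : totalWeight w.part = totalWeight t.part := by
    have := totalWeight_eq (j := j) hwk
    rw [hwj, hweight] at this
    omega
  constructor
  · rw [boundary_gen_apply G (p := p) (q := q) (t := t) (w := w) le_rfl, if_neg, zero_add, Finset.sum_eq_single j,
      if_pos ⟨rfl, hwk⟩, hwj, hl, partOp_one_cons_apply, if_neg, if_pos rfl]
    · exact one_ne_zero
    · exact fun e => one_add_ne b (List.cons.inj e).1
    · intro k _ hkj
      rw [if_neg]
      rintro ⟨-, h⟩
      have := h j (Ne.symm hkj)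
      rw [hwj, hl] at this
      exact one_ne_one_add b (List.cons.inj this).1.symm
    · exact fun h => absurd (Finset.mem_univ _) h
    · intro h
      have := congrFun h j
      rw [hwj, hl] at this
      exact one_ne_one_add b (List.cons.inj this).1.symm
  · intro t' hne hle
    obtain ⟨h1, h2⟩ := tripleRank_le hle
    rw [boundary_gen_apply G (p := p) (q := q) (w := w) h1]
    have e1 : (if w.part = t'.part then domOp (Finsupp.single t'.dom 1) w.dom else 0) = 0 := by
      split_ifs with hpart
      · by_contra h0
        have h3 := (isFacet_of_apply_ne_zero h0).domRank_le (p := p) (q := q)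
        have h4 := (h2 (le_antisymm h1 h3)).2 (by rw [← hpart, hwt])
        rw [hfirst, ← hpart, firstPart_eq hwfirst, hwj] at h4
        change ((1 + b : ℕ+) : ℕ) ≤ 1 at h4
        rw [PNat.add_coe, PNat.one_coe] at h4
        omega
      · rfl
    rw [e1, zero_add]
    refine Finset.sum_eq_zero fun k _ => ?_
    split_ifs with h3
    swap
    · rfl
    by_contra h0
    obtain ⟨h4, h5⟩ := partOp_apply_ne_zero h0
    have h6 := h2 (by rw [← h3.1, hwd])
    have h7 := totalWeight_eq h3.2
    have h8 : w.part k ≠ [] := by rcases h5 with h | h; exacts [by omega, h.2]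
    have h9 := List.length_pos_iff.2 h8
    have h10 : IsBadPart (t'.part k) := isBadPart_of_length (by omega)
    have h11 := h6.2 (by omega)
    rw [hfirst] at h11
    by_cases hkj : k = j
    · subst hkj
      have hf : IsFirstBad t'.part k := ⟨h10, fun i hi => by
        rw [← h3.2 i hi.ne]; exact hwfirst.2 i hi⟩
      rw [firstPart_eq hf] at h11
      obtain ⟨a, l, hal⟩ := List.exists_cons_of_ne_nil h10.1
      rw [hal] at h11 h4 h0
      change (a : ℕ) ≤ 1 at h11
      have ha : a = 1 := PNat.eq (le_antisymm h11 a.pos)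
      rw [List.length_cons] at h4
      obtain ⟨b', m', rfl⟩ := List.exists_cons_of_ne_nil (List.length_pos_iff.1 (by omega : 0 < l.length))
      rw [ha, hwj, partOp_one_cons_apply] at h0
      by_cases e2 : b' :: m' = (1 + b) :: m
      · rw [hal, ha, e2, weight_cons, hwj] at h7
        rw [PNat.one_coe] at h7
        omega
      · rw [if_neg e2] at h0
        by_cases e3 : b' :: m' = b :: m
        · apply hne
          ext1
          · exact h3.1.symm
          · funext i
            by_cases hi : i = k
            · rw [hi, hal, hl, ha, e3]
            · rw [← h3.2 i hi, hwk i hi]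
        · rw [if_neg e3] at h0
          exact h0 rfl
    · have hjp : t'.part j = (1 + b) :: m := by rw [← h3.2 j (Ne.symm hkj), hwj]
      have hf : IsFirstBad t'.part j := by
        refine ⟨by rw [hjp]; exact hbad, fun i hi hib => ?_⟩
        by_cases hik : i = k
        · have h12 := weight_le_one (hj.2 i hi)
          rw [← hwk i hi.ne] at h12
          have h13 := length_le_weight (t'.part k)
          rw [hik] at h12
          omega
        · rw [← h3.2 i hik] at hib
          exact hwfirst.2 i hi hib
      rw [firstPart_eq hf, hjp] at h11
      change ((1 + b : ℕ+) : ℕ) ≤ 1 at h11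
      rw [PNat.add_coe, PNat.one_coe] at h11
      omega

/-- Triples with a partition `(1 + b, …)` are matched with those in which it is `(1, b, …)`. -/
theorem reduces_of_one_add_cons (G : GridDiagram n) (p q : Fin n) {t : Triple n} {j : Fin n}
    (hj : IsFirstBad t.part j) {b : ℕ+} {m : List ℕ+} (hl : t.part j = (1 + b) :: m) :
    Reduces G p q t (t.setPart j (1 :: b :: m)) := by
  classical
  have huj : (t.setPart j (1 :: b :: m)).part j = 1 :: b :: m := setPart_part _ _ _
  have huk : ∀ k, k ≠ j → (t.setPart j (1 :: b :: m)).part k = t.part k := fun k hk =>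
    Function.update_of_ne hk _ _
  have hb0 := b.pos
  have hweight : weight (1 :: b :: m) = weight (t.part j) := by
    simp only [hl, weight_cons, PNat.add_coe, PNat.one_coe]; ring
  have hfirst : firstPart t.part = 1 + b := by
    rw [firstPart_eq hj, hl]
    change ((1 + b : ℕ+) : ℕ) = _
    rw [PNat.add_coe, PNat.one_coe]
  set u := t.setPart j (1 :: b :: m) with hu
  have hud : u.dom = t.dom := rfl
  have hut : totalWeight u.part = totalWeight t.part := by
    have := totalWeight_eq (j := j) huk
    rw [huj, hweight] at this
    omega
  -- families whose first bad partition is `(1, …)`, at the index `j`, have smaller rank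
  have hlow : ∀ s : Triple n, domRank p q s.dom ≤ domRank p q t.dom →
      totalWeight s.part ≤ totalWeight t.part → (∀ k, k < j → s.part k = t.part k) →
      (∃ l, l ≠ [] ∧ s.part j = 1 :: l) → tripleRank p q s < tripleRank p q t := by
    rintro s h1 h2 h3 ⟨l, hl0, hl1⟩
    have hf : IsFirstBad s.part j := by
      refine ⟨?_, fun k hk => by rw [h3 k hk]; exact hj.2 k hk⟩
      rw [hl1]
      exact ⟨List.cons_ne_nil _ _, fun e => hl0 (List.cons.inj e).2⟩
    refine tripleRank_lt h1 (Or.inr ⟨h2, ?_⟩)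
    rw [firstPart_eq hf, hl1, hfirst]
    change 1 < 1 + (b : ℕ)
    omega
  rw [Reduces, boundary_gen, ← Finset.add_sum_erase _ (fun k => setOp u k _) (Finset.mem_univ j),
    huj, partOp_one_cons]
  have hsplit : setOp u j (Finsupp.single (b :: m) 1 + (Finsupp.single ((1 + b) :: m) 1
      + consOp 1 (tailOp (Finsupp.single (b :: m) 1)))) = gen t
      + (setOp u j (Finsupp.single (b :: m) 1)
      + setOp u j (consOp 1 (tailOp (Finsupp.single (b :: m) 1)))) := by
    have : gen t = setOp u j (Finsupp.single ((1 + b) :: m) 1) := by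
      rw [setOp_single, hu, setPart_setPart, ← hl]
      congr 1
      ext1
      · rfl
      · exact (Function.update_eq_self _ _).symm
    rw [this, map_add, map_add]
    abel
  rw [hsplit, show ∀ a b c d e : Chain n, a + b + (c + d + e) - c = a + b + (d + e) from
    fun a b c d e => by abel]
  refine Submodule.add_mem _ (Submodule.add_mem _ ?_ (Submodule.sum_mem _ fun k _ => ?_))
    (Submodule.add_mem _ (Submodule.add_mem _ ?_ ?_) (Submodule.sum_mem _ fun k hk => ?_))
  · refine lin_mem (N := chainsOn _) (fun E hE => single_mem_chainsOn ?_) (domOp_mem u.dom)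
    exact hlow _ (IsFacet.domRank_le hE) hut.le (fun k hk => huk k hk.ne) ⟨_, List.cons_ne_nil _ _, huj⟩
  · exact chainsOn_mono (fun s hs => tripleRank_lt_iff.2 (Or.inl hs.1.domRank_lt))
      (bubbleTerms_mem G u k)
  · rw [setOp_single]
    refine single_mem_chainsOn (tripleRank_lt le_rfl (Or.inl ?_))
    have h1 := totalWeight_eq (j := j) (μ := (u.setPart j (b :: m)).part) (ν := u.part)
      fun k hk => Function.update_of_ne hk _ _
    rw [setPart_part u, huj, weight_cons 1, PNat.one_coe] at h1
    omega
  · refine lin_mem (N := chainsOn _) (fun l hl => single_mem_chainsOn ?_)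
      (consOp_mem (tailOp_mem (b :: m)))
    obtain ⟨l', ⟨-, hl'⟩, rfl⟩ := hl
    have h1 := totalWeight_eq (j := j) (μ := (u.setPart j (1 :: l')).part) (ν := u.part)
      fun k hk => Function.update_of_ne hk _ _
    rw [setPart_part u, huj, weight_cons 1, weight_cons 1] at h1
    rcases hl' with h2 | h2
    · exact tripleRank_lt le_rfl (Or.inl (by omega))
    · refine hlow _ le_rfl (by omega) (fun k hk => ?_) ⟨l', h2.2, setPart_part _ _ _⟩
      exact (Function.update_of_ne hk.ne _ _).trans (huk k hk.ne)
  · have hkj := Finset.ne_of_mem_erase hk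
    by_cases hbk : IsBadPart (u.part k)
    · refine lin_mem (N := chainsOn _) (fun l hl => single_mem_chainsOn ?_) (partOp_mem _)
      have h1 := totalWeight_eq (j := k) (μ := (u.setPart k l).part) (ν := u.part)
        fun i hi => Function.update_of_ne hi _ _
      rw [setPart_part] at h1
      have h2 : weight l ≤ weight (u.part k) := by rcases hl.2 with h | h <;> omega
      have hnlt : ¬ k < j := fun h => hj.2 k h (by rw [← huk k hkj]; exact hbk)
      refine hlow _ le_rfl (by omega) (fun i hi => ?_) ⟨b :: m, List.cons_ne_nil _ _, ?_⟩
      · exact (Function.update_of_ne (fun e : i = k => hnlt (e ▸ hi)) _ _).trans (huk i hi.ne)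
      · exact (Function.update_of_ne (Ne.symm hkj) _ _).trans huj
    · rw [partOp_of_not_isBadPart hbk, map_zero]
      exact Submodule.zero_mem _

/-! ### Two-dimensional cycles -/

theorem eq_zero_of_chainsOn {X : Type*} {S : Set X} {z : X →₀ ZMod 2} (hz : z ∈ chainsOn S)
    (h : ∀ x, x ∉ S) : z = 0 := by
  by_contra hne
  obtain ⟨x, hx⟩ := Finsupp.support_nonempty_iff.2 hne
  exact h x (hz hx)

theorem domOp_eq_zero {D : PosDomain n} (h : D.maslov < 1) : domOp (Finsupp.single D 1) = 0 :=
  eq_zero_of_chainsOn (domOp_mem D) fun E hE => by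
    have h1 := IsFacet.maslov_eq hE
    have h2 := maslov_nonneg E
    linarith

theorem bubbleOp_eq_zero (G : GridDiagram n) (j : Fin n) {z : DChain n}
    (hz : z ∈ chainsOn {D | D.maslov < 2}) : G.bubbleOp j z = 0 := by
  rw [← Submodule.mem_bot (ZMod 2)]
  refine map_mem_of_chainsOn _ (fun D hD => ?_) hz
  rw [Submodule.mem_bot]
  refine eq_zero_of_chainsOn (bubbleOp_mem G j D) fun E hE => ?_
  have h1 := IsBubble.maslov_eq hE
  have h2 := maslov_nonneg E
  have h3 : D.maslov < 2 := hD
  linarith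

theorem boundary_tag (G : GridDiagram n) {μ : Fin n → List ℕ+} (hμ : ∀ j, ¬ IsBadPart (μ j))
    (z : DChain n) : G.boundary (tag μ z) = tag μ (domOp z)
      + ∑ j, partLift j enlargeOp (tag μ (G.bubbleOp j z)) := by
  have : G.boundary ∘ₗ tag μ = tag μ ∘ₗ domOp
      + ∑ j, partLift j enlargeOp ∘ₗ tag μ ∘ₗ G.bubbleOp j := linearMap_ext_single fun D => by
    rw [LinearMap.comp_apply, tag_single, boundary_gen, LinearMap.add_apply, LinearMap.sum_apply,
      Finset.sum_eq_zero (f := fun j => setOp _ j _), add_zero]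
    · rfl
    · intro j _
      rw [partOp_of_not_isBadPart (hμ j), map_zero]
  have := LinearMap.congr_fun this z
  rw [LinearMap.comp_apply, LinearMap.add_apply, LinearMap.sum_apply] at this
  exact this

theorem boundary_tag_of_maslov_lt (G : GridDiagram n) {μ : Fin n → List ℕ+}
    (hμ : ∀ j, ¬ IsBadPart (μ j)) {z : DChain n} (hz : z ∈ chainsOn {D | D.maslov < 2}) :
    G.boundary (tag μ z) = tag μ (domOp z) := by
  rw [boundary_tag G hμ, Finset.sum_eq_zero, add_zero]
  intro j _
  rw [bubbleOp_eq_zero G j hz, map_zero, map_zero]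

open Classical in
theorem emptyPart_gen (t : Triple n) :
    emptyPart (gen t) = if t.part = (fun _ => []) then Finsupp.single t.dom 1 else 0 :=
  lin_single _ _

theorem not_isBadPart_nil : ¬ IsBadPart [] := fun h => h.1 rfl

theorem not_isBadPart_one : ¬ IsBadPart [1] := fun h => h.2 rfl

theorem not_isBadPart_bubblePair (j k i : Fin n) : ¬ IsBadPart ((bubblePair j k).part i) := by
  simp only [bubblePair]
  split_ifs
  exacts [not_isBadPart_one, not_isBadPart_nil]

theorem boundary_bubblePair (G : GridDiagram n) (j k : Fin n) :
    G.boundary (gen (bubblePair j k)) = 0 := by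
  have h : gen (bubblePair j k)
      = tag (bubblePair j k).part (Finsupp.single (constDomain 1) 1) := (tag_single _ _).symm
  have h0 := maslov_constDomain (1 : Generator n)
  rw [h, boundary_tag_of_maslov_lt G (not_isBadPart_bubblePair j k)
    (single_mem_chainsOn (by change (constDomain 1).maslov < 2; rw [h0]; norm_num)),
    domOp_eq_zero (by rw [h0]; norm_num), map_zero]

theorem emptyPart_bubblePair (j k : Fin n) : emptyPart (gen (bubblePair j k)) = 0 := by
  rw [emptyPart_gen, if_neg]
  intro h
  have := congrFun h j
  simp [bubblePair] at this

theorem part_eq_nil_of_totalLength {μ : Fin n → List ℕ+} (h : totalLength μ = 0) :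
    μ = fun _ => [] := by
  funext j
  rw [totalLength, Finset.sum_eq_zero_iff] at h
  exact List.length_eq_zero_iff.1 (h j (Finset.mem_univ j))

theorem exists_bubblePair {μ : Fin n → List ℕ+} (hμ : ∀ j, ¬ IsBadPart (μ j))
    (h : totalLength μ = 2) : ∃ j k, j < k ∧ μ = (bubblePair j k).part := by
  have h1 : ∀ j, (μ j).length = if μ j ≠ [] then 1 else 0 := fun j => by
    by_cases h0 : μ j = []
    · rw [if_neg (not_not.2 h0), h0]; rfl
    · have : μ j = [1] := by
        by_contra h2
        exact hμ j ⟨h0, h2⟩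
      rw [if_pos h0, this]; rfl
  rw [totalLength, Finset.sum_congr rfl fun j _ => h1 j, ← Finset.card_filter,
    Finset.card_eq_two] at h
  obtain ⟨j, k, hjk, hs⟩ := h
  have h2 : ∀ i, μ i = if i = j ∨ i = k then [1] else [] := fun i => by
    have h3 : i ∈ ({i | μ i ≠ []} : Finset (Fin n)) ↔ i = j ∨ i = k := by rw [hs]; simp
    rw [Finset.mem_filter] at h3
    split_ifs with h4
    · by_contra h5
      exact hμ i ⟨(h3.2 h4).2, h5⟩
    · by_contra h5
      exact h4 (h3.1 ⟨Finset.mem_univ i, h5⟩)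
  rcases lt_or_gt_of_ne hjk with hlt | hlt
  · exact ⟨j, k, hlt, funext h2⟩
  · refine ⟨k, j, hlt, funext fun i => ?_⟩
    rw [h2, bubblePair]
    simp only [or_comm]

/-- The span of the boundaries of the three-dimensional triples in `S` and of the triples with
constant domain `c_Id` and two partitions of `1`. -/
def bubbleBoundaries (G : GridDiagram n) (S : Set (Triple n)) : Submodule (ZMod 2) (Chain n) :=
  (chainsOn {t | t ∈ S ∧ t.HasDegree 3}).map G.boundary ⊔
    Submodule.span (ZMod 2) {c | ∃ j k, j < k ∧ c = gen (bubblePair j k)}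

/-- A two-dimensional cycle which contains an even number of copies of the horizontal and of the
vertical annulus through the corner square is a boundary up to triples with constant domain `c_Id`. -/
theorem cycle_mem_bubbleBoundaries (hn : 2 ≤ n) (G : GridDiagram n) {S : Set (Triple n)}
    (hS : ∀ s t : Triple n, t ∈ S →
      s.dom.coeff (G.Ocol 0) (G.Orow 0) ≤ t.dom.coeff (G.Ocol 0) (G.Orow 0) → s ∈ S)
    {Z : Chain n} (hZ : Z ∈ chainsOn {t | t ∈ S ∧ t.HasDegree 2}) (h0 : G.boundary Z = 0)
    (hH : annulusCount (rowCoeff (G.Orow 0)) (emptyPart Z) = 0)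
    (hV : annulusCount (colCoeff (G.Ocol 0)) (emptyPart Z) = 0) : Z ∈ bubbleBoundaries G S := by
  classical
  set p := G.Ocol 0
  set q := G.Orow 0
  -- among the annuli of the same shape, the one at the diagonal generator has the smallest rank
  have hann : ∀ (a : Fin n → Fin n → ℕ) (ha : IsAnnulusCoeff a) (hp : IsPeriodic a)
      (t : Triple n), t.HasDegree 2 → t.dom = annulus a hp (diagonal p q) →
      (annulusCount a ∘ₗ emptyPart) (Finsupp.single t 1) ≠ 0 ∧
      ∀ t' : Triple n, t' ≠ t → tripleRank p q t' ≤ tripleRank p q t →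
        (annulusCount a ∘ₗ emptyPart) (Finsupp.single t' 1) = 0 := by
    intro a ha hp t ht hd
    have hpart : t.part = fun _ => [] := by
      rw [hasDegree_iff, hd, maslov_annulus ha] at ht
      refine part_eq_nil_of_totalLength ?_
      have : (totalLength t.part : ℚ) = 0 := by push_cast at ht; linarith
      exact_mod_cast this
    constructor
    · rw [LinearMap.comp_apply]
      change annulusCount a (emptyPart (gen t)) ≠ 0
      rw [emptyPart_gen, if_pos hpart, annulusCount, lin_single, hd, if_pos ⟨rfl, rfl⟩]
      exact one_ne_zero
    · intro t' hne hle
      rw [LinearMap.comp_apply]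
      change annulusCount a (emptyPart (gen t')) = 0
      rw [emptyPart_gen]
      split_ifs with hpart'
      · rw [annulusCount, lin_single]
        split_ifs with h'
        · exfalso
          have h1 := (tripleRank_le hle).1
          have hxy : t'.dom = annulus a hp t'.dom.y := by
            ext1
            exacts [h'.1, rfl, h'.2]
          have h2 : potential p q t'.dom.y ≠ 0 := fun h2 => by
            rw [potential_eq_zero] at h2
            apply hne
            ext1
            · rw [hxy, hd, h2]
            · rw [hpart, hpart']
          refine absurd h1 (not_le.2 ?_)
          rw [domRank_lt_iff]
          have h3 : potential p q t.dom.y = 0 := by rw [potential_eq_zero, hd]; rfl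
          have h4 : t.dom.coeff = t'.dom.coeff := by rw [h'.2, hd]; rfl
          rw [h4, h3]
          exact Or.inr ⟨rfl, Or.inr ⟨rfl, Or.inl (by omega)⟩⟩
        · rfl
      · rw [map_zero]
  refine mem_of_triangular (tripleRank p q) {t | t ∈ S ∧ t.HasDegree 2} _
    ({ψ | ∃ w, ψ = Finsupp.lapply w ∘ₗ G.boundary} ∪
      {annulusCount (rowCoeff q) ∘ₗ emptyPart, annulusCount (colCoeff p) ∘ₗ emptyPart})
    ?_ ?_ Z hZ ?_
  · intro ψ hψ t ht
    suffices h : bubbleBoundaries G S ≤ LinearMap.ker ψ from h ht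
    refine sup_le ?_ (Submodule.span_le.2 ?_)
    · rintro _ ⟨z, -, rfl⟩
      rw [LinearMap.mem_ker]
      rcases hψ with ⟨w, rfl⟩ | rfl | rfl
      · rw [LinearMap.comp_apply, G.boundary_boundary hn, map_zero]
      · rw [LinearMap.comp_apply, emptyPart_boundary, annulusCount_domOp]
      · rw [LinearMap.comp_apply, emptyPart_boundary, annulusCount_domOp]
    · rintro _ ⟨j, k, -, rfl⟩
      rw [SetLike.mem_coe, LinearMap.mem_ker]
      rcases hψ with ⟨w, rfl⟩ | rfl | rfl
      · rw [LinearMap.comp_apply, boundary_bubblePair, map_zero]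
      · rw [LinearMap.comp_apply, emptyPart_bubblePair, map_zero]
      · rw [LinearMap.comp_apply, emptyPart_bubblePair, map_zero]
  · rintro t ⟨htS, ht⟩
    have hdet : ∀ w, Detects G p q t w → ∃ ψ ∈ ({ψ | ∃ w, ψ = Finsupp.lapply w ∘ₗ G.boundary} ∪
        {annulusCount (rowCoeff q) ∘ₗ emptyPart, annulusCount (colCoeff p) ∘ₗ emptyPart} :
          Set (Chain n →ₗ[ZMod 2] ZMod 2)), ψ (Finsupp.single t 1) ≠ 0 ∧
        ∀ y ∈ {t | t ∈ S ∧ t.HasDegree 2}, y ≠ t → tripleRank p q y ≤ tripleRank p q t →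
          ψ (Finsupp.single y 1) = 0 := fun w hw =>
      ⟨_, Or.inl ⟨w, rfl⟩, hw.1, fun y _ hne hle => hw.2 y hne hle⟩
    have hred : ∀ u : Triple n, Reduces G p q t u → u.HasDegree 3 →
        u.dom.coeff p q ≤ t.dom.coeff p q → ∃ c ∈ bubbleBoundaries G S,
          c - Finsupp.single t 1 ∈ chainsOn {y | y ∈ {t | t ∈ S ∧ t.HasDegree 2} ∧
            tripleRank p q y < tripleRank p q t} := by
      intro u hu hu3 hc
      refine ⟨G.boundary (gen u), Submodule.mem_sup_left
        (Submodule.mem_map_of_mem (single_mem_chainsOn ⟨hS u t htS hc, hu3⟩)), ?_⟩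
      have h1 : G.boundary (gen u) - gen t ∈ chainsOn {t | t ∈ S ∧ t.HasDegree 2} :=
        Submodule.sub_mem _ (chainsOn_mono (fun s hs => by exact ⟨hS s t htS ((hs.2 p q).trans hc), hs.1⟩)
          (boundary_gen_mem G (k := 2) hu3)) (single_mem_chainsOn ⟨htS, ht⟩)
      exact fun y hy => ⟨h1 hy, hu hy⟩
    have ht' := ht
    rw [hasDegree_iff] at ht'
    by_cases hbad : ∃ j, IsBadPart (t.part j)
    · obtain ⟨j, hj⟩ := hbad
      obtain ⟨j, hj⟩ := exists_isFirstBad hj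
      obtain ⟨a, l, hl⟩ := List.exists_cons_of_ne_nil hj.1.1
      by_cases ha : a = 1
      · obtain ⟨b, m, rfl⟩ := List.exists_cons_of_ne_nil (l := l) fun e =>
          hj.1.2 (by rw [hl, ha, e])
        rw [ha] at hl
        exact Or.inr (hdet _ (detects_of_one_cons G p q hj hl))
      · obtain ⟨b, rfl⟩ := PNat.exists_eq_succ_of_ne_one ha
        rw [add_comm] at hl
        refine Or.inl (hred _ (reduces_of_one_add_cons G p q hj hl) ?_ le_rfl)
        rw [hasDegree_iff]
        have h1 := totalLength_update t.part j (1 :: b :: l)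
        rw [hl] at h1
        simp only [List.length_cons] at h1
        have h2 : totalLength (Function.update t.part j (1 :: b :: l)) = totalLength t.part + 1 := by
          omega
        change t.dom.maslov + (totalLength (Function.update t.part j (1 :: b :: l)) : ℚ) = _
        rw [h2]
        push_cast at ht' ⊢
        linarith
    · push Not at hbad
      have hnn : (0 : ℚ) ≤ totalLength t.part := Nat.cast_nonneg _
      push_cast at ht'
      rcases domain_cases hn p q (D := t.dom) (by linarith) with
        ⟨w, hw⟩ | ⟨U, hU⟩ | h | h | h
      · exact Or.inr (hdet _ (detects_of_isDetectedBy G hw hbad))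
      · refine Or.inl (hred _ (reduces_of_isReducedBy G hU hbad) ?_ hU.corner_eq.le)
        rw [hasDegree_iff]
        have := hU.facet.maslov_eq
        push_cast
        change U.maslov + (totalLength t.part : ℚ) = 3
        linarith
      · left
        refine ⟨gen t, ?_, by rw [gen, sub_self]; exact Submodule.zero_mem _⟩
        have hlen : totalLength t.part = 2 := by
          rw [h, maslov_constDomain] at ht'
          have : (totalLength t.part : ℚ) = 2 := by linarith
          exact_mod_cast this
        obtain ⟨j, k, hjk, hpart⟩ := exists_bubblePair hbad hlen
        obtain ⟨z, hz, hz'⟩ := const_add_const_mem hn p q (diagonal p q) 1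
        have h1 : G.boundary (tag t.part z) = gen t + gen (bubblePair j k) := by
          rw [boundary_tag_of_maslov_lt G hbad (chainsOn_mono (fun D hD => ?_) hz), hz', map_add,
            tag_single, tag_single, ← h, hpart]
          · congr 1
            · rw [← hpart]
          · change D.maslov < 2
            rw [hD.1]; norm_num
        have h2 : gen t = G.boundary (tag t.part z) + gen (bubblePair j k) := by
          rw [h1, add_assoc, add_self_zmod_two, add_zero]
        rw [h2]
        refine Submodule.add_mem _ (Submodule.mem_sup_left (Submodule.mem_map_of_mem ?_))
          (Submodule.mem_sup_right (Submodule.subset_span ⟨j, k, hjk, rfl⟩))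
        refine lin_mem (N := chainsOn _) (fun D hD => single_mem_chainsOn ?_) hz
        refine ⟨?_, ?_⟩
        · refine hS _ t htS ?_
          change D.coeff p q ≤ _
          rw [hD.2]; exact Nat.zero_le _
        · rw [hasDegree_iff]
          change D.maslov + (totalLength t.part : ℚ) = _
          rw [hD.1, hlen]; norm_num
      · obtain ⟨h1, h2⟩ := hann _ (Or.inr ⟨q, rfl⟩) _ t ht h
        exact Or.inr ⟨_, Or.inr (Or.inl rfl), h1, fun y _ hne hle => h2 y hne hle⟩
      · obtain ⟨h1, h2⟩ := hann _ (Or.inl ⟨p, rfl⟩) _ t ht h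
        exact Or.inr ⟨_, Or.inr (Or.inr rfl), h1, fun y _ hne hle => h2 y hne hle⟩
  · rintro ψ (⟨w, rfl⟩ | rfl | rfl)
    · rw [LinearMap.comp_apply, h0, map_zero]
    · exact hH
    · exact hV

/-! ### Existence of the cycles -/

theorem emptyPart_annulusCount (a : Fin n → Fin n → ℕ) (hp : IsPeriodic a) (U : Chain n) :
    ∑ x, U (annulusTriple a hp x) = annulusCount a (emptyPart U) := by
  classical
  have : (∑ x, Finsupp.lapply (annulusTriple a hp x) : Chain n →ₗ[ZMod 2] ZMod 2)
      = annulusCount a ∘ₗ emptyPart := linearMap_ext_single fun t => by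
    rw [LinearMap.comp_apply, LinearMap.sum_apply]
    change _ = annulusCount a (emptyPart (gen t))
    rw [emptyPart_gen]
    simp only [Finsupp.lapply_apply, Finsupp.single_apply]
    by_cases h : t.part = fun _ => []
    · rw [if_pos h, annulusCount, lin_single]
      by_cases h' : t.dom.x = t.dom.y ∧ t.dom.coeff = a
      · rw [if_pos h', Finset.sum_eq_single t.dom.y, if_pos]
        · ext1
          · ext1
            exacts [h'.1, rfl, h'.2]
          · exact h
        · intro x _ hx
          rw [if_neg]
          intro e
          exact hx (by rw [e]; rfl)
        · exact fun hx => absurd (Finset.mem_univ _) hx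
      · rw [if_neg h']
        refine Finset.sum_eq_zero fun x _ => if_neg fun e => h' ?_
        rw [e]
        exact ⟨rfl, rfl⟩
    · rw [if_neg h, map_zero]
      refine Finset.sum_eq_zero fun x _ => if_neg fun e => h ?_
      rw [e]; rfl
  have := LinearMap.congr_fun this U
  rw [LinearMap.sum_apply] at this
  exact this

theorem annulusCount_zero_annulusOp {a : Fin n → Fin n → ℕ} (hp : IsPeriodic a) (z : DChain n) :
    annulusCount 0 (annulusOp a hp z) = annulusCount a z := by
  classical
  have : annulusCount 0 ∘ₗ annulusOp a hp = annulusCount a := linearMap_ext_single fun D => by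
    rw [LinearMap.comp_apply]
    by_cases h : a ≤ D.coeff
    · rw [annulusOp_pos hp D h, annulusCount, annulusCount, lin_single, lin_single]
      refine if_congr (and_congr Iff.rfl ⟨fun e => ?_, fun e => ?_⟩) rfl rfl
      · funext c r
        have h1 : D.coeff c r - a c r = 0 := congrFun (congrFun e c) r
        have h2 : a c r ≤ D.coeff c r := h c r
        omega
      · funext c r
        change D.coeff c r - a c r = 0
        rw [e, Nat.sub_self]
    · rw [annulusOp_neg hp D h, map_zero, annulusCount, lin_single, if_neg]
      exact fun h' => h h'.2.ge
  exact LinearMap.congr_fun this z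

theorem annulusCount_zero_bubbleOp (G : GridDiagram n) (j : Fin n) (z : DChain n) :
    annulusCount 0 (G.bubbleOp j z)
      = annulusCount (colCoeff (G.Ocol j)) z + annulusCount (rowCoeff (G.Orow j)) z := by
  rw [GridDiagram.bubbleOp, LinearMap.add_apply, map_add, annulusCount_zero_annulusOp,
    annulusCount_zero_annulusOp, add_comm]
  rfl

theorem annulusCount_eq_zero {p q : Fin n} {k : ℕ} {a : Fin n → Fin n → ℕ} (ha : a p q ≠ 0)
    {z : DChain n} (hz : z ∈ chainsOn (cornerFree p q k)) : annulusCount a z = 0 := by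
  classical
  rw [← Submodule.mem_bot (ZMod 2)]
  refine map_mem_of_chainsOn _ (fun D hD => ?_) hz
  rw [Submodule.mem_bot, annulusCount, lin_single, if_neg]
  intro h
  exact ha (by rw [← h.2]; exact hD.2)

theorem annulusCount_annulus (a b : Fin n → Fin n → ℕ) (hb : IsPeriodic b) (x : Generator n) :
    annulusCount a (Finsupp.single (annulus b hb x) 1) = if b = a then 1 else 0 := by
  classical
  rw [annulusCount, lin_single]
  refine if_congr ⟨fun h => h.2, fun h => ⟨rfl, h⟩⟩ rfl rfl

/-- The two annuli through the corner can be completed to a cycle by domains away from the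
corner. -/
theorem exists_domain_cycle (hn : 2 ≤ n) (p q : Fin n) : ∃ z : DChain n,
    z ∈ chainsOn {D | D.maslov = 2} ∧ domOp z = 0 ∧ annulusCount (colCoeff p) z = 1 := by
  have hdiff : ∀ s : Fin n ⊕ Fin n, stripPair s (diagonal p q) = (p, p + 1) →
      stripCoeff s p q = 1 → domOp (Finsupp.single
        (annulus (stripCoeff s) (stripCoeff_periodic s) (diagonal p q)) 1)
        + Finsupp.single (cornerSquare hn p q) 1 ∈ chainsOn (cornerFree p q 1) := by
    classical
    intro s hs hc E hE
    obtain ⟨h1, h2⟩ := isFacet_annulus_corner hn hs hc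
    have h3 := Finsupp.mem_support_iff.1 hE
    rw [Finsupp.add_apply, domOp_apply_eq, Finsupp.single_apply] at h3
    by_cases hES : cornerSquare hn p q = E
    · rw [if_pos hES, if_pos (hES ▸ h1), add_self_zmod_two] at h3
      exact absurd rfl h3
    · rw [if_neg hES, add_zero] at h3
      have hf := by_contra fun hf => h3 (if_neg hf)
      have h4 := hf.maslov_eq
      rw [maslov_annulus (stripCoeff_isAnnulusCoeff s)] at h4
      exact ⟨by push_cast; linarith, h2 E hf (Ne.symm hES)⟩
  have hr := hdiff (.inr q) (stripPair_diagonal_inr p q) (if_pos rfl)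
  have hc := hdiff (.inl p) rfl (if_pos rfl)
  set A : DChain n := Finsupp.single (annulus _ (stripCoeff_periodic (.inr q)) (diagonal p q)) 1
  set B : DChain n := Finsupp.single (annulus _ (stripCoeff_periodic (.inl p)) (diagonal p q)) 1
  have hAB : domOp (A + B) ∈ chainsOn (cornerFree p q 1) := by
    have h1 := Submodule.add_mem _ hr hc
    rw [add_add_add_comm, add_self_zmod_two, add_zero, ← map_add] at h1
    exact h1
  obtain ⟨w, hw, hw'⟩ := degree_one_mem hn p q hAB (domOp_domOp hn _)
  refine ⟨A + B + w, ?_, ?_, ?_⟩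
  · refine Submodule.add_mem _ (Submodule.add_mem _ (single_mem_chainsOn ?_)
      (single_mem_chainsOn ?_)) (chainsOn_mono (fun D hD => ?_) hw)
    · exact maslov_annulus (stripCoeff_isAnnulusCoeff _) _ _
    · exact maslov_annulus (stripCoeff_isAnnulusCoeff _) _ _
    · change D.maslov = 2
      rw [hD.1]; norm_num
  · rw [map_add, hw', add_self_zmod_two]
  · rw [map_add, map_add, annulusCount_eq_zero (p := p) (q := q) (by simp [colCoeff]) hw, add_zero,
      annulusCount_annulus, annulusCount_annulus, if_neg, zero_add]
    · exact if_pos rfl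
    intro h
    have := congrFun (congrFun h p) (q + 1)
    simp [stripCoeff, colCoeff, rowCoeff, (succ_ne hn q).symm] at this

theorem partLift_enlargeOp_tag (j : Fin n) (z : DChain n) :
    partLift j enlargeOp (tag (fun _ => []) z) = tag (Function.update (fun _ => []) j [1]) z := by
  have : partLift j enlargeOp ∘ₗ tag (fun _ => []) = tag (Function.update (fun _ => []) j [1]) :=
    linearMap_ext_single fun D => by
      rw [LinearMap.comp_apply, tag_single, tag_single, partLift_gen, enlargeOp_nil, setOp_single]
      rfl
  exact LinearMap.congr_fun this z

theorem not_isBadPart_update (j k : Fin n) :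
    ¬ IsBadPart ((Function.update (fun _ => []) j [1] : Fin n → List ℕ+) k) := by
  by_cases h : k = j
  · rw [h, Function.update_self]; exact not_isBadPart_one
  · rw [Function.update_of_ne h]; exact not_isBadPart_nil

/-- Removing `H_j` and `V_j` from the cycle of `exists_domain_cycle` leaves an even number of
constant domains, which bound; rectangles with a part `1` compensate for these terms. -/
theorem exists_isUPrime (hn : 2 ≤ n) (G : GridDiagram n) : ∃ U, G.IsUPrime U := by
  classical
  obtain ⟨z, hz, hz0, hz1⟩ := exists_domain_cycle hn (G.Ocol 0) (G.Orow 0)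
  have hsum : ∀ c r, annulusCount (colCoeff c) z + annulusCount (rowCoeff r) z = 0 := fun c r => by
    rw [← squareCount_domOp hn, hz0, map_zero]
  have hrow : ∀ r, annulusCount (rowCoeff r) z = 1 := fun r => by
    have h1 := hsum (G.Ocol 0) r
    rw [hz1] at h1
    refine zmod_two_eq_one fun h2 => ?_
    rw [h2, add_zero] at h1
    exact one_ne_zero h1
  have hcol : ∀ c, annulusCount (colCoeff c) z = 1 := fun c => by
    have h1 := hsum c 0
    rw [hrow] at h1
    refine zmod_two_eq_one fun h2 => ?_
    rw [h2, zero_add] at h1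
    exact one_ne_zero h1
  have hw : ∀ j, ∃ w ∈ chainsOn (cornerFree (G.Ocol 0) (G.Orow 0) 1),
      domOp w = G.bubbleOp j z := fun j => by
    refine degree_zero_mem hn (G.Ocol 0) (G.Orow 0) ?_ ?_
    · refine map_mem_of_chainsOn _ (fun D hD => chainsOn_mono (fun E hE => ?_)
        (bubbleOp_mem G j D)) hz
      have h1 := IsBubble.maslov_eq hE
      have h2 : D.maslov = 2 := hD
      change E.maslov = 0
      linarith
    · rw [annulusCount_zero_bubbleOp, hsum]
  choose w hw hw' using hw
  set e : Fin n → Fin n → List ℕ+ := fun j => Function.update (fun _ => []) j [1] with he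
  have hempty : emptyPart (tag (fun _ => []) z + ∑ j, tag (e j) (w j)) = z := by
    rw [map_add, map_sum, emptyPart_tag, if_pos rfl, Finset.sum_eq_zero, add_zero]
    intro j _
    rw [emptyPart_tag, if_neg]
    intro h
    have := congrFun h j
    simp [he] at this
  refine ⟨tag (fun _ => []) z + ∑ j, tag (e j) (w j), ?_, ?_, fun j => ?_, fun j => ?_⟩
  · rw [map_add, map_sum, boundary_tag G (fun _ => not_isBadPart_nil), hz0, map_zero, zero_add,
      ← Finset.sum_add_distrib]
    refine Finset.sum_eq_zero fun j _ => ?_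
    rw [partLift_enlargeOp_tag, boundary_tag_of_maslov_lt G (not_isBadPart_update j)
      (chainsOn_mono (fun D hD => ?_) (hw j)), hw', add_self_zmod_two]
    change D.maslov < 2
    rw [hD.1]; norm_num
  · have hmem : tag (fun _ => []) z + ∑ j, tag (e j) (w j) ∈
        chainsOn {t : Triple n | t.HasDegree 2 ∧ t.dom.maslov ≠ 0} := by
      refine Submodule.add_mem _ ?_ (Submodule.sum_mem _ fun j _ => ?_)
      · refine lin_mem (N := chainsOn _) (fun D hD => single_mem_chainsOn ?_) hz
        have h1 : D.maslov = 2 := hD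
        refine ⟨?_, ?_⟩
        · rw [hasDegree_iff]
          change D.maslov + (totalLength (n := n) (fun _ => []) : ℚ) = _
          rw [h1]; simp [totalLength]
        · change D.maslov ≠ 0
          rw [h1]; norm_num
      · refine lin_mem (N := chainsOn _) (fun D hD => single_mem_chainsOn ?_) (hw j)
        have h1 := hD.1
        have h2 := totalLength_update (n := n) (fun _ => []) j [1]
        refine ⟨?_, ?_⟩
        · rw [hasDegree_iff]
          change D.maslov + (totalLength (e j) : ℚ) = _
          have h3 : totalLength (e j) = 1 := by
            simpa [totalLength] using h2
          rw [h1, h3]; norm_num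
        · change D.maslov ≠ 0
          rw [h1]; norm_num
    intro t ht
    refine ⟨(hmem ht).1, fun x hx => (hmem ht).2 ?_⟩
    rw [hx, maslov_constDomain]
  · rw [emptyPart_annulusCount, hempty, G.hCoeff_eq, hrow]
  · rw [emptyPart_annulusCount, hempty, G.vCoeff_eq, hcol]

/-! ### Cochains -/

section Cochains

variable {S : Set (Triple n)} {k : ℕ}

theorem eval_gen_of_mem (f : Cochain S k) {t : Triple n} (h : t ∈ S ∧ t.HasDegree k) :
    Cochain.eval f (gen t) = f ⟨t, h⟩ := by
  classical
  exact (lin_single _ _).trans (dif_pos h)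

theorem eval_gen_of_not_mem (f : Cochain S k) {t : Triple n} (h : ¬ (t ∈ S ∧ t.HasDegree k)) :
    Cochain.eval f (gen t) = 0 := by
  classical
  exact (lin_single _ _).trans (dif_neg h)

theorem eval_add (f g : Cochain S k) : Cochain.eval (f + g) = Cochain.eval f + Cochain.eval g :=
  linearMap_ext_single fun t => by
    change Cochain.eval (f + g) (gen t) = Cochain.eval f (gen t) + Cochain.eval g (gen t)
    by_cases h : t ∈ S ∧ t.HasDegree k
    · rw [eval_gen_of_mem _ h, eval_gen_of_mem _ h, eval_gen_of_mem _ h]; rfl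
    · rw [eval_gen_of_not_mem _ h, eval_gen_of_not_mem _ h, eval_gen_of_not_mem _ h, add_zero]

/-- Linear maps that agree on the generators of a set of triples agree on its span. -/
theorem eq_of_chainsOn {X M : Type*} [AddCommGroup M] [Module (ZMod 2) M] {S : Set X}
    {φ ψ : (X →₀ ZMod 2) →ₗ[ZMod 2] M}
    (h : ∀ x ∈ S, φ (Finsupp.single x 1) = ψ (Finsupp.single x 1)) {z : X →₀ ZMod 2}
    (hz : z ∈ chainsOn S) : φ z = ψ z := by
  rw [← sub_eq_zero, ← LinearMap.sub_apply, ← Submodule.mem_bot (ZMod 2)]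
  refine map_mem_of_chainsOn _ (fun x hx => ?_) hz
  rw [Submodule.mem_bot, LinearMap.sub_apply, h x hx, sub_self]

theorem eval_coboundary (G : GridDiagram n) (h : Cochain S k) {z : Chain n}
    (hz : z ∈ chainsOn {t | t ∈ S ∧ t.HasDegree (k + 1)}) :
    Cochain.eval (G.coboundary h) z = Cochain.eval h (G.boundary z) :=
  eq_of_chainsOn (ψ := Cochain.eval h ∘ₗ G.boundary) (fun _ ht => eval_gen_of_mem _ ht) hz

/-- A set of triples which contains with a triple all triples whose domain does not have larger
multiplicity at `O_1`.  Such a set spans a subcomplex. -/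
def IsCornerClosed (G : GridDiagram n) (S : Set (Triple n)) : Prop :=
  ∀ s t : Triple n, t ∈ S →
    s.dom.coeff (G.Ocol 0) (G.Orow 0) ≤ t.dom.coeff (G.Ocol 0) (G.Orow 0) → s ∈ S

theorem boundary_mem (G : GridDiagram n) (hS : IsCornerClosed G S) {z : Chain n}
    (hz : z ∈ chainsOn {t | t ∈ S ∧ t.HasDegree (k + 1)}) :
    G.boundary z ∈ chainsOn {t | t ∈ S ∧ t.HasDegree k} :=
  map_mem_of_chainsOn _ (fun t ht => chainsOn_mono
    (fun s hs => by exact ⟨hS s t ht.1 (hs.2 _ _), hs.1⟩) (boundary_gen_mem G ht.2)) hz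

theorem coboundary_add (G : GridDiagram n) (f g : Cochain S k) :
    G.coboundary (f + g) = G.coboundary f + G.coboundary g := by
  funext t
  change Cochain.eval (f + g) _ = Cochain.eval f _ + Cochain.eval g _
  rw [eval_add]; rfl

theorem coboundary_coboundary (hn : 2 ≤ n) (G : GridDiagram n) (hS : IsCornerClosed G S)
    (h : Cochain S k) : G.coboundary (G.coboundary h) = 0 := by
  funext t
  change Cochain.eval (G.coboundary h) (G.boundary (gen t.1)) = 0
  have ht : gen t.1 ∈ chainsOn {t | t ∈ S ∧ t.HasDegree (k + 1 + 1)} := single_mem_chainsOn t.2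
  rw [eval_coboundary G h (boundary_mem G hS ht), G.boundary_boundary hn,
    map_zero]

theorem eval_coboundary_of_cycle (G : GridDiagram n) (h : Cochain S k) {z : Chain n}
    (hz : z ∈ chainsOn {t | t ∈ S ∧ t.HasDegree (k + 1)}) (h0 : G.boundary z = 0) :
    Cochain.eval (G.coboundary h) z = 0 := by
  rw [eval_coboundary G h hz, h0, map_zero]

theorem eval_coboundary_bubblePair (G : GridDiagram n) (h : Cochain S k) (i j : Fin n) :
    Cochain.eval (G.coboundary h) (gen (bubblePair i j)) = 0 := by
  by_cases hm : bubblePair i j ∈ S ∧ (bubblePair i j).HasDegree (k + 1)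
  · exact eval_coboundary_of_cycle G h (single_mem_chainsOn hm) (boundary_bubblePair G i j)
  · exact eval_gen_of_not_mem _ hm

/-- Cochains which agree on all cycles differ by a coboundary. -/
theorem exists_eq_add_coboundary (G : GridDiagram n) (hS : IsCornerClosed G S)
    {f f' : Cochain S (k + 1)} (h : ∀ z ∈ chainsOn {t | t ∈ S ∧ t.HasDegree (k + 1)},
      G.boundary z = 0 → Cochain.eval f' z = Cochain.eval f z) :
    ∃ g : Cochain S k, f' = f + G.coboundary g := by
  let C : Submodule (ZMod 2) (Chain n) := chainsOn {t | t ∈ S ∧ t.HasDegree (k + 1)}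
  obtain ⟨H, hH⟩ := exists_factor_of_ker_le (V := C) (W := Chain n) (G.boundary ∘ₗ C.subtype)
    ((Cochain.eval f' - Cochain.eval f) ∘ₗ C.subtype) fun z hz => by
      rw [LinearMap.mem_ker] at hz ⊢
      exact sub_eq_zero.2 (h z.1 z.2 hz)
  refine ⟨fun t => H (gen t.1), ?_⟩
  funext t
  have h1 := LinearMap.congr_fun hH ⟨gen t.1, single_mem_chainsOn t.2⟩
  change Cochain.eval f' (gen t.1) - Cochain.eval f (gen t.1) = H (G.boundary (gen t.1)) at h1
  rw [eval_gen_of_mem f' t.2, eval_gen_of_mem f t.2, sub_eq_iff_eq_add'] at h1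
  refine h1.trans ?_
  change f t + H (G.boundary (gen t.1)) = f t + Cochain.eval _ (G.boundary (gen t.1))
  have ht : gen t.1 ∈ C := single_mem_chainsOn t.2
  exact congrArg _ (eq_of_chainsOn (fun s hs =>
    (eval_gen_of_mem (fun u : {u : Triple n // u ∈ S ∧ u.HasDegree k} => H (gen u.1)) hs).symm)
    (boundary_mem G hS ht))

theorem eval_eq_of_mem_bubbleBoundaries (G : GridDiagram n) {f f' : Cochain S 2}
    (h : G.coboundary f' = G.coboundary f) (hb : ∀ i j : Fin n, i < j →
      Cochain.eval f' (gen (bubblePair i j)) = Cochain.eval f (gen (bubblePair i j)))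
    {c : Chain n} (hc : c ∈ bubbleBoundaries G S) : Cochain.eval f' c = Cochain.eval f c := by
  suffices h : bubbleBoundaries G S ≤ LinearMap.ker (Cochain.eval f' - Cochain.eval f) from
    sub_eq_zero.1 (h hc)
  refine sup_le ?_ (Submodule.span_le.2 ?_)
  · rintro _ ⟨z, hz, rfl⟩
    rw [LinearMap.mem_ker, LinearMap.sub_apply, ← eval_coboundary G f' hz,
      ← eval_coboundary G f hz, h, sub_self]
  · rintro _ ⟨i, j, hij, rfl⟩
    rw [SetLike.mem_coe, LinearMap.mem_ker, LinearMap.sub_apply, hb i j hij, sub_self]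

end Cochains

theorem isCornerClosed_full (G : GridDiagram n) : IsCornerClosed G (full n) :=
  fun _ _ _ _ => trivial

theorem isCornerClosed_blocked (G : GridDiagram n) : IsCornerClosed G G.blocked :=
  fun _ _ ht hle => Nat.le_zero.1 (hle.trans_eq ht)

/-- On a two-dimensional cycle, the horizontal and the vertical annuli occur equally often. -/
theorem annulusCount_row_eq_col (hn : 2 ≤ n) (G : GridDiagram n) {z : Chain n}
    (h0 : G.boundary z = 0) (c r : Fin n) : annulusCount (rowCoeff r) (emptyPart z)
      = annulusCount (colCoeff c) (emptyPart z) := by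
  have h1 := squareCount_domOp hn c r (emptyPart z)
  rw [← emptyPart_boundary G, h0, map_zero, map_zero] at h1
  calc _ = annulusCount (rowCoeff r) (emptyPart z) + (annulusCount (colCoeff c) (emptyPart z)
          + annulusCount (rowCoeff r) (emptyPart z)) := by rw [← h1, add_zero]
    _ = _ := by rw [add_left_comm, add_self_zmod_two, add_zero]

/-- Frame assignments on the full complex: every 2-cycle is congruent to a multiple of `U` modulo
boundaries and the triples with two partitions of `1`. -/
theorem frame_full_iff (hn : 2 ≤ n) (G : GridDiagram n) {U : Chain n} (hU : G.IsUPrime U)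
    {o : Cochain (full n) 3} {f : Cochain (full n) 2} (hf : G.IsFrameAssignment o f)
    (f' : Cochain (full n) 2) :
    (G.IsFrameAssignment o f' ∧ (∀ j k : Fin n, j < k →
        Cochain.eval f' (gen (bubblePair j k)) = Cochain.eval f (gen (bubblePair j k))) ∧
      Cochain.eval f' U = Cochain.eval f U) ↔
    ∃ h : Cochain (full n) 1, f' = f + G.coboundary h := by
  have hU2 : U ∈ chainsOn {t | t ∈ full n ∧ t.HasDegree (1 + 1)} := fun t ht =>
    ⟨trivial, (hU.support t ht).1⟩
  constructor
  · rintro ⟨hf', hb, hUU⟩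
    refine exists_eq_add_coboundary G (isCornerClosed_full G) fun z hz hz0 => ?_
    have hrow : annulusCount (rowCoeff (G.Orow 0)) (emptyPart U) = 1 := by
      rw [← hU.horizontal 0, emptyPart_annulusCount]; rfl
    have hcol := annulusCount_row_eq_col hn G hU.cycle (G.Ocol 0) (G.Orow 0)
    have hz1 := annulusCount_row_eq_col hn G hz0 (G.Ocol 0) (G.Orow 0)
    -- subtract the right multiple of `U` in order to get rid of the annuli through the corner
    set a := annulusCount (rowCoeff (G.Orow 0)) (emptyPart z) with ha
    have hmem : z + a • U ∈ bubbleBoundaries G (full n) := by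
      refine cycle_mem_bubbleBoundaries hn G (isCornerClosed_full G)
        (Submodule.add_mem _ hz (Submodule.smul_mem _ _ hU2)) ?_ ?_ ?_
      · rw [map_add, map_smul, hz0, hU.cycle, smul_zero, add_zero]
      · rw [map_add, map_add, map_smul, map_smul, hrow, ← ha, smul_eq_mul, mul_one,
          add_self_zmod_two]
      · rw [map_add, map_add, map_smul, map_smul, ← hcol, hrow, ← hz1, smul_eq_mul, mul_one,
          add_self_zmod_two]
    have := eval_eq_of_mem_bubbleBoundaries G (hf'.trans hf.symm) hb hmem
    rw [map_add, map_add, map_smul, map_smul, hUU] at this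
    exact add_right_cancel this
  · rintro ⟨h, rfl⟩
    refine ⟨?_, fun j k _ => ?_, ?_⟩
    · change G.coboundary (f + G.coboundary h) = o
      rw [coboundary_add, coboundary_coboundary hn G (isCornerClosed_full G), add_zero]
      exact hf
    · rw [eval_add, LinearMap.add_apply, eval_coboundary_bubblePair, add_zero]
    · rw [eval_add, LinearMap.add_apply, eval_coboundary_of_cycle G h hU2 hU.cycle, add_zero]

/-- Frame assignments on the subcomplex of domains that avoid `O_1`: no annulus through `O_1` occurs
in a cycle, so that no additional 2-cycle is needed. -/
theorem frame_blocked_iff (hn : 2 ≤ n) (G : GridDiagram n)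
    {o : Cochain G.blocked 3} {f : Cochain G.blocked 2} (hf : G.IsFrameAssignment o f)
    (f' : Cochain G.blocked 2) :
    (G.IsFrameAssignment o f' ∧ ∀ j k : Fin n, j < k →
        Cochain.eval f' (gen (bubblePair j k)) = Cochain.eval f (gen (bubblePair j k))) ↔
    ∃ h : Cochain G.blocked 1, f' = f + G.coboundary h := by
  classical
  constructor
  · rintro ⟨hf', hb⟩
    refine exists_eq_add_coboundary G (isCornerClosed_blocked G) fun z hz hz0 => ?_
    have hrow : annulusCount (rowCoeff (G.Orow 0)) (emptyPart z) = 0 := by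
      refine (eq_of_chainsOn (φ := annulusCount _ ∘ₗ emptyPart) (ψ := 0) (fun t ht => ?_) hz)
      rw [LinearMap.comp_apply]
      change annulusCount _ (emptyPart (gen t)) = 0
      rw [emptyPart_gen]
      split_ifs
      · rw [annulusCount, lin_single, if_neg]
        intro h
        have h1 : t.dom.coeff (G.Ocol 0) (G.Orow 0) = 0 := ht.1
        rw [h.2] at h1
        simp [rowCoeff] at h1
      · rw [map_zero]
    refine eval_eq_of_mem_bubbleBoundaries G (hf'.trans hf.symm) hb
      (cycle_mem_bubbleBoundaries hn G (isCornerClosed_blocked G) hz hz0 hrow ?_)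
    rw [← annulusCount_row_eq_col hn G hz0 (G.Ocol 0) (G.Orow 0), hrow]
  · rintro ⟨h, rfl⟩
    refine ⟨?_, fun j k _ => ?_⟩
    · change G.coboundary (f + G.coboundary h) = o
      rw [coboundary_add, coboundary_coboundary hn G (isCornerClosed_blocked G), add_zero]
      exact hf
    · rw [eval_add, LinearMap.add_apply, eval_coboundary_bubblePair, add_zero]

end GridCDP

end

theorem proposition8p1 (n : ℕ) [NeZero n] (hn : 2 ≤ n) (G : GridCDP.GridDiagram n) :
    -- cycles `U'` exist
    (∃ U : GridCDP.Chain n, G.IsUPrime U) ∧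
    -- uniqueness on `CDP_*`
    (∀ U : GridCDP.Chain n, G.IsUPrime U →
      ∀ (o : GridCDP.Cochain (GridCDP.full n) 3) (f : GridCDP.Cochain (GridCDP.full n) 2),
        G.IsFrameAssignment o f →
        ∀ f' : GridCDP.Cochain (GridCDP.full n) 2,
          (G.IsFrameAssignment o f' ∧
            (∀ j k : Fin n, j < k →
              GridCDP.Cochain.eval f' (GridCDP.gen (GridCDP.bubblePair j k)) =
                GridCDP.Cochain.eval f (GridCDP.gen (GridCDP.bubblePair j k))) ∧
            GridCDP.Cochain.eval f' U = GridCDP.Cochain.eval f U) ↔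
          ∃ h : GridCDP.Cochain (GridCDP.full n) 1, f' = f + G.coboundary h) ∧
    -- uniqueness on `CDP_*^0`
    (∀ (o : GridCDP.Cochain G.blocked 3) (f : GridCDP.Cochain G.blocked 2),
        G.IsFrameAssignment o f →
        ∀ f' : GridCDP.Cochain G.blocked 2,
          (G.IsFrameAssignment o f' ∧
            ∀ j k : Fin n, j < k →
              GridCDP.Cochain.eval f' (GridCDP.gen (GridCDP.bubblePair j k)) =
                GridCDP.Cochain.eval f (GridCDP.gen (GridCDP.bubblePair j k))) ↔
          ∃ h : GridCDP.Cochain G.blocked 1, f' = f + G.coboundary h) :=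
  ⟨GridCDP.exists_isUPrime hn G, fun _ hU _ _ hf f' => GridCDP.frame_full_iff hn G hU hf f',
    fun _ _ hf f' => GridCDP.frame_blocked_iff hn G hf f'⟩
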